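/- \textbf{Notation.} Let $d\ge 2$ be an integer and set $2^*=\infty$ if $d=2$, $2^*=\frac{2d}{d-2}$ if $d\ge3$. For $2<p<2^*$, $a<\frac{d-2}{2}$ let $b=a+1+d\left(\frac1p-\frac12\right)$, i.e. $p=\frac{2d}{d-2+2(b-a)}$, and $$\vartheta(p,d)=\frac{d(p-2)}{2p},\qquad a_-(p)=\frac{d-2}{2}-\frac{2(d-1)}{p+2},$$ $$\Theta(a,p,d)=\frac{p-2}{32(d-1)p}\Big[(p+2)^2\big(d^2+4a^2-4a(d-2)\big)-4p(p+4)(d-1)\Big].$$ Let $\mathcal D^{1,2}_a(\mathbb R^d)$ be the completion of $C_c^\infty(\mathbb R^d\setminus\{0\})$ for the norm $\big(\int_{\mathbb R^d}|\nabla u|^2|x|^{-2a}\,dx\big)^{1/2}$. Let $\mathsf C(\theta,p,a)\in[0,\infty]$ be the optimal (smallest) constant in $$\Big(\int_{\mathbb R^d}\frac{|u|^p}{|x|^{bp}}\,dx\Big)^{2/p}\le \mathsf C(\theta,p,a)\Big(\int_{\mathbb R^d}\frac{|\nabla u|^2}{|x|^{2a}}\,dx\Big)^{\theta}\Big(\int_{\mathbb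 R^d}\frac{|u|^2}{|x|^{2(a+1)}}\,dx\Big)^{1-\theta}\qquad\forall\,u\in\mathcal D^{1,2}_a(\mathbb R^d),\tag{1}$$ and $\mathsf C^*(\theta,p,a)$ the optimal constant in the same inequality restricted to radial $u\in\mathcal D^{1,2}_a(\mathbb R^d)$. Likewise, on the cylinder $\mathcal C=\mathbb R\times S^{d-1}$ with coordinates $y=(s,\omega)$ and measure $dy=ds\,d\omega$, let $\mathsf C_{\mathcal C}(\theta,p,a)$ be the optimal constant in $$\Big(\int_{\mathcal C}|w|^p\,dy\Big)^{2/p}\le \mathsf C_{\mathcal C}(\theta,p,a)\Big(\int_{\mathcal C}|\nabla w|^2\,dy+\tfrac14(d-2-2a)^2\int_{\mathcal C}|w|^2\,dy\Big)^{\theta}\Big(\int_{\mathcal C}|w|^2\,dy\Big)^{1-\theta}\qquad\forall\,w\in H^1(\mathcal C),\tag{2}$$ and $\mathsf C_{\mathcal C}^*(\theta,p,a)$ the optimal constant in (2) restricted to functions $w$ depending only on $s$. We say that \emph{symmetry breaking occurs} for $(\theta,p,a)$ if $\mathsf C(\theta,p,a)>\mathsf C^*(\theta,p,a)$ and equality in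 (1) is not achieved by any nonzero radial function, and, in the same way, $\mathsf C_{\mathcal C}(\theta,p,a)>\mathsf C_{\mathcal C}^*(\theta,p,a)$ and equality in (2) is not achieved by any nonzero function depending only on $s$. \textbf{Theorem.} Let $d\ge 2$, $2<p<2^*$ and $a<a_-(p)$. Symmetry breaking occurs for $(\theta,p,a)$ if either $$\vartheta(p,d)\le\theta<\Theta(a,p,d)\quad\text{when}\quad a\ge\frac{d-2}{2}-\frac{2\sqrt{d-1}}{\sqrt{(p-2)(p+2)}},$$ or $$\vartheta(p,d)\le\theta\le1\quad\text{when}\quad a<\frac{d-2}{2}-\frac{2\sqrt{d-1}}{\sqrt{(p-2)(p+2)}}.$$ Moreover, if $d\ge2$ and $a<-1/2$, there exist $\varepsilon>0$, $\gamma_1>d/4$ and $\gamma_2>\gamma_1$ such that, for every $\gamma\in(\gamma_1,\gamma_2)$ and every $p\in(2,2+\varepsilon)$, one has $p<2^*$, $\vartheta(p,d)\le\gamma(p-2)\le1$, and symmetry breaking occurs for $(\theta,p,a)$ with $\theta=\gamma(p-2)$. -/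

import Mathlib

open MeasureTheory Filter Topology
open scoped ENNReal ContDiff RealInnerProductSpace

namespace CKN

/-! ### Exponents and thresholds -/

/-- The critical exponent `2^*`: infinite for `d ≤ 2`, and `2 d / (d - 2)` for `d ≥ 3`. -/
noncomputable def twoStar (d : ℕ) : EReal :=
  if d ≤ 2 then ⊤ else ((2 * (d : ℝ) / ((d : ℝ) - 2) : ℝ) : EReal)

/-- `ϑ(p,d) = d (p - 2) / (2 p)`. -/
noncomputable def vartheta (p : ℝ) (d : ℕ) : ℝ := d * (p - 2) / (2 * p)

/-- `Θ(a,p,d)`. -/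
noncomputable def capTheta (a p : ℝ) (d : ℕ) : ℝ :=
  (p - 2) / (32 * ((d : ℝ) - 1) * p) *
    ((p + 2) ^ 2 * ((d : ℝ) ^ 2 + 4 * a ^ 2 - 4 * a * ((d : ℝ) - 2))
      - 4 * p * (p + 4) * ((d : ℝ) - 1))

/-- `a_-(p) = (d - 2) / 2 - 2 (d - 1) / (p + 2)`. -/
noncomputable def aMinus (p : ℝ) (d : ℕ) : ℝ :=
  ((d : ℝ) - 2) / 2 - 2 * ((d : ℝ) - 1) / (p + 2)

/-- The threshold `(d - 2) / 2 - 2 √(d - 1) / √((p - 2) (p + 2))`. -/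
noncomputable def aThreshold (p : ℝ) (d : ℕ) : ℝ :=
  ((d : ℝ) - 2) / 2 - 2 * √((d : ℝ) - 1) / √((p - 2) * (p + 2))

/-- The exponent `b` determined by `p = 2 d / (d - 2 + 2 (b - a))`. -/
noncomputable def bExp (a p : ℝ) (d : ℕ) : ℝ := a + 1 + d * (1 / p - 1 / 2)

/-! ### The inequality on `ℝ^d` -/

/-- `u` belongs to `D^{1,2}_a(ℝ^d)`, and `G` is its gradient. By the weighted Hardy inequality
(valid for `a < (d - 2) / 2`), the completion of `C_c^∞(ℝ^d ∖ {0})` for the norm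
`(∫ |∇u|² / |x|^{2a})^{1/2}` is the set of limits obtained when `φ_n → u` in
`L²(|x|^{-2(a+1)} dx)` and `∇φ_n → G` in `L²(|x|^{-2a} dx)`, with `φ_n ∈ C_c^∞(ℝ^d ∖ {0})`. -/
structure MemD {d : ℕ} (a : ℝ) (u : EuclideanSpace ℝ (Fin d) → ℝ)
    (G : EuclideanSpace ℝ (Fin d) → EuclideanSpace ℝ (Fin d)) : Prop where
  aestronglyMeasurable : AEStronglyMeasurable u volume
  aestronglyMeasurable_grad : AEStronglyMeasurable G volume
  exists_approx : ∃ φ : ℕ → EuclideanSpace ℝ (Fin d) → ℝ,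
    (∀ n, ContDiff ℝ ∞ (φ n) ∧ HasCompactSupport (φ n) ∧ 0 ∉ tsupport (φ n)) ∧
    Tendsto (fun n => ∫⁻ x, ENNReal.ofReal ((φ n x - u x) ^ 2 / ‖x‖ ^ (2 * (a + 1))))
      atTop (𝓝 0) ∧
    Tendsto (fun n => ∫⁻ x, ENNReal.ofReal (‖gradient (φ n) x - G x‖ ^ 2 / ‖x‖ ^ (2 * a)))
      atTop (𝓝 0)

/-- The function `u` is radial, as a class of functions up to null sets. -/
def IsRadial {d : ℕ} (u : EuclideanSpace ℝ (Fin d) → ℝ) : Prop :=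
  ∃ f : ℝ → ℝ, ∀ᵐ x, u x = f ‖x‖

/-- The left-hand side `(∫ |u|^p / |x|^{bp})^{2/p}`. -/
noncomputable def lhsD {d : ℕ} (p a : ℝ) (u : EuclideanSpace ℝ (Fin d) → ℝ) : ℝ≥0∞ :=
  (∫⁻ x, ENNReal.ofReal (|u x| ^ p / ‖x‖ ^ (bExp a p d * p))) ^ (2 / p)

/-- `(∫ |∇u|² / |x|^{2a})^θ (∫ |u|² / |x|^{2(a+1)})^{1-θ}`, where `G = ∇u`. -/
noncomputable def rhsD {d : ℕ} (θ a : ℝ) (u : EuclideanSpace ℝ (Fin d) → ℝ)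
    (G : EuclideanSpace ℝ (Fin d) → EuclideanSpace ℝ (Fin d)) : ℝ≥0∞ :=
  (∫⁻ x, ENNReal.ofReal (‖G x‖ ^ 2 / ‖x‖ ^ (2 * a))) ^ θ *
    (∫⁻ x, ENNReal.ofReal (|u x| ^ 2 / ‖x‖ ^ (2 * (a + 1)))) ^ (1 - θ)

/-- The optimal constant `C(θ,p,a)` on `D^{1,2}_a(ℝ^d)`, with values in `[0,∞]`. -/
noncomputable def optConst (d : ℕ) (θ p a : ℝ) : ℝ≥0∞ :=
  sInf {K | ∀ (u : EuclideanSpace ℝ (Fin d) → ℝ)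
    (G : EuclideanSpace ℝ (Fin d) → EuclideanSpace ℝ (Fin d)),
    MemD a u G → lhsD p a u ≤ K * rhsD θ a u G}

/-- The optimal constant `C^*(θ,p,a)` among the radial functions of `D^{1,2}_a(ℝ^d)`. -/
noncomputable def optConstRadial (d : ℕ) (θ p a : ℝ) : ℝ≥0∞ :=
  sInf {K | ∀ (u : EuclideanSpace ℝ (Fin d) → ℝ)
    (G : EuclideanSpace ℝ (Fin d) → EuclideanSpace ℝ (Fin d)),
    MemD a u G → IsRadial u → lhsD p a u ≤ K * rhsD θ a u G}

/-- Optimality on `D^{1,2}_a(ℝ^d)` is achieved by some nonzero radial function. -/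
def AchievedByRadial (d : ℕ) (θ p a : ℝ) : Prop :=
  ∃ (u : EuclideanSpace ℝ (Fin d) → ℝ)
    (G : EuclideanSpace ℝ (Fin d) → EuclideanSpace ℝ (Fin d)),
    MemD a u G ∧ IsRadial u ∧ ¬ (∀ᵐ x, u x = 0) ∧
      lhsD p a u = optConst d θ p a * rhsD θ a u G

/-! ### The inequality on the cylinder `ℝ × S^{d-1}` -/

/-- The cylinder `ℝ × S^{d-1}`. -/
abbrev Cyl (d : ℕ) : Type := ℝ × Metric.sphere (0 : EuclideanSpace ℝ (Fin d)) 1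

/-- The measure `ds dω`, where `dω` is the (unnormalized) surface measure of the sphere. -/
noncomputable def cylMeasure (d : ℕ) : Measure (Cyl d) :=
  (volume : Measure ℝ).prod (volume : Measure (EuclideanSpace ℝ (Fin d))).toSphere

/-- The derivative along the axis of the restriction of `Φ` to the cylinder. -/
noncomputable def axialDeriv {d : ℕ} (Φ : ℝ × EuclideanSpace ℝ (Fin d) → ℝ) (y : Cyl d) : ℝ :=
  deriv (fun t => Φ (t, (y.2 : EuclideanSpace ℝ (Fin d)))) y.1

/-- The spherical gradient of the restriction of `Φ` to the cylinder: the tangential part of the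
gradient in the second variable. -/
noncomputable def sphericalGrad {d : ℕ} (Φ : ℝ × EuclideanSpace ℝ (Fin d) → ℝ) (y : Cyl d) :
    EuclideanSpace ℝ (Fin d) :=
  gradient (fun x => Φ (y.1, x)) (y.2 : EuclideanSpace ℝ (Fin d)) -
    ⟪(y.2 : EuclideanSpace ℝ (Fin d)),
      gradient (fun x => Φ (y.1, x)) (y.2 : EuclideanSpace ℝ (Fin d))⟫ •
        (y.2 : EuclideanSpace ℝ (Fin d))

/-- `w` belongs to `H¹(ℝ × S^{d-1})`, with axial derivative `g` and spherical gradient `H`: it is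
the limit, for the `H¹` norm, of smooth compactly supported functions on the cylinder (which are
the restrictions of the smooth compactly supported functions on `ℝ × ℝ^d`). -/
structure MemH1 {d : ℕ} (w : Cyl d → ℝ) (g : Cyl d → ℝ)
    (H : Cyl d → EuclideanSpace ℝ (Fin d)) : Prop where
  aestronglyMeasurable : AEStronglyMeasurable w (cylMeasure d)
  aestronglyMeasurable_axial : AEStronglyMeasurable g (cylMeasure d)
  aestronglyMeasurable_spherical : AEStronglyMeasurable H (cylMeasure d)
  exists_approx : ∃ Φ : ℕ → ℝ × EuclideanSpace ℝ (Fin d) → ℝ,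
    (∀ n, ContDiff ℝ ∞ (Φ n) ∧ HasCompactSupport (Φ n)) ∧
    Tendsto (fun n => ∫⁻ y, ENNReal.ofReal ((Φ n (y.1, y.2) - w y) ^ 2) ∂(cylMeasure d))
      atTop (𝓝 0) ∧
    Tendsto (fun n => ∫⁻ y, ENNReal.ofReal ((axialDeriv (Φ n) y - g y) ^ 2) ∂(cylMeasure d))
      atTop (𝓝 0) ∧
    Tendsto (fun n => ∫⁻ y, ENNReal.ofReal (‖sphericalGrad (Φ n) y - H y‖ ^ 2) ∂(cylMeasure d))
      atTop (𝓝 0)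

/-- The function `w` depends only on the axial variable `s`, up to null sets. -/
def IsAxial {d : ℕ} (w : Cyl d → ℝ) : Prop :=
  ∃ f : ℝ → ℝ, ∀ᵐ y ∂(cylMeasure d), w y = f y.1

/-- The left-hand side `(∫ |w|^p)^{2/p}`. -/
noncomputable def lhsCyl {d : ℕ} (p : ℝ) (w : Cyl d → ℝ) : ℝ≥0∞ :=
  (∫⁻ y, ENNReal.ofReal (|w y| ^ p) ∂(cylMeasure d)) ^ (2 / p)

/-- `(∫ |∇w|² + (d - 2 - 2a)²/4 ∫ |w|²)^θ (∫ |w|²)^{1-θ}`, where `∇w = (g, H)`. -/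
noncomputable def rhsCyl {d : ℕ} (θ a : ℝ) (w : Cyl d → ℝ) (g : Cyl d → ℝ)
    (H : Cyl d → EuclideanSpace ℝ (Fin d)) : ℝ≥0∞ :=
  ((∫⁻ y, ENNReal.ofReal (g y ^ 2 + ‖H y‖ ^ 2) ∂(cylMeasure d)) +
      ENNReal.ofReal (((d : ℝ) - 2 - 2 * a) ^ 2 / 4) *
        ∫⁻ y, ENNReal.ofReal (|w y| ^ 2) ∂(cylMeasure d)) ^ θ *
    (∫⁻ y, ENNReal.ofReal (|w y| ^ 2) ∂(cylMeasure d)) ^ (1 - θ)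

/-- The optimal constant of the inequality on the cylinder, with values in `[0,∞]`. -/
noncomputable def optConstCyl (d : ℕ) (θ p a : ℝ) : ℝ≥0∞ :=
  sInf {K | ∀ (w g : Cyl d → ℝ) (H : Cyl d → EuclideanSpace ℝ (Fin d)),
    MemH1 w g H → lhsCyl p w ≤ K * rhsCyl θ a w g H}

/-- The optimal constant on the cylinder among functions that depend only on `s`. -/
noncomputable def optConstAxial (d : ℕ) (θ p a : ℝ) : ℝ≥0∞ :=
  sInf {K | ∀ (w g : Cyl d → ℝ) (H : Cyl d → EuclideanSpace ℝ (Fin d)),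
    MemH1 w g H → IsAxial w → lhsCyl p w ≤ K * rhsCyl θ a w g H}

/-- Optimality on `H¹(ℝ × S^{d-1})` is achieved by some nonzero function of `s` only. -/
def AchievedByAxial (d : ℕ) (θ p a : ℝ) : Prop :=
  ∃ (w g : Cyl d → ℝ) (H : Cyl d → EuclideanSpace ℝ (Fin d)),
    MemH1 w g H ∧ IsAxial w ∧ ¬ (∀ᵐ y ∂(cylMeasure d), w y = 0) ∧
      lhsCyl p w = optConstCyl d θ p a * rhsCyl θ a w g H

/-! ### Symmetry breaking -/

/-- Optimality is not achieved among radial functions on `ℝ^d`, resp. among `s`-dependent functions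
on the cylinder, and the optimal constants are larger than the symmetric ones. -/
structure SymmetryBreaking (d : ℕ) (θ p a : ℝ) : Prop where
  const_lt : optConstRadial d θ p a < optConst d θ p a
  not_achieved : ¬ AchievedByRadial d θ p a
  const_lt_cyl : optConstAxial d θ p a < optConstCyl d θ p a
  not_achieved_cyl : ¬ AchievedByAxial d θ p a

end CKN

namespace CKN

/-! ### The sharp one-dimensional interpolation inequality -/

/-! The proof computes the symmetric optimal constant's upper bound exactly and then beats it with
one non-symmetric trial function. Put `L = (d-2-2a)^2/4`.

Upper bound. The Emden-Fowler change `u ↦ e^{αs} u(e^s z)`, `α = (d-2-2a)/2`, turns weighted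
integrals on the space into integrals on the cylinder, where symmetric functions depend on `s` only.
On the line the inequality is solved by Sz.-Nagy's argument (`nagy_unit`, `gagliardoNirenberg`):
`v'^2 + l(v^2 - |v|^p)` dominates twice the derivative of a primitive evaluated at `v`, with
equality for `w = cosh(ks)^{-2/(p-2)}`. This gives `interpolation_line_sharp`. Approximants of a
symmetric function need not be symmetric, so the line inequality is applied on every line of the
cylinder, followed by Hölder on the sphere and Fatou (`lhsCyl_le_of_tendsto`). Both symmetric
constants are thus at most `symConst`.

Lower bound. Take `w + e ψ(s) z_i` with `z_i` a coordinate on the sphere, a spherical harmonic of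
eigenvalue `d-1`, and `ψ = w^{p/2}`. If `l` is the squared decay rate of `w`, then `ψ` is the ground
state of the linearized operator `-∂² + l - (p/2)(p-1) l w^{p-2}`, with eigenvalue `-l(p^2-4)/4`.
The second variation in this direction has the sign of `d-1 - l(p^2-4)/4`, so it is negative exactly
when `4(d-1) < l(p^2-4)` (`second_variation_neg`, `symmetryBreaking_of_freq`). A truncation makes
the trial function admissible in both settings, and both optimal constants exceed `symConst`. Finite
positive right-hand sides then exclude symmetric extremals.

Conclusion. The criticality of `w` gives `l = L(p+2)/(2pθ-(p-2))`, and the frequency condition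
solved for `θ` is `θ < Θ(a,p,d)`. The square-root threshold on `a` is where `Θ = 1`, and the last
claim compares the limits of `ϑ/(p-2)` and `Θ/(p-2)` as `p → 2`. -/

/-- The odd primitive of `√(t² - |t|^p)`. -/
noncomputable def nagyPrim (p x : ℝ) : ℝ := ∫ t in (0 : ℝ)..x, √(t ^ 2 - |t| ^ p)

lemma continuous_nagyIntegrand {p : ℝ} (hp : 2 < p) :
    Continuous fun t : ℝ => √(t ^ 2 - |t| ^ p) :=
  ((continuous_id.pow 2).sub
    (continuous_abs.rpow_const fun _ => Or.inr (by linarith))).sqrt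

lemma hasDerivAt_nagyPrim {p : ℝ} (hp : 2 < p) (x : ℝ) :
    HasDerivAt (nagyPrim p) (√(x ^ 2 - |x| ^ p)) x :=
  (continuous_nagyIntegrand hp).integral_hasStrictDerivAt 0 x |>.hasDerivAt

lemma nagyPrim_zero (p : ℝ) : nagyPrim p 0 = 0 := by simp [nagyPrim]

lemma contDiff_nagyPrim {p : ℝ} (hp : 2 < p) : ContDiff ℝ 1 (nagyPrim p) := by
  rw [contDiff_one_iff_deriv]
  refine ⟨fun x => (hasDerivAt_nagyPrim hp x).differentiableAt, ?_⟩
  have : deriv (nagyPrim p) = fun t : ℝ => √(t ^ 2 - |t| ^ p) :=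
    funext fun x => (hasDerivAt_nagyPrim hp x).deriv
  rw [this]
  exact continuous_nagyIntegrand hp

lemma integrable_abs_rpow {v : ℝ → ℝ} (hv : Continuous v) (hc : HasCompactSupport v)
    {p : ℝ} (hp : 0 < p) : Integrable fun s => |v s| ^ p := by
  refine Continuous.integrable_of_hasCompactSupport
    (hv.abs.rpow_const fun _ => Or.inr hp.le) ?_
  exact hc.comp_left (g := fun x : ℝ => |x| ^ p) (by simp [Real.zero_rpow hp.ne'])

lemma integrable_sq {v : ℝ → ℝ} (hv : Continuous v) (hc : HasCompactSupport v) :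
    Integrable fun s => v s ^ 2 :=
  Continuous.integrable_of_hasCompactSupport (hv.pow 2)
    (hc.comp_left (g := fun x : ℝ => x ^ 2) (by simp))

/-- Sz.-Nagy's inequality for functions with maximum `1`. -/
lemma nagy_unit {p l : ℝ} (hp : 2 < p) (hl : 0 < l) {v : ℝ → ℝ} (hv : ContDiff ℝ 1 v)
    (hc : HasCompactSupport v) (hle : ∀ s, |v s| ≤ 1) {s₀ : ℝ} (h1 : v s₀ = 1) :
    l * (∫ s, |v s| ^ p) + 4 * √l * nagyPrim p 1 ≤ (∫ s, deriv v s ^ 2) + l * ∫ s, v s ^ 2 := by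
  have hd : Continuous (deriv v) := hv.continuous_deriv le_rfl
  have iA := integrable_abs_rpow hv.continuous hc (p := p) (by linarith)
  have iY := integrable_sq hv.continuous hc
  have iX := integrable_sq hd hc.deriv
  have hP : ContDiff ℝ 1 (nagyPrim p ∘ v) := (contDiff_nagyPrim hp).comp hv
  have hPc : HasCompactSupport (nagyPrim p ∘ v) := hc.comp_left (nagyPrim_zero p)
  have hder : ∀ s, deriv (nagyPrim p ∘ v) s = √(v s ^ 2 - |v s| ^ p) * deriv v s := fun s =>
    ((hasDerivAt_nagyPrim hp (v s)).comp s
      (hv.differentiable one_ne_zero s).hasDerivAt).deriv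
  have iP : Integrable (deriv (nagyPrim p ∘ v)) :=
    (hP.continuous_deriv le_rfl).integrable_of_hasCompactSupport hPc.deriv
  have e1 := hPc.integral_Iic_deriv_eq hP s₀
  have e2 := hPc.integral_Ioi_deriv_eq hP s₀
  simp only [Function.comp_apply, h1] at e1 e2
  set F : ℝ → ℝ := fun s => deriv v s ^ 2 + l * v s ^ 2 - l * |v s| ^ p with hF
  have iF : Integrable F := (iX.add (iY.const_mul l)).sub (iA.const_mul l)
  -- Young's inequality `2|xy| ≤ x² + y²` with `x = v'` and `y = √l √(v² - |v|^p)`; the hypothesis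
  -- `|v| ≤ 1` makes the radicand nonnegative.
  have key : ∀ s, |2 * √l * deriv (nagyPrim p ∘ v) s| ≤ F s := by
    intro s
    rw [hder]
    have hg : 0 ≤ v s ^ 2 - |v s| ^ p := by
      have : |v s| ^ p ≤ |v s| ^ (2 : ℝ) :=
        Real.rpow_le_rpow_of_exponent_ge' (abs_nonneg _) (hle s) (by norm_num) hp.le
      rw [Real.rpow_two, sq_abs] at this
      linarith
    have hs := Real.sq_sqrt hg
    have hsl := Real.sq_sqrt hl.le
    rw [abs_le]
    have e : F s = deriv v s ^ 2 + (√l * √(v s ^ 2 - |v s| ^ p)) ^ 2 := by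
      rw [mul_pow, hs, hsl, hF]; ring
    rw [e]
    constructor <;> nlinarith [sq_nonneg (deriv v s - √l * √(v s ^ 2 - |v s| ^ p)),
      sq_nonneg (deriv v s + √l * √(v s ^ 2 - |v s| ^ p))]
  -- The primitive of `v` climbs from `0` to `nagyPrim p 1` up to `s₀` and returns to `0` after it.
  -- Using opposite signs on the two half-lines, each contributes `2√l · nagyPrim p 1`.
  have h3 : ∫ s in Set.Iic s₀, 2 * √l * deriv (nagyPrim p ∘ v) s ≤ ∫ s in Set.Iic s₀, F s :=
    setIntegral_mono (iP.const_mul _).integrableOn iF.integrableOn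
      fun s => (le_abs_self _).trans (key s)
  have h4 : ∫ s in Set.Ioi s₀, -(2 * √l * deriv (nagyPrim p ∘ v) s) ≤ ∫ s in Set.Ioi s₀, F s :=
    setIntegral_mono (iP.const_mul _).neg.integrableOn iF.integrableOn
      fun s => (neg_le_abs _).trans (key s)
  rw [integral_const_mul, e1] at h3
  rw [integral_neg, integral_const_mul, e2] at h4
  have h5 := intervalIntegral.integral_Iic_add_Ioi iF.integrableOn (iF.integrableOn (s := Set.Ioi s₀))
  have h6 : ∫ s, F s = (∫ s, deriv v s ^ 2) + l * (∫ s, v s ^ 2) - l * ∫ s, |v s| ^ p := by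
    have iXY : Integrable fun s => deriv v s ^ 2 + l * v s ^ 2 := iX.add (iY.const_mul l)
    rw [hF, ← integral_const_mul, ← integral_const_mul, ← integral_add iX (iY.const_mul l),
      ← integral_sub iXY (iA.const_mul l)]
  linarith

/-- Sz.-Nagy's inequality. -/
lemma nagy {p : ℝ} (hp : 2 < p) {v : ℝ → ℝ} (hv : ContDiff ℝ 1 v)
    (hc : HasCompactSupport v) (h0 : v ≠ 0) :
    ∃ M : ℝ, 0 < M ∧ ∀ l : ℝ, 0 < l →
      l * M ^ (2 - p) * (∫ s, |v s| ^ p) + 4 * √l * nagyPrim p 1 * M ^ 2 ≤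
        (∫ s, deriv v s ^ 2) + l * ∫ s, v s ^ 2 := by
  obtain ⟨s₀, hs₀⟩ := hv.continuous.abs.exists_forall_ge_of_hasCompactSupport
    (hc.comp_left (g := fun x : ℝ => |x|) (by simp))
  have hM : 0 < |v s₀| := by
    obtain ⟨s, hs⟩ := Function.ne_iff.1 h0
    exact (abs_pos.2 hs).trans_le (hs₀ s)
  have hne : v s₀ ≠ 0 := abs_pos.1 hM
  refine ⟨|v s₀|, hM, fun l hl => ?_⟩
  -- Dividing by the signed value `v s₀` rather than by its modulus makes the normalized function
  -- equal to `+1` at its extremum.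
  have hu : ContDiff ℝ 1 (fun s => (v s₀)⁻¹ * v s) := contDiff_const.mul hv
  have hder : ∀ s, deriv (fun s => (v s₀)⁻¹ * v s) s = (v s₀)⁻¹ * deriv v s := fun s =>
    deriv_const_mul _ (hv.differentiable one_ne_zero s)
  have := nagy_unit hp hl hu (hc.mul_left (f := fun _ => (v s₀)⁻¹)) (fun s => by
    rw [abs_mul, abs_inv, inv_mul_le_iff₀ hM, mul_one]; exact hs₀ s) (s₀ := s₀)
    (inv_mul_cancel₀ hne)
  simp only [hder, mul_pow, abs_mul, abs_inv, Real.mul_rpow (inv_nonneg.2 (abs_nonneg (v s₀)))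
    (abs_nonneg _), integral_const_mul] at this
  rw [Real.inv_rpow hM.le] at this
  have h2 : |v s₀| ^ (2 - p) = |v s₀| ^ 2 * (|v s₀| ^ p)⁻¹ := by
    rw [Real.rpow_sub hM, Real.rpow_two, div_eq_mul_inv]
  have h3 : (v s₀)⁻¹ ^ 2 = (|v s₀| ^ 2)⁻¹ := by rw [inv_pow, sq_abs]
  rw [h2]
  rw [h3] at this
  have hM2 : 0 < |v s₀| ^ 2 := by positivity
  have := mul_le_mul_of_nonneg_left this hM2.le
  calc _ = |v s₀| ^ 2 * (l * ((|v s₀| ^ p)⁻¹ * ∫ s, |v s| ^ p) + 4 * √l * nagyPrim p 1) := by ring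
    _ ≤ _ := this
    _ = _ := by field_simp

lemma integral_sq_pos {v : ℝ → ℝ} (hv : Continuous v) (hc : HasCompactSupport v) (h0 : v ≠ 0) :
    0 < ∫ s, v s ^ 2 := by
  obtain ⟨s, hs⟩ := Function.ne_iff.1 h0
  exact (hv.pow 2).integral_pos_of_hasCompactSupport_nonneg_nonzero
    (hc.comp_left (g := fun x : ℝ => x ^ 2) (by simp)) (fun s => sq_nonneg _)
    (x := s) (pow_ne_zero 2 hs)

lemma deriv_ne_zero_of_hasCompactSupport {v : ℝ → ℝ} (hv : ContDiff ℝ 1 v)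
    (hc : HasCompactSupport v) (h0 : v ≠ 0) : deriv v ≠ 0 := by
  intro h
  apply h0
  have hconst := is_const_of_deriv_eq_zero (hv.differentiable one_ne_zero)
    (fun x => congrFun h x)
  obtain ⟨y, hy⟩ : ∃ y, y ∉ tsupport v := by
    by_contra! hall
    exact noncompact_univ ℝ ((Set.eq_univ_of_forall hall) ▸ hc.isCompact)
  funext x
  rw [hconst x y, image_eq_zero_of_notMem_tsupport hy]; rfl

/-- The sharp Gagliardo-Nirenberg inequality on the line, normalized by the values `X₀, Y₀, A₀`
of the three integrals at an optimizer. -/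
lemma gagliardoNirenberg {p l₀ X₀ Y₀ A₀ : ℝ} (hp : 2 < p) (hl₀ : 0 < l₀) (hX₀ : 0 < X₀)
    (hP : 2 * √l₀ * nagyPrim p 1 = X₀) (hA : l₀ * A₀ * (p - 2) = 4 * X₀)
    (hY : l₀ * Y₀ * (p - 2) = (p + 2) * X₀) {v : ℝ → ℝ} (hv : ContDiff ℝ 1 v)
    (hc : HasCompactSupport v) :
    ((∫ s, |v s| ^ p) / A₀) ^ (2 / p) ≤
      ((∫ s, deriv v s ^ 2) / X₀) ^ ((p - 2) / (2 * p)) *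
        ((∫ s, v s ^ 2) / Y₀) ^ ((p + 2) / (2 * p)) := by
  have hA₀ : 0 < A₀ := by
    by_contra! h
    have : l₀ * A₀ * (p - 2) ≤ 0 :=
      mul_nonpos_of_nonpos_of_nonneg (mul_nonpos_of_nonneg_of_nonpos hl₀.le h) (by linarith)
    linarith
  have hY₀ : 0 < Y₀ := by
    by_contra! h
    have : l₀ * Y₀ * (p - 2) ≤ 0 :=
      mul_nonpos_of_nonpos_of_nonneg (mul_nonpos_of_nonneg_of_nonpos hl₀.le h) (by linarith)
    nlinarith
  by_cases h0 : v = 0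
  · subst h0
    have hp0 : p ≠ 0 := by linarith
    have : (0 : ℝ) ^ (2 / p) = 0 := Real.zero_rpow (by positivity)
    simp only [Pi.zero_apply, abs_zero, Real.zero_rpow hp0, integral_zero, zero_div, this]
    positivity
  have hd : Continuous (deriv v) := hv.continuous_deriv le_rfl
  have hXpos := integral_sq_pos hd hc.deriv (deriv_ne_zero_of_hasCompactSupport hv hc h0)
  have hYpos := integral_sq_pos hv.continuous hc h0
  obtain ⟨M, hM, hN⟩ := nagy hp hv hc h0
  set X := ∫ s, deriv v s ^ 2
  set Y := ∫ s, v s ^ 2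
  set A := ∫ s, |v s| ^ p
  have hAnn : 0 ≤ A := integral_nonneg fun s => Real.rpow_nonneg (abs_nonneg _) _
  set x := X / X₀ with hx
  set y := Y / Y₀ with hy
  set b := A / A₀ with hb
  have hx0 : 0 < x := by positivity
  have hy0 : 0 < y := by positivity
  have hb0 : 0 ≤ b := by positivity
  have hXx : X = x * X₀ := by rw [hx]; field_simp
  have hYy : Y = y * Y₀ := by rw [hy]; field_simp
  have hAb : A = b * A₀ := by rw [hb]; field_simp
  set m := x / y with hm
  have hm0 : 0 < m := by positivity
  -- The free parameter is chosen so that `m * y = x`: after normalization the gradient and mass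
  -- terms stand in the fixed ratio `p-2 : p+2` of the optimizer.
  have h1 := hN (m * l₀) (by positivity)
  rw [Real.sqrt_mul hm0.le] at h1
  -- the normalized linear inequality
  have h2 : 4 * (m * M ^ (2 - p) * b) + 2 * (p - 2) * (√m * M ^ 2) ≤ 2 * p * x := by
    have hmy : m * y = x := by rw [hm]; field_simp
    rw [hXx, hYy, hAb] at h1
    have h3 : (p - 2) * (m * l₀ * M ^ (2 - p) * (b * A₀) +
        4 * (√m * √l₀) * nagyPrim p 1 * M ^ 2) ≤ (p - 2) * (x * X₀ + m * l₀ * (y * Y₀)) :=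
      mul_le_mul_of_nonneg_left h1 (by linarith)
    have e1 : (p - 2) * (m * l₀ * M ^ (2 - p) * (b * A₀) +
        4 * (√m * √l₀) * nagyPrim p 1 * M ^ 2) =
        (4 * (m * M ^ (2 - p) * b) + 2 * (p - 2) * (√m * M ^ 2)) * X₀ := by
      linear_combination (m * M ^ (2 - p) * b) * hA + (2 * (p - 2) * √m * M ^ 2) * hP
    have e2 : (p - 2) * (x * X₀ + m * l₀ * (y * Y₀)) = 2 * p * x * X₀ := by
      linear_combination (m * y) * hY + (p + 2) * X₀ * hmy
    rw [e1, e2] at h3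
    exact le_of_mul_le_mul_right h3 hX₀
  have hp0 : 0 < p := by linarith
  -- The weights `2/p` and `(p-2)/p` are those for which the powers of the unknown maximum `M`
  -- cancel in the geometric mean.
  have h4 := Real.geom_mean_le_arith_mean2_weighted (w₁ := 2 / p) (w₂ := (p - 2) / p)
    (p₁ := m * M ^ (2 - p) * b) (p₂ := √m * M ^ 2) (by positivity)
    (div_nonneg (by linarith) hp0.le) (by positivity) (by positivity) (by field_simp; ring)
  have h5 : 2 / p * (m * M ^ (2 - p) * b) + (p - 2) / p * (√m * M ^ 2) ≤ x := by
    rw [← mul_le_mul_iff_right₀ (by positivity : 0 < 2 * p)]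
    calc _ = 4 * (m * M ^ (2 - p) * b) + 2 * (p - 2) * (√m * M ^ 2) := by field_simp; ring
      _ ≤ _ := h2
  have h6 : (m * M ^ (2 - p) * b) ^ (2 / p) * (√m * M ^ 2) ^ ((p - 2) / p) =
      m ^ ((p + 2) / (2 * p)) * b ^ (2 / p) := by
    rw [Real.mul_rpow (by positivity) hb0, Real.mul_rpow hm0.le (by positivity),
      Real.mul_rpow (by positivity) (by positivity), Real.sqrt_eq_rpow, ← Real.rpow_mul hm0.le,
      ← Real.rpow_mul hM.le, ← Real.rpow_natCast M 2, ← Real.rpow_mul hM.le]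
    have e1 : (m : ℝ) ^ ((p + 2) / (2 * p)) = m ^ (2 / p) * m ^ (1 / 2 * ((p - 2) / p)) := by
      rw [← Real.rpow_add hm0]; congr 1; field_simp; ring
    have e2 : M ^ ((2 - p) * (2 / p)) * M ^ (((2 : ℕ) : ℝ) * ((p - 2) / p)) = 1 := by
      rw [← Real.rpow_add hM, ← Real.rpow_zero M]; congr 1; field_simp; push_cast; ring
    rw [e1]
    linear_combination (m ^ (2 / p) * m ^ (1 / 2 * ((p - 2) / p)) * b ^ (2 / p)) * e2
  have h7 : m ^ ((p + 2) / (2 * p)) * b ^ (2 / p) ≤ x := h6 ▸ h4.trans h5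
  have h8 : m ^ ((p + 2) / (2 * p)) * y ^ ((p + 2) / (2 * p)) = x ^ ((p + 2) / (2 * p)) := by
    rw [← Real.mul_rpow hm0.le hy0.le, hm, div_mul_cancel₀ _ hy0.ne']
  have h9 : x ^ ((p - 2) / (2 * p)) * x ^ ((p + 2) / (2 * p)) = x := by
    rw [← Real.rpow_add hx0]
    conv_rhs => rw [← Real.rpow_one x]
    congr 1; field_simp; ring
  have hmp : 0 < m ^ ((p + 2) / (2 * p)) := by positivity
  rw [← mul_le_mul_iff_right₀ hmp]
  calc _ ≤ x := h7
    _ = x ^ ((p - 2) / (2 * p)) * (m ^ ((p + 2) / (2 * p)) * y ^ ((p + 2) / (2 * p))) := by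
        rw [h8, h9]
    _ = _ := by ring

/-- The sharp interpolation inequality on the line with the energy `∫ v'² + L ∫ v²`. -/
lemma interpolation_line {p l₀ X₀ Y₀ A₀ L θ : ℝ} (hp : 2 < p) (hl₀ : 0 < l₀) (hX₀ : 0 < X₀)
    (hY₀ : 0 < Y₀)
    (hP : 2 * √l₀ * nagyPrim p 1 = X₀) (hA : l₀ * A₀ * (p - 2) = 4 * X₀)
    (hY : l₀ * Y₀ * (p - 2) = (p + 2) * X₀) (hL : 0 < L) (hθ : (p - 2) / (2 * p) < θ)
    (hcrit : θ * X₀ = (p - 2) / (2 * p) * (X₀ + L * Y₀)) {v : ℝ → ℝ} (hv : ContDiff ℝ 1 v)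
    (hc : HasCompactSupport v) :
    ((∫ s, |v s| ^ p) / A₀) ^ (2 / p) ≤
      (((∫ s, deriv v s ^ 2) + L * ∫ s, v s ^ 2) / (X₀ + L * Y₀)) ^ θ *
        ((∫ s, v s ^ 2) / Y₀) ^ (1 - θ) := by
  refine (gagliardoNirenberg hp hl₀ hX₀ hP hA hY hv hc).trans ?_
  by_cases h0 : v = 0
  · subst h0
    have hq : (0 : ℝ) ^ ((p + 2) / (2 * p)) = 0 := Real.zero_rpow (by positivity)
    simp only [Pi.zero_apply, zero_pow two_ne_zero, integral_zero, zero_div, hq, mul_zero]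
    positivity
  have hd : Continuous (deriv v) := hv.continuous_deriv le_rfl
  have hXpos := integral_sq_pos hd hc.deriv (deriv_ne_zero_of_hasCompactSupport hv hc h0)
  have hYpos := integral_sq_pos hv.continuous hc h0
  set X := ∫ s, deriv v s ^ 2
  set Y := ∫ s, v s ^ 2
  set q := (p - 2) / (2 * p) with hq
  have hq0 : 0 < q := div_pos (by linarith) (by linarith)
  have hq1 : (p + 2) / (2 * p) = 1 - q := by rw [hq]; field_simp; ring
  have hθ0 : 0 < θ := hq0.trans hθ
  have hE₀ : 0 < X₀ + L * Y₀ := by positivity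
  have hx0 : 0 < X / X₀ := by positivity
  have hy0 : 0 < Y / Y₀ := by positivity
  -- By `hcrit` the weight `q/θ` is the share `X₀/(X₀ + L Y₀)` of the gradient in the optimizer's
  -- energy, so the arithmetic mean is the normalized energy and nothing is lost at the optimizer.
  have h1 := Real.geom_mean_le_arith_mean2_weighted (w₁ := q / θ) (w₂ := 1 - q / θ)
    (p₁ := X / X₀) (p₂ := Y / Y₀) (by positivity)
    (sub_nonneg.2 ((div_le_one hθ0).2 hθ.le)) hx0.le hy0.le (by ring)
  have h2 : q / θ * (X / X₀) + (1 - q / θ) * (Y / Y₀) = (X + L * Y) / (X₀ + L * Y₀) := by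
    have e : q / θ = X₀ / (X₀ + L * Y₀) := by
      rw [div_eq_div_iff hθ0.ne' hE₀.ne']; linarith
    rw [e]; field_simp; ring
  rw [h2] at h1
  have h3 := Real.rpow_le_rpow (by positivity) h1 hθ0.le
  rw [Real.mul_rpow (by positivity) (by positivity), ← Real.rpow_mul hx0.le,
    ← Real.rpow_mul hy0.le, div_mul_cancel₀ _ hθ0.ne'] at h3
  calc (X / X₀) ^ q * (Y / Y₀) ^ ((p + 2) / (2 * p))
      = (X / X₀) ^ q * (Y / Y₀) ^ ((1 - q / θ) * θ) * (Y / Y₀) ^ (1 - θ) := by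
        rw [mul_assoc, ← Real.rpow_add hy0, hq1]; congr 2; field_simp; ring
    _ ≤ _ := mul_le_mul_of_nonneg_right h3 (by positivity)

/-! ### Powers of the hyperbolic secant -/

/-- The function `s ↦ cosh (k s) ^ (-c)`. -/
noncomputable def sechPow (k c s : ℝ) : ℝ := Real.cosh (k * s) ^ (-c)

lemma sechPow_pos (k c s : ℝ) : 0 < sechPow k c s := Real.rpow_pos_of_pos (Real.cosh_pos _) _

lemma sechPow_le_one {k c : ℝ} (hc : 0 ≤ c) (s : ℝ) : sechPow k c s ≤ 1 :=
  Real.rpow_le_one_of_one_le_of_nonpos (Real.one_le_cosh _) (by linarith)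

lemma contDiff_sechPow (k c : ℝ) : ContDiff ℝ ∞ (sechPow k c) :=
  ContDiff.rpow_const_of_ne (Real.contDiff_cosh.comp (contDiff_const.mul contDiff_id))
    fun _ => (Real.cosh_pos _).ne'

lemma continuous_sechPow (k c : ℝ) : Continuous (sechPow k c) := (contDiff_sechPow k c).continuous

lemma sechPow_rpow (k c r s : ℝ) : sechPow k c s ^ r = sechPow k (c * r) s := by
  rw [sechPow, sechPow, ← Real.rpow_mul (Real.cosh_pos _).le, neg_mul]

lemma sechPow_sq (k c s : ℝ) : sechPow k c s ^ 2 = sechPow k (2 * c) s := by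
  rw [← Real.rpow_natCast, sechPow_rpow, mul_comm]; norm_num

lemma sechPow_mul (k c e s : ℝ) : sechPow k c s * sechPow k e s = sechPow k (c + e) s := by
  rw [sechPow, sechPow, sechPow, ← Real.rpow_add (Real.cosh_pos _)]; congr 1; ring

lemma sinh_sq_mul_sechPow (k c s : ℝ) :
    Real.sinh (k * s) ^ 2 * sechPow k (c + 2) s = sechPow k c s - sechPow k (c + 2) s := by
  have h : sechPow k c s = Real.cosh (k * s) ^ 2 * sechPow k (c + 2) s := by
    rw [sechPow, sechPow, ← Real.rpow_natCast, ← Real.rpow_add (Real.cosh_pos _)]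
    congr 1; push_cast; ring
  rw [h, Real.cosh_sq]; ring

lemma hasDerivAt_sechPow (k c s : ℝ) :
    HasDerivAt (sechPow k c) (-(k * c) * Real.sinh (k * s) * sechPow k (c + 1) s) s := by
  have h := ((Real.hasDerivAt_cosh (k * s)).comp s ((hasDerivAt_id s).const_mul k)).rpow_const
    (p := -c) (Or.inl (Real.cosh_pos _).ne')
  refine h.congr_deriv ?_
  have : -c - 1 = -(c + 1) := by ring
  simp only [Function.comp_apply, sechPow, this]
  ring

lemma deriv_sechPow_sq (k c s : ℝ) :
    deriv (sechPow k c) s ^ 2 = (k * c) ^ 2 * (sechPow k (2 * c) s - sechPow k (2 * c + 2) s) := by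
  rw [(hasDerivAt_sechPow k c s).deriv, ← sinh_sq_mul_sechPow, mul_pow, mul_pow, sechPow_sq,
    show 2 * (c + 1) = 2 * c + 2 by ring]
  ring

lemma integrable_sechPow {k c : ℝ} (hk : 0 < k) (hc : 0 < c) : Integrable (sechPow k c) := by
  -- From `cosh (k s) ≥ e^{± k s} / 2`; each sign gives an integrable majorant on one half-line.
  have hb : ∀ σ : ℝ, σ = 1 ∨ σ = -1 → ∀ s, sechPow k c s ≤ 2 ^ c * Real.exp (-(c * k) * (σ * s)) := by
    intro σ hσ s
    have h1 : Real.exp (k * (σ * s)) / 2 ≤ Real.cosh (k * s) := by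
      have : Real.cosh (k * s) = Real.cosh (k * (σ * s)) := by
        rcases hσ with h | h <;> simp [h]
      rw [this, Real.cosh_eq]
      have := Real.exp_pos (-(k * (σ * s)))
      linarith
    calc sechPow k c s ≤ (Real.exp (k * (σ * s)) / 2) ^ (-c) :=
          Real.rpow_le_rpow_of_nonpos (by positivity) h1 (by linarith)
      _ = _ := by
          rw [Real.div_rpow (Real.exp_pos _).le zero_le_two, ← Real.exp_mul,
            Real.rpow_neg zero_le_two, div_inv_eq_mul, mul_comm]
          congr 2; ring
  have hck : 0 < c * k := mul_pos hc hk
  rw [← integrableOn_univ, ← Set.Iic_union_Ioi (a := (0 : ℝ))]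
  refine IntegrableOn.union ?_ ?_
  · refine Integrable.mono' ((integrableOn_exp_mul_Iic hck 0).const_mul (2 ^ c))
      (continuous_sechPow k c).aestronglyMeasurable (Eventually.of_forall fun s => ?_)
    rw [Real.norm_of_nonneg (sechPow_pos k c s).le]
    simpa using hb (-1) (Or.inr rfl) s
  · refine Integrable.mono' ((integrableOn_exp_mul_Ioi (neg_lt_zero.2 hck) 0).const_mul (2 ^ c))
      (continuous_sechPow k c).aestronglyMeasurable (Eventually.of_forall fun s => ?_)
    rw [Real.norm_of_nonneg (sechPow_pos k c s).le]
    simpa using hb 1 (Or.inl rfl) s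

lemma integral_sechPow_pos {k c : ℝ} (hk : 0 < k) (hc : 0 < c) : 0 < ∫ s, sechPow k c s :=
  integral_pos_of_integrable_nonneg_nonzero (continuous_sechPow k c) (integrable_sechPow hk hc)
    (fun s => (sechPow_pos k c s).le) (sechPow_pos k c 0).ne'

lemma abs_sinh_mul_sechPow_le (k c s : ℝ) :
    |Real.sinh (k * s) * sechPow k (c + 1) s| ≤ sechPow k c s := by
  refine abs_le_of_sq_le_sq ?_ (sechPow_pos k c s).le
  rw [mul_pow, sechPow_sq, sechPow_sq, mul_add, mul_one, sinh_sq_mul_sechPow]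
  linarith [sechPow_pos k (2 * c + 2) s]

/-- The recursion for the integrals of powers of the hyperbolic secant. -/
lemma integral_sechPow_add_two {k c : ℝ} (hk : 0 < k) (hc : 0 < c) :
    (c + 1) * ∫ s, sechPow k (c + 2) s = c * ∫ s, sechPow k c s := by
  -- The derivative of this integrable function is a combination of the two powers, and its integral
  -- over the line is zero.
  have hd : ∀ s, HasDerivAt (fun s => Real.sinh (k * s) * sechPow k (c + 1) s)
      (k * ((c + 1) * sechPow k (c + 2) s - c * sechPow k c s)) s := by
    intro s
    have h := ((Real.hasDerivAt_sinh (k * s)).comp s ((hasDerivAt_id s).const_mul k)).mul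
      (hasDerivAt_sechPow k (c + 1) s)
    refine h.congr_deriv ?_
    have e1 := sinh_sq_mul_sechPow k c s
    have e2 : Real.cosh (k * s) * sechPow k (c + 1) s = sechPow k c s := by
      rw [sechPow, sechPow]
      nth_rw 1 [← Real.rpow_one (Real.cosh (k * s))]
      rw [← Real.rpow_add (Real.cosh_pos _)]
      congr 1; ring
    simp only [Function.comp_apply, mul_one]
    rw [show c + 1 + 1 = c + 2 by ring]
    linear_combination k * e2 - k * (c + 1) * e1
  have i1 := integrable_sechPow hk hc
  have i2 := integrable_sechPow hk (by linarith : 0 < c + 2)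
  have iF : Integrable fun s => Real.sinh (k * s) * sechPow k (c + 1) s := by
    refine i1.mono' ?_ (Eventually.of_forall fun s => abs_sinh_mul_sechPow_le k c s)
    exact Continuous.aestronglyMeasurable
      ((Real.continuous_sinh.comp (continuous_const.mul continuous_id)).mul
        (continuous_sechPow k (c + 1)))
  have h0 := integral_eq_zero_of_hasDerivAt_of_integrable hd
    (((i2.const_mul _).sub (i1.const_mul _)).const_mul k) iF
  rw [integral_const_mul, integral_sub (i2.const_mul _) (i1.const_mul _), integral_const_mul,
    integral_const_mul] at h0
  have := (mul_eq_zero.1 h0).resolve_left hk.ne'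
  linarith

lemma integrable_deriv_sechPow_sq {k c : ℝ} (hk : 0 < k) (hc : 0 < c) :
    Integrable fun s => deriv (sechPow k c) s ^ 2 := by
  simp only [deriv_sechPow_sq]
  exact ((integrable_sechPow hk (by linarith)).sub
    (integrable_sechPow hk (by linarith))).const_mul _

lemma integral_deriv_sechPow_sq {k c : ℝ} (hk : 0 < k) (hc : 0 < c) :
    ∫ s, deriv (sechPow k c) s ^ 2 =
      (k * c) ^ 2 * ((∫ s, sechPow k (2 * c) s) - ∫ s, sechPow k (2 * c + 2) s) := by
  simp only [deriv_sechPow_sq]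
  rw [integral_const_mul, integral_sub (integrable_sechPow hk (by linarith))
    (integrable_sechPow hk (by linarith))]

lemma tendsto_sechPow_atTop {k c : ℝ} (hk : 0 < k) (hc : 0 < c) :
    Tendsto (sechPow k c) atTop (𝓝 0) := by
  have h1 : Tendsto (fun s : ℝ => Real.cosh (k * s)) atTop atTop := by
    refine tendsto_atTop_mono (f := fun s => Real.exp (k * s) / 2) (fun s => ?_) ?_
    · rw [Real.cosh_eq]
      have := Real.exp_pos (-(k * s))
      linarith
    · exact (Real.tendsto_exp_atTop.comp (tendsto_id.const_mul_atTop hk)).atTop_div_const two_pos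
  exact (tendsto_rpow_neg_atTop hc).comp h1

/-- The derivative of a power of the hyperbolic secant is extremal in Sz.-Nagy's inequality. -/
lemma integral_deriv_sechPow_sq_eq_nagyPrim {k p : ℝ} (hk : 0 < k) (hp : 2 < p) :
    ∫ s, deriv (sechPow k (2 / (p - 2))) s ^ 2 = 2 * (k * (2 / (p - 2))) * nagyPrim p 1 := by
  have hp2 : p - 2 ≠ 0 := by linarith
  set b := 2 / (p - 2) with hb
  have hb0 : 0 < b := div_pos two_pos (by linarith)
  have hbp : b * p = 2 * b + 2 := by rw [hb]; field_simp; ring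
  -- For `s ≥ 0` this is `-w'/(kb)`: the first integral `w'^2 = (kb)^2 (w^2 - w^p)`, which is
  -- equality in Young's inequality behind `nagy_unit`. The negative half-line is recovered by
  -- evenness.
  have hw : ∀ s, 0 ≤ s → √(sechPow k b s ^ 2 - |sechPow k b s| ^ p) =
      Real.sinh (k * s) * sechPow k (b + 1) s := by
    intro s hs
    rw [abs_of_pos (sechPow_pos _ _ _), sechPow_rpow, hbp, sechPow_sq, ← sinh_sq_mul_sechPow,
      show 2 * b + 2 = 2 * (b + 1) by ring, ← sechPow_sq, ← mul_pow, Real.sqrt_sq]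
    exact mul_nonneg (Real.sinh_nonneg_iff.2 (by positivity)) (sechPow_pos _ _ _).le
  have hG : ∀ s ∈ Set.Ici (0 : ℝ), HasDerivAt (nagyPrim p ∘ sechPow k b)
      (-(k * b)⁻¹ * deriv (sechPow k b) s ^ 2) s := by
    intro s hs
    have h := (hasDerivAt_nagyPrim hp (sechPow k b s)).comp s (hasDerivAt_sechPow k b s)
    refine h.congr_deriv ?_
    rw [hw s hs, (hasDerivAt_sechPow k b s).deriv]
    field_simp
  have hlim : Tendsto (nagyPrim p ∘ sechPow k b) atTop (𝓝 0) := by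
    have := ((contDiff_nagyPrim hp).continuous.tendsto 0).comp (tendsto_sechPow_atTop hk hb0)
    rwa [nagyPrim_zero] at this
  have h1 := integral_Ioi_of_hasDerivAt_of_tendsto' hG
    ((integrable_deriv_sechPow_sq hk hb0).const_mul _).integrableOn hlim
  have h00 : sechPow k b 0 = 1 := by simp [sechPow]
  rw [integral_const_mul, Function.comp_apply, h00] at h1
  have h2 : ∫ s in Set.Ioi (0 : ℝ), deriv (sechPow k b) s ^ 2 = k * b * nagyPrim p 1 := by
    field_simp at h1
    linarith
  have h3 := integral_comp_abs (f := fun s => deriv (sechPow k b) s ^ 2)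
  rw [h2] at h3
  have h4 : ∀ c s, sechPow k c |s| = sechPow k c s := fun c s => by
    rw [sechPow, sechPow, ← Real.cosh_abs (k * s), abs_mul, abs_of_pos hk]
  simp only [deriv_sechPow_sq, h4] at h3 ⊢
  linarith

/-! ### The optimizer on the line -/

/-- The squared rate `l` such that the optimizer solves `-w'' + l w = (p / 2) l w^(p-1)`. -/
noncomputable def lineFreq (p θ L : ℝ) : ℝ := L * (p + 2) / (2 * p * θ - (p - 2))

/-- The optimizer on the line is `cosh (k s) ^ (-2 / (p - 2))` for this value of `k`. -/
noncomputable def lineRate (p θ L : ℝ) : ℝ := √(lineFreq p θ L) * ((p - 2) / 2)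

/-- The integral of the power `p` of the optimizer on the line. -/
noncomputable def lineMass (p θ L : ℝ) : ℝ :=
  ∫ s, sechPow (lineRate p θ L) (2 * (2 / (p - 2)) + 2) s

/-- The best constant in the interpolation inequality on the line. -/
noncomputable def lineConst (p θ L : ℝ) : ℝ :=
  lineMass p θ L ^ (2 / p) /
    (((lineFreq p θ L * (p - 2) / 4 + L * ((p + 2) / 4)) * lineMass p θ L) ^ θ *
      ((p + 2) / 4 * lineMass p θ L) ^ (1 - θ))

section line

variable {p θ L : ℝ}

lemma lineFreq_denom_pos (hp : 2 < p) (hθ : (p - 2) / (2 * p) < θ) :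
    0 < 2 * p * θ - (p - 2) := by
  rw [div_lt_iff₀ (by linarith)] at hθ
  linarith

lemma lineFreq_pos (hp : 2 < p) (hL : 0 < L) (hθ : (p - 2) / (2 * p) < θ) :
    0 < lineFreq p θ L :=
  div_pos (mul_pos hL (by linarith)) (lineFreq_denom_pos hp hθ)

lemma lineRate_pos (hp : 2 < p) (hL : 0 < L) (hθ : (p - 2) / (2 * p) < θ) :
    0 < lineRate p θ L :=
  mul_pos (Real.sqrt_pos.2 (lineFreq_pos hp hL hθ)) (by linarith)

lemma lineRate_mul (hp : 2 < p) : lineRate p θ L * (2 / (p - 2)) = √(lineFreq p θ L) := by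
  have : p - 2 ≠ 0 := by linarith
  rw [lineRate]; field_simp

lemma lineMass_pos (hp : 2 < p) (hL : 0 < L) (hθ : (p - 2) / (2 * p) < θ) :
    0 < lineMass p θ L :=
  integral_sechPow_pos (lineRate_pos hp hL hθ)
    (by have := div_pos two_pos (sub_pos.2 hp); linarith)

/-- The secant recursion with exponent `4/(p-2)`. Together with the next lemma it makes every
integral of the optimizer an explicit multiple of `lineMass`. -/
lemma integral_optimizer_sq (hp : 2 < p) (hL : 0 < L) (hθ : (p - 2) / (2 * p) < θ) :
    ∫ s, sechPow (lineRate p θ L) (2 * (2 / (p - 2))) s = (p + 2) / 4 * lineMass p θ L := by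
  have hp2 : 0 < p - 2 := by linarith
  have h := integral_sechPow_add_two (c := 2 * (2 / (p - 2))) (lineRate_pos hp hL hθ)
    (by positivity)
  rw [← lineMass] at h
  have e : (2 * (2 / (p - 2)) + 1) * (p - 2) = p + 2 := by field_simp; ring
  have e' : 2 * (2 / (p - 2)) * (p - 2) = 4 := by field_simp; norm_num
  linear_combination (-(p - 2) / 4) * h + lineMass p θ L / 4 * e -
    (∫ s, sechPow (lineRate p θ L) (2 * (2 / (p - 2))) s) / 4 * e'

lemma integral_deriv_optimizer_sq (hp : 2 < p) (hL : 0 < L) (hθ : (p - 2) / (2 * p) < θ) :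
    ∫ s, deriv (sechPow (lineRate p θ L) (2 / (p - 2))) s ^ 2 =
      lineFreq p θ L * (p - 2) / 4 * lineMass p θ L := by
  rw [integral_deriv_sechPow_sq (lineRate_pos hp hL hθ) (div_pos two_pos (sub_pos.2 hp)),
    lineRate_mul hp, Real.sq_sqrt (lineFreq_pos hp hL hθ).le, integral_optimizer_sq hp hL hθ,
    ← lineMass]
  ring

lemma lineConst_pos (hp : 2 < p) (hL : 0 < L) (hθ : (p - 2) / (2 * p) < θ) :
    0 < lineConst p θ L := by
  have h1 := lineMass_pos hp hL hθ
  have h2 := lineFreq_pos hp hL hθ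
  have h3 : 0 < p - 2 := by linarith
  rw [lineConst]; positivity

/-- The sharp interpolation inequality on the line. -/
lemma interpolation_line_sharp (hp : 2 < p) (hL : 0 < L) (hθ : (p - 2) / (2 * p) < θ)
    {v : ℝ → ℝ} (hv : ContDiff ℝ 1 v) (hc : HasCompactSupport v) :
    (∫ s, |v s| ^ p) ^ (2 / p) ≤
      lineConst p θ L * (((∫ s, deriv v s ^ 2) + L * ∫ s, v s ^ 2) ^ θ *
        (∫ s, v s ^ 2) ^ (1 - θ)) := by
  have hm := lineMass_pos hp hL hθ
  have hl := lineFreq_pos hp hL hθ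
  have hp2 : 0 < p - 2 := by linarith
  have hP : 2 * √(lineFreq p θ L) * nagyPrim p 1 =
      lineFreq p θ L * (p - 2) / 4 * lineMass p θ L := by
    rw [← integral_deriv_optimizer_sq hp hL hθ,
      integral_deriv_sechPow_sq_eq_nagyPrim (lineRate_pos hp hL hθ) hp, lineRate_mul hp]
  -- `lineFreq` is defined so that this holds: the optimizer is critical under dilations of the
  -- line.
  have hcrit : θ * (lineFreq p θ L * (p - 2) / 4 * lineMass p θ L) = (p - 2) / (2 * p) *
      (lineFreq p θ L * (p - 2) / 4 * lineMass p θ L + L * ((p + 2) / 4 * lineMass p θ L)) := by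
    have hd := lineFreq_denom_pos hp hθ
    have : lineFreq p θ L * (2 * p * θ - (p - 2)) = L * (p + 2) :=
      div_mul_cancel₀ _ hd.ne'
    field_simp
    linear_combination this
  have h := interpolation_line (X₀ := lineFreq p θ L * (p - 2) / 4 * lineMass p θ L)
    (Y₀ := (p + 2) / 4 * lineMass p θ L) (A₀ := lineMass p θ L) hp hl (by positivity)
    (by positivity) hP (by ring) (by ring) hL hθ hcrit hv hc
  have hA : 0 ≤ ∫ s, |v s| ^ p := integral_nonneg fun s => Real.rpow_nonneg (abs_nonneg _) _
  have hX : 0 ≤ ∫ s, deriv v s ^ 2 := integral_nonneg fun s => sq_nonneg _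
  have hY : 0 ≤ ∫ s, v s ^ 2 := integral_nonneg fun s => sq_nonneg _
  rw [Real.div_rpow hA hm.le, Real.div_rpow (by positivity) (by positivity),
    Real.div_rpow hY (by positivity), div_mul_div_comm, div_le_iff₀ (by positivity)] at h
  refine h.trans_eq ?_
  rw [lineConst, show (lineFreq p θ L * (p - 2) / 4 + L * ((p + 2) / 4)) * lineMass p θ L =
    lineFreq p θ L * (p - 2) / 4 * lineMass p θ L + L * ((p + 2) / 4 * lineMass p θ L) by ring]
  ring

lemma lintegral_interpolation_line (hp : 2 < p) (hL : 0 < L) (hθ : (p - 2) / (2 * p) < θ)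
    (hθ1 : θ ≤ 1) {v : ℝ → ℝ} (hv : ContDiff ℝ 1 v) (hc : HasCompactSupport v) :
    (∫⁻ s, ENNReal.ofReal (|v s| ^ p)) ^ (2 / p) ≤
      ENNReal.ofReal (lineConst p θ L) *
        (((∫⁻ s, ENNReal.ofReal (deriv v s ^ 2)) +
            ENNReal.ofReal L * ∫⁻ s, ENNReal.ofReal (v s ^ 2)) ^ θ *
          (∫⁻ s, ENNReal.ofReal (v s ^ 2)) ^ (1 - θ)) := by
  have hθ0 : 0 ≤ θ := (div_pos (by linarith) (by linarith : 0 < 2 * p)).le.trans hθ.le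
  have iA := integrable_abs_rpow hv.continuous hc (p := p) (by linarith)
  have iY := integrable_sq hv.continuous hc
  have iX := integrable_sq (hv.continuous_deriv le_rfl) hc.deriv
  have hA : 0 ≤ ∫ s, |v s| ^ p := integral_nonneg fun s => Real.rpow_nonneg (abs_nonneg _) _
  have hX : 0 ≤ ∫ s, deriv v s ^ 2 := integral_nonneg fun s => sq_nonneg _
  have hY : 0 ≤ ∫ s, v s ^ 2 := integral_nonneg fun s => sq_nonneg _
  rw [← ofReal_integral_eq_lintegral_ofReal iA
      (Eventually.of_forall fun s => Real.rpow_nonneg (abs_nonneg _) _),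
    ← ofReal_integral_eq_lintegral_ofReal iY (Eventually.of_forall fun s => sq_nonneg _),
    ← ofReal_integral_eq_lintegral_ofReal iX (Eventually.of_forall fun s => sq_nonneg _),
    ← ENNReal.ofReal_mul hL.le, ← ENNReal.ofReal_add hX (by positivity),
    ENNReal.ofReal_rpow_of_nonneg hA (by positivity),
    ENNReal.ofReal_rpow_of_nonneg (by positivity) hθ0,
    ENNReal.ofReal_rpow_of_nonneg hY (by linarith), ← ENNReal.ofReal_mul (by positivity),
    ← ENNReal.ofReal_mul (lineConst_pos hp hL hθ).le]
  exact ENNReal.ofReal_le_ofReal (interpolation_line_sharp hp hL hθ hv hc)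

end line

/-! ### From the line to the cylinder -/

/-- The surface measure of the sphere. -/
noncomputable abbrev sph (d : ℕ) : Measure (Metric.sphere (0 : EuclideanSpace ℝ (Fin d)) 1) :=
  (volume : Measure (EuclideanSpace ℝ (Fin d))).toSphere

lemma cylMeasure_eq (d : ℕ) : cylMeasure d = (volume : Measure ℝ).prod (sph d) := rfl

/-- Interpolation on each line of the cylinder, followed by Hölder's inequality on the sphere. -/
lemma lintegral_sphere_le {d : ℕ} {p θ L : ℝ} (hp : 2 < p) (hL : 0 < L)
    (hθ : (p - 2) / (2 * p) < θ) (hθ1 : θ ≤ 1) {W : Cyl d → ℝ} (hW : Continuous W)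
    (hW1 : ∀ z, ContDiff ℝ 1 fun s => W (s, z)) (hWc : ∀ z, HasCompactSupport fun s => W (s, z))
    {F : Cyl d → ℝ≥0∞} (hF : Measurable F)
    (hWF : ∀ z, (∫⁻ s, ENNReal.ofReal (deriv (fun s => W (s, z)) s ^ 2)) +
      ENNReal.ofReal L * ∫⁻ s, ENNReal.ofReal (W (s, z) ^ 2) ≤ ∫⁻ s, F (s, z)) :
    ∫⁻ z, (∫⁻ s, ENNReal.ofReal (|W (s, z)| ^ p)) ^ (2 / p) ∂(sph d) ≤
      ENNReal.ofReal (lineConst p θ L) * ((∫⁻ y, F y ∂(cylMeasure d)) ^ θ *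
        (∫⁻ y, ENNReal.ofReal (W y ^ 2) ∂(cylMeasure d)) ^ (1 - θ)) := by
  have hθ0 : 0 ≤ θ := (div_pos (by linarith) (by linarith : 0 < 2 * p)).le.trans hθ.le
  have hWm : Measurable fun y => ENNReal.ofReal (W y ^ 2) := (hW.measurable.pow_const 2).ennreal_ofReal
  rw [cylMeasure_eq, lintegral_prod_symm' _ hF, lintegral_prod_symm' _ hWm]
  calc _ ≤ ∫⁻ z, ENNReal.ofReal (lineConst p θ L) * ((∫⁻ s, F (s, z)) ^ θ *
        (∫⁻ s, ENNReal.ofReal (W (s, z) ^ 2)) ^ (1 - θ)) ∂(sph d) := by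
        refine lintegral_mono fun z => ?_
        refine (lintegral_interpolation_line hp hL hθ hθ1 (hW1 z) (hWc z)).trans ?_
        gcongr
        exact hWF z
    _ = ENNReal.ofReal (lineConst p θ L) * ∫⁻ z, (∫⁻ s, F (s, z)) ^ θ *
        (∫⁻ s, ENNReal.ofReal (W (s, z) ^ 2)) ^ (1 - θ) ∂(sph d) :=
        lintegral_const_mul' _ _ ENNReal.ofReal_ne_top
    _ ≤ _ := by
        gcongr
        exact ENNReal.lintegral_mul_norm_pow_le hF.lintegral_prod_left'.aemeasurable
          hWm.lintegral_prod_left'.aemeasurable hθ0 (by linarith) (by ring)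

lemma sph_univ_ne_zero {d : ℕ} (hd : 2 ≤ d) : sph d Set.univ ≠ 0 := by
  have : Nonempty (Fin d) := ⟨⟨0, by omega⟩⟩
  have : Nontrivial (EuclideanSpace ℝ (Fin d)) := inferInstance
  exact Measure.measure_univ_ne_zero.2 (Measure.toSphere_ne_zero _)

lemma ae_slice {d : ℕ} {P : Cyl d → Prop} (h : ∀ᵐ y ∂(cylMeasure d), P y) :
    ∀ᵐ z ∂(sph d), ∀ᵐ s : ℝ, P (s, z) := by
  have h1 : ∀ᵐ z ∂((sph d).prod (volume : Measure ℝ)), P z.swap := by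
    rw [cylMeasure_eq, ← Measure.prod_swap] at h
    exact ae_of_ae_map measurable_swap.aemeasurable h
  exact Measure.ae_ae_of_ae_prod h1

/-- Passage to the limit in an inequality on the lines of the cylinder, for a limit that is
constant on the spheres. -/
lemma lhsCyl_le_of_tendsto {d : ℕ} (hd : 2 ≤ d) {p : ℝ} (hp : 2 < p) {W : ℕ → Cyl d → ℝ}
    {w : Cyl d → ℝ} (hW : ∀ n, Continuous (W n)) (hw : AEStronglyMeasurable w (cylMeasure d))
    (hax : IsAxial w)
    (hlim : Tendsto (fun n => ∫⁻ y, ENNReal.ofReal ((W n y - w y) ^ 2) ∂(cylMeasure d))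
      atTop (𝓝 0)) {R : ℕ → ℝ≥0∞} {R₀ : ℝ≥0∞} (hR : Tendsto R atTop (𝓝 R₀))
    (hle : ∀ n, ∫⁻ z, (∫⁻ s, ENNReal.ofReal (|W n (s, z)| ^ p)) ^ (2 / p) ∂(sph d) ≤ R n) :
    lhsCyl p w ≤ sph d Set.univ ^ (2 / p - 1) * R₀ := by
  have hp0 : 0 < p := by linarith
  have hσ0 := sph_univ_ne_zero hd
  have hσt : sph d Set.univ ≠ ⊤ := measure_ne_top _ _
  -- an almost everywhere convergent subsequence
  have hmeas : TendstoInMeasure (cylMeasure d) W atTop w := by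
    refine tendstoInMeasure_of_tendsto_eLpNorm (p := 2) two_ne_zero
      (fun n => (hW n).aestronglyMeasurable) hw ?_
    have := (ENNReal.continuous_rpow_const (y := 1 / 2)).tendsto 0 |>.comp hlim
    rw [ENNReal.zero_rpow_of_pos (by norm_num)] at this
    refine this.congr fun n => ?_
    rw [eLpNorm_eq_lintegral_rpow_enorm_toReal two_ne_zero ENNReal.ofNat_ne_top]
    simp only [Function.comp_apply, ENNReal.toReal_ofNat, Pi.sub_apply]
    congr 1
    refine lintegral_congr fun y => ?_
    rw [← ofReal_norm, ENNReal.ofReal_rpow_of_nonneg (norm_nonneg _) zero_le_two,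
      Real.rpow_two, Real.norm_eq_abs, sq_abs]
  obtain ⟨ns, hns, hae⟩ := hmeas.exists_seq_tendsto_ae
  have hRns := hR.comp hns.tendsto_atTop
  obtain ⟨f, hf⟩ := hax
  set A : ℝ≥0∞ := ∫⁻ s, ENNReal.ofReal (|f s| ^ p) with hA
  have hslice : ∀ᵐ z ∂(sph d), ∫⁻ s, ENNReal.ofReal (|w (s, z)| ^ p) = A := by
    filter_upwards [ae_slice hf] with z hz
    refine lintegral_congr_ae ?_
    filter_upwards [hz] with s hs
    rw [hs]
  have hlhs : ∫⁻ y, ENNReal.ofReal (|w y| ^ p) ∂(cylMeasure d) = A * sph d Set.univ := by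
    have hm : AEMeasurable (fun y => ENNReal.ofReal (|w y| ^ p)) (cylMeasure d) :=
      (((continuous_abs.rpow_const fun _ => Or.inr hp0.le).comp_aestronglyMeasurable
        hw).aemeasurable).ennreal_ofReal
    rw [cylMeasure_eq, lintegral_prod_symm _ hm, lintegral_congr_ae hslice, lintegral_const]
  have hmono : Monotone fun x : ℝ≥0∞ => x ^ (2 / p) := ENNReal.monotone_rpow_of_nonneg (by positivity)
  have hmW : ∀ n, Measurable fun y => ENNReal.ofReal (|W n y| ^ p) := fun n =>
    (((hW n).abs.rpow_const fun _ => Or.inr hp0.le).measurable).ennreal_ofReal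
  -- Fatou is used on each line and then on the sphere; in between, `x ↦ x^(2/p)` commutes with the
  -- lower limit, being monotone and continuous. Since `w` is axial, the integral over a line is the
  -- same number `A` for almost all `z`.
  have key : A ^ (2 / p) * sph d Set.univ ≤ R₀ := by
    calc A ^ (2 / p) * sph d Set.univ = ∫⁻ _, A ^ (2 / p) ∂(sph d) := (lintegral_const _).symm
      _ ≤ ∫⁻ z, liminf (fun i => (∫⁻ s, ENNReal.ofReal (|W (ns i) (s, z)| ^ p)) ^ (2 / p)) atTop
          ∂(sph d) := by
          refine lintegral_mono_ae ?_
          filter_upwards [hslice, ae_slice hae] with z h1 h2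
          have h3 : A ≤ liminf (fun i => ∫⁻ s, ENNReal.ofReal (|W (ns i) (s, z)| ^ p)) atTop := by
            rw [← h1]
            refine le_trans (le_of_eq (lintegral_congr_ae ?_)) (lintegral_liminf_le fun i =>
              (hmW (ns i)).comp measurable_prodMk_right)
            filter_upwards [h2] with s hs
            have hcont : Continuous fun x : ℝ => ENNReal.ofReal (|x| ^ p) :=
              ENNReal.continuous_ofReal.comp
                (continuous_abs.rpow_const fun _ => Or.inr hp0.le)
            exact (((hcont.tendsto _).comp hs).liminf_eq).symm
          refine (hmono h3).trans_eq ?_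
          exact hmono.map_liminf_of_continuousAt _ ENNReal.continuous_rpow_const.continuousAt
      _ ≤ liminf (fun i => ∫⁻ z, (∫⁻ s, ENNReal.ofReal (|W (ns i) (s, z)| ^ p)) ^ (2 / p)
          ∂(sph d)) atTop :=
          lintegral_liminf_le fun i => (hmW (ns i)).lintegral_prod_left'.pow_const _
      _ ≤ liminf (fun i => R (ns i)) atTop := liminf_le_liminf (Eventually.of_forall fun i => hle _)
      _ = R₀ := hRns.liminf_eq
  rw [lhsCyl, hlhs, ENNReal.mul_rpow_of_nonneg _ _ (by positivity)]
  calc A ^ (2 / p) * sph d Set.univ ^ (2 / p)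
      = sph d Set.univ ^ (2 / p - 1) * (A ^ (2 / p) * sph d Set.univ) := by
        have : sph d Set.univ ^ (2 / p) = sph d Set.univ ^ (2 / p - 1) * sph d Set.univ := by
          nth_rw 3 [← ENNReal.rpow_one (sph d Set.univ)]
          rw [← ENNReal.rpow_add _ _ hσ0 hσt, sub_add_cancel]
        rw [this]; ring
    _ ≤ _ := by gcongr

/-- Convergence of the integrals of squares under convergence in `L²`. -/
lemma tendsto_lintegral_norm_sq {α E : Type*} [MeasurableSpace α] {μ : Measure α}
    [NormedAddCommGroup E] {f : ℕ → α → E} {g : α → E}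
    (hf : ∀ n, AEStronglyMeasurable (f n) μ) (hg : AEStronglyMeasurable g μ)
    (hfin : ∀ n, ∫⁻ y, ENNReal.ofReal (‖f n y‖ ^ 2) ∂μ ≠ ⊤)
    (hlim : Tendsto (fun n => ∫⁻ y, ENNReal.ofReal (‖f n y - g y‖ ^ 2) ∂μ) atTop (𝓝 0)) :
    Tendsto (fun n => ∫⁻ y, ENNReal.ofReal (‖f n y‖ ^ 2) ∂μ) atTop
      (𝓝 (∫⁻ y, ENNReal.ofReal (‖g y‖ ^ 2) ∂μ)) ∧ ∫⁻ y, ENNReal.ofReal (‖g y‖ ^ 2) ∂μ ≠ ⊤ := by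
  have hsq : ∀ h : α → E, ∫⁻ y, ENNReal.ofReal (‖h y‖ ^ 2) ∂μ = eLpNorm h 2 μ ^ (2 : ℝ) := by
    intro h
    rw [eLpNorm_eq_lintegral_rpow_enorm_toReal two_ne_zero ENNReal.ofNat_ne_top,
      ← ENNReal.rpow_mul]
    simp only [ENNReal.toReal_ofNat, one_div, ne_eq, OfNat.ofNat_ne_zero, not_false_eq_true,
      inv_mul_cancel₀, ENNReal.rpow_one]
    refine lintegral_congr fun y => ?_
    rw [← ofReal_norm, ENNReal.ofReal_rpow_of_nonneg (norm_nonneg _) zero_le_two,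
      Real.rpow_two]
  have h2 : (0 : ℝ) < 2 := two_pos
  have hlim' : Tendsto (fun n => eLpNorm (f n - g) 2 μ) atTop (𝓝 0) := by
    have := (ENNReal.continuous_rpow_const (y := 1 / 2)).tendsto 0 |>.comp hlim
    rw [ENNReal.zero_rpow_of_pos (by norm_num)] at this
    refine this.congr fun n => ?_
    rw [Function.comp_apply]
    have := hsq (f n - g)
    simp only [Pi.sub_apply] at this
    rw [this, ← ENNReal.rpow_mul]
    norm_num
  have hfn : ∀ n, MemLp (f n) 2 μ := fun n => by
    refine ⟨hf n, ?_⟩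
    have := hfin n
    rw [hsq] at this
    exact lt_top_iff_ne_top.2 fun h => this (by rw [h, ENNReal.top_rpow_of_pos h2])
  have hgL : MemLp g 2 μ := by
    obtain ⟨n, hn⟩ := (hlim'.eventually_lt_const ENNReal.zero_lt_top).exists
    have hd : MemLp (f n - g) 2 μ := ⟨(hf n).sub hg, hn⟩
    simpa using (hfn n).sub hd
  have hcv : Tendsto (fun n => eLpNorm (f n) 2 μ) atTop (𝓝 (eLpNorm g 2 μ)) := by
    have h1 : Tendsto (fun n => (hfn n).toLp) atTop (𝓝 hgL.toLp) :=
      (Lp.tendsto_Lp_iff_tendsto_eLpNorm'' f hfn g hgL).2 hlim'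
    have h2 := (continuous_norm.tendsto _).comp h1
    simp only [Function.comp_def, Lp.norm_toLp] at h2
    exact (ENNReal.tendsto_toReal_iff (fun n => (hfn n).2.ne) hgL.2.ne).1 h2
  simp only [hsq]
  exact ⟨(ENNReal.continuous_rpow_const.tendsto _).comp hcv,
    ENNReal.rpow_ne_top_of_nonneg h2.le hgL.2.ne⟩

/-! ### The optimal constant among functions of the axial variable -/

instance (d : ℕ) : IsFiniteMeasureOnCompacts (cylMeasure d) :=
  inferInstanceAs (IsFiniteMeasureOnCompacts ((volume : Measure ℝ).prod (sph d)))

lemma integrable_cyl {d : ℕ} {f : Cyl d → ℝ} (hf : Continuous f) {K : Set ℝ} (hK : IsCompact K)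
    (h : ∀ s ∉ K, ∀ z, f (s, z) = 0) : Integrable f (cylMeasure d) :=
  hf.integrable_of_hasCompactSupport <|
    HasCompactSupport.intro (hK.prod isCompact_univ) fun y hy => h y.1 (by
      intro hy1; exact hy ⟨hy1, trivial⟩) y.2

lemma lintegral_cyl_sq_ne_top {d : ℕ} {f : Cyl d → ℝ} (hf : Continuous f) {K : Set ℝ}
    (hK : IsCompact K) (h : ∀ s ∉ K, ∀ z, f (s, z) = 0) :
    ∫⁻ y, ENNReal.ofReal (‖f y‖ ^ 2) ∂(cylMeasure d) ≠ ⊤ :=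
  (Integrable.lintegral_lt_top (integrable_cyl (hf.norm.pow 2) hK
    fun s hs z => by simp [h s hs z])).ne

lemma deriv_eq_zero_of_notMem {v : ℝ → ℝ} {K : Set ℝ} (hK : IsClosed K)
    (h : ∀ s ∉ K, v s = 0) {s : ℝ} (hs : s ∉ K) : deriv v s = 0 := by
  have : v =ᶠ[𝓝 s] fun _ => 0 := by
    filter_upwards [hK.isOpen_compl.mem_nhds hs] with t ht using h t ht
  rw [this.deriv_eq, deriv_const]

/-- The symmetric constant: `|S^{d-1}|^{2/p-1}` times the best constant on the line. -/
noncomputable def symConst (d : ℕ) (p θ L : ℝ) : ℝ≥0∞ :=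
  sph d Set.univ ^ (2 / p - 1) * ENNReal.ofReal (lineConst p θ L)

lemma symConst_ne_top {d : ℕ} (hd : 2 ≤ d) (p θ L : ℝ) : symConst d p θ L ≠ ⊤ :=
  ENNReal.mul_ne_top (ENNReal.rpow_ne_top_of_ne_zero (sph_univ_ne_zero hd) (measure_ne_top _ _))
    ENNReal.ofReal_ne_top

lemma exists_compact_fst {E : Type*} [TopologicalSpace E] {Φ : ℝ × E → ℝ}
    (hc : HasCompactSupport Φ) : ∃ K : Set ℝ, IsCompact K ∧ ∀ s ∉ K, ∀ x, Φ (s, x) = 0 :=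
  ⟨Prod.fst '' tsupport Φ, hc.isCompact.image continuous_fst, fun _ hs x => by
    by_contra h
    exact hs ⟨_, subset_tsupport _ h, rfl⟩⟩

/-- The approximants depend on `z`, so the sharp inequality is used on each line before passing to
the limit. The bound `R` contains only the axial derivative: it is finite without any control of
`H`, which is what excludes equality in `not_achievedByAxial`. -/
lemma lhsCyl_le_of_isAxial {d : ℕ} (hd : 2 ≤ d) {p θ L : ℝ} (hp : 2 < p) (hL : 0 < L)
    (hθ : (p - 2) / (2 * p) < θ) (hθ1 : θ ≤ 1) {w g : Cyl d → ℝ}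
    {H : Cyl d → EuclideanSpace ℝ (Fin d)} (hw : MemH1 w g H) (hax : IsAxial w) :
    ∃ R : ℝ≥0∞, R ≠ ⊤ ∧ lhsCyl p w ≤ symConst d p θ L * R ∧
      R ≤ ((∫⁻ y, ENNReal.ofReal (g y ^ 2 + ‖H y‖ ^ 2) ∂(cylMeasure d)) +
        ENNReal.ofReal L * ∫⁻ y, ENNReal.ofReal (|w y| ^ 2) ∂(cylMeasure d)) ^ θ *
          (∫⁻ y, ENNReal.ofReal (|w y| ^ 2) ∂(cylMeasure d)) ^ (1 - θ) := by
  have hθ0 : 0 ≤ θ := (div_pos (by linarith) (by linarith : 0 < 2 * p)).le.trans hθ.le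
  obtain ⟨Φ, hΦ, h1, h2, -⟩ := hw.exists_approx
  choose K hK hK0 using fun n => exists_compact_fst (hΦ n).2
  set W : ℕ → Cyl d → ℝ := fun n y => Φ n (y.1, y.2) with hWdef
  have hWc : ∀ n, Continuous (W n) := fun n => (hΦ n).1.continuous.comp
    (continuous_fst.prodMk (continuous_subtype_val.comp continuous_snd))
  have hDeq : ∀ n y, axialDeriv (Φ n) y = fderiv ℝ (Φ n) (y.1, y.2) (1, 0) := by
    intro n y
    have hd1 : HasDerivAt (fun t : ℝ => ((t, (y.2 : EuclideanSpace ℝ (Fin d))) : ℝ × _)) (1, 0) y.1 :=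
      (hasDerivAt_id y.1).prodMk (hasDerivAt_const _ _)
    exact (((hΦ n).1.differentiable (by simp) _).hasFDerivAt.comp_hasDerivAt y.1 hd1).deriv
  have hDc : ∀ n, Continuous (axialDeriv (d := d) (Φ n)) := by
    intro n
    rw [funext (hDeq n)]
    exact (((hΦ n).1.continuous_fderiv (by simp)).comp
      (continuous_fst.prodMk (continuous_subtype_val.comp continuous_snd))).clm_apply
      continuous_const
  have hW0 : ∀ n, ∀ s ∉ K n, ∀ z, W n (s, z) = 0 := fun n s hs z => hK0 n s hs _
  have hD0 : ∀ n, ∀ s ∉ K n, ∀ z, axialDeriv (d := d) (Φ n) (s, z) = 0 := fun n s hs z =>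
    deriv_eq_zero_of_notMem (hK n).isClosed (fun t ht => hK0 n t ht _) hs
  obtain ⟨c1, f1⟩ := tendsto_lintegral_norm_sq (fun n => (hWc n).aestronglyMeasurable)
    hw.aestronglyMeasurable (fun n => lintegral_cyl_sq_ne_top (hWc n) (hK n) (hW0 n))
    (by simpa only [Real.norm_eq_abs, sq_abs] using h1)
  obtain ⟨c2, f2⟩ := tendsto_lintegral_norm_sq (fun n => (hDc n).aestronglyMeasurable)
    hw.aestronglyMeasurable_axial (fun n => lintegral_cyl_sq_ne_top (hDc n) (hK n) (hD0 n))
    (by simpa only [Real.norm_eq_abs, sq_abs] using h2)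
  simp only [Real.norm_eq_abs, sq_abs] at c1 c2 f1 f2
  set X := ∫⁻ y, ENNReal.ofReal (g y ^ 2) ∂(cylMeasure d)
  set Y := ∫⁻ y, ENNReal.ofReal (w y ^ 2) ∂(cylMeasure d)
  have hXY : X + ENNReal.ofReal L * Y ≠ ⊤ :=
    ENNReal.add_ne_top.2 ⟨f2, ENNReal.mul_ne_top ENNReal.ofReal_ne_top f1⟩
  have hR₀ : (X + ENNReal.ofReal L * Y) ^ θ * Y ^ (1 - θ) ≠ ⊤ :=
    ENNReal.mul_ne_top (ENNReal.rpow_ne_top_of_nonneg hθ0 hXY)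
      (ENNReal.rpow_ne_top_of_nonneg (by linarith) f1)
  refine ⟨(X + ENNReal.ofReal L * Y) ^ θ * Y ^ (1 - θ), hR₀, ?_, ?_⟩
  · have hF : ∀ n, Measurable fun y : Cyl d => ENNReal.ofReal (axialDeriv (Φ n) y ^ 2) +
        ENNReal.ofReal L * ENNReal.ofReal (W n y ^ 2) := fun n =>
      ((hDc n).measurable.pow_const 2).ennreal_ofReal.add
        (((hWc n).measurable.pow_const 2).ennreal_ofReal.const_mul _)
    have hlim : Tendsto (fun n => ENNReal.ofReal (lineConst p θ L) *
        ((∫⁻ y, ENNReal.ofReal (axialDeriv (Φ n) y ^ 2) +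
          ENNReal.ofReal L * ENNReal.ofReal (W n y ^ 2) ∂(cylMeasure d)) ^ θ *
          (∫⁻ y, ENNReal.ofReal (W n y ^ 2) ∂(cylMeasure d)) ^ (1 - θ))) atTop
        (𝓝 (ENNReal.ofReal (lineConst p θ L) * ((X + ENNReal.ofReal L * Y) ^ θ * Y ^ (1 - θ)))) := by
      refine ENNReal.Tendsto.const_mul (ENNReal.Tendsto.mul
        ((ENNReal.continuous_rpow_const.tendsto _).comp ?_)
        (Or.inr (ENNReal.rpow_ne_top_of_nonneg (by linarith) f1))
        ((ENNReal.continuous_rpow_const.tendsto _).comp c1)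
        (Or.inr (ENNReal.rpow_ne_top_of_nonneg hθ0 hXY))) (Or.inr ENNReal.ofReal_ne_top)
      refine (c2.add (ENNReal.Tendsto.const_mul c1 (Or.inr ENNReal.ofReal_ne_top))).congr
        fun n => ?_
      rw [lintegral_add_left ((hDc n).measurable.pow_const 2).ennreal_ofReal,
        lintegral_const_mul _ ((hWc n).measurable.pow_const 2).ennreal_ofReal]
    refine (lhsCyl_le_of_tendsto hd hp hWc hw.aestronglyMeasurable hax h1 hlim fun n => ?_).trans_eq
      (by rw [symConst, mul_assoc])
    refine lintegral_sphere_le hp hL hθ hθ1 (hWc n) (fun z => ?_) (fun z => ?_) (hF n) fun z => ?_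
    · exact ((hΦ n).1.of_le (by simp)).comp
        (contDiff_id.prodMk (contDiff_const (c := (z : EuclideanSpace ℝ (Fin d)))))
    · exact HasCompactSupport.intro (hK n) fun s hs => hW0 n s hs z
    · have m1 : Measurable fun s : ℝ => ENNReal.ofReal (axialDeriv (Φ n) (s, z) ^ 2) :=
        (((hDc n).measurable.comp measurable_prodMk_right).pow_const 2).ennreal_ofReal
      have m2 : Measurable fun s : ℝ => ENNReal.ofReal (W n (s, z) ^ 2) :=
        (((hWc n).measurable.comp measurable_prodMk_right).pow_const 2).ennreal_ofReal
      rw [lintegral_add_left m1, lintegral_const_mul _ m2]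
      exact le_rfl
  · have hX : X ≤ ∫⁻ y, ENNReal.ofReal (g y ^ 2 + ‖H y‖ ^ 2) ∂(cylMeasure d) :=
      lintegral_mono fun y => ENNReal.ofReal_le_ofReal (by linarith [sq_nonneg ‖H y‖])
    simp only [sq_abs]
    gcongr

lemma optConstAxial_le {d : ℕ} (hd : 2 ≤ d) {p θ a : ℝ} (hp : 2 < p)
    (hL : 0 < ((d : ℝ) - 2 - 2 * a) ^ 2 / 4) (hθ : (p - 2) / (2 * p) < θ) (hθ1 : θ ≤ 1) :
    optConstAxial d θ p a ≤ symConst d p θ (((d : ℝ) - 2 - 2 * a) ^ 2 / 4) := by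
  refine sInf_le fun w g H hw hax => ?_
  obtain ⟨R, -, h1, h2⟩ := lhsCyl_le_of_isAxial hd hp hL hθ hθ1 hw hax
  exact h1.trans (by rw [rhsCyl]; gcongr)

/-- If the symmetric constant is smaller than the optimal one, then optimality is not achieved
by functions of the axial variable. -/
lemma not_achievedByAxial {d : ℕ} (hd : 2 ≤ d) {p θ a : ℝ} (hp : 2 < p)
    (hL : 0 < ((d : ℝ) - 2 - 2 * a) ^ 2 / 4) (hθ : (p - 2) / (2 * p) < θ) (hθ1 : θ ≤ 1)
    (hlt : symConst d p θ (((d : ℝ) - 2 - 2 * a) ^ 2 / 4) < optConstCyl d θ p a) :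
    ¬ AchievedByAxial d θ p a := by
  rintro ⟨w, g, H, hw, hax, hne, heq⟩
  obtain ⟨R, hR, h1, h2⟩ := lhsCyl_le_of_isAxial hd hp hL hθ hθ1 hw hax
  rw [← rhsCyl] at h2
  have hp0 : 0 < p := by linarith
  have hl0 : lhsCyl p w ≠ 0 := by
    intro h0
    apply hne
    rw [lhsCyl, ENNReal.rpow_eq_zero_iff_of_pos (by positivity), lintegral_eq_zero_iff'] at h0
    · filter_upwards [h0] with y hy
      rw [Pi.zero_apply, ENNReal.ofReal_eq_zero] at hy
      by_contra hy0
      exact absurd hy (not_le.2 (Real.rpow_pos_of_pos (abs_pos.2 hy0) _))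
    · exact (((continuous_abs.rpow_const fun _ => Or.inr hp0.le).comp_aestronglyMeasurable
        hw.aestronglyMeasurable).aemeasurable).ennreal_ofReal
  -- `R` is finite, and nonzero because the left-hand side is, so multiplying by it preserves the
  -- strict inequality.
  have hlt' : lhsCyl p w < optConstCyl d θ p a * R := by
    refine h1.trans_lt (ENNReal.mul_lt_mul_left ?_ hR hlt)
    rintro rfl
    simp only [mul_zero, nonpos_iff_eq_zero] at h1
    exact hl0 h1
  have hle : optConstCyl d θ p a * R ≤ lhsCyl p w := by rw [heq]; gcongr
  exact (hlt'.trans_le hle).false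

/-! ### Logarithmic polar coordinates -/

/-- The Emden-Fowler change of variables `(s, z) ↦ e^s z`. -/
noncomputable def expPolar {d : ℕ} (y : Cyl d) : EuclideanSpace ℝ (Fin d) :=
  Real.exp y.1 • (y.2 : EuclideanSpace ℝ (Fin d))

lemma continuous_expPolar (d : ℕ) : Continuous (expPolar (d := d)) :=
  (Real.continuous_exp.comp continuous_fst).smul (continuous_subtype_val.comp continuous_snd)

lemma norm_sphere {d : ℕ} (z : Metric.sphere (0 : EuclideanSpace ℝ (Fin d)) 1) :
    ‖(z : EuclideanSpace ℝ (Fin d))‖ = 1 := norm_eq_of_mem_sphere z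

lemma norm_expPolar {d : ℕ} (y : Cyl d) : ‖expPolar y‖ = Real.exp y.1 := by
  rw [expPolar, norm_smul, norm_sphere, mul_one, Real.norm_of_nonneg (Real.exp_pos _).le]

lemma lintegral_Ioi_eq_lintegral_exp (f : ℝ → ℝ≥0∞) :
    ∫⁻ r in Set.Ioi (0 : ℝ), f r = ∫⁻ s, ENNReal.ofReal (Real.exp s) * f (Real.exp s) := by
  have h := lintegral_image_eq_lintegral_abs_deriv_mul (s := Set.univ) (f := Real.exp)
    (f' := Real.exp) MeasurableSet.univ (fun s _ => (Real.hasDerivAt_exp s).hasDerivWithinAt)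
    Real.exp_injective.injOn f
  rw [Set.image_univ, Real.range_exp, Measure.restrict_univ] at h
  simpa only [abs_of_pos (Real.exp_pos _)] using h

/-- Polar coordinates with `r = e^s`, so that `r^{d-1} dr = e^{d s} ds`. -/
lemma lintegral_eq_lintegral_expPolar_of_measurable {d : ℕ} (hd : 2 ≤ d)
    {F : EuclideanSpace ℝ (Fin d) → ℝ≥0∞} (hF : Measurable F) :
    ∫⁻ x, F x = ∫⁻ y, ENNReal.ofReal (Real.exp (d * y.1)) * F (expPolar y) ∂(cylMeasure d) := by
  have : Nonempty (Fin d) := ⟨⟨0, by omega⟩⟩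
  have : Nontrivial (EuclideanSpace ℝ (Fin d)) := inferInstance
  have hmp := (volume : Measure (EuclideanSpace ℝ (Fin d))).measurePreserving_homeomorphUnitSphereProd
  set G : Metric.sphere (0 : EuclideanSpace ℝ (Fin d)) 1 × Set.Ioi (0 : ℝ) → ℝ≥0∞ :=
    fun q => F ((q.2 : ℝ) • (q.1 : EuclideanSpace ℝ (Fin d))) with hG
  have hGm : Measurable G := hF.comp (by fun_prop)
  have h1 : ∫⁻ x, F x = ∫⁻ q, G q ∂((sph d).prod
      (Measure.volumeIoiPow (Module.finrank ℝ (EuclideanSpace ℝ (Fin d)) - 1))) := by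
    rw [← hmp.lintegral_comp hGm]
    have h2 : ∀ x : ({0}ᶜ : Set (EuclideanSpace ℝ (Fin d))),
        G (homeomorphUnitSphereProd _ x) = F x := by
      intro x
      have hx : ‖(x : EuclideanSpace ℝ (Fin d))‖ ≠ 0 := norm_ne_zero_iff.2 x.2
      simp [hG, smul_smul, mul_inv_cancel₀ hx]
    simp only [h2]
    rw [lintegral_subtype_comap (measurableSet_singleton _).compl F, restrict_compl_singleton]
  rw [h1, finrank_euclideanSpace_fin, lintegral_prod _ hGm.aemeasurable, cylMeasure_eq,
    lintegral_prod_symm' _ (by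
      refine Measurable.mul ?_ (hF.comp (continuous_expPolar d).measurable)
      fun_prop)]
  refine lintegral_congr fun z => ?_
  rw [Measure.volumeIoiPow, lintegral_withDensity_eq_lintegral_mul _ (by fun_prop)
    (by exact hGm.comp measurable_prodMk_left)]
  simp only [Pi.mul_apply, hG]
  rw [lintegral_subtype_comap measurableSet_Ioi
    (fun r : ℝ => ENNReal.ofReal (r ^ (d - 1)) * F (r • (z : EuclideanSpace ℝ (Fin d)))),
    lintegral_Ioi_eq_lintegral_exp]
  refine lintegral_congr fun s => ?_
  rw [← mul_assoc, ← ENNReal.ofReal_mul (Real.exp_pos _).le, ← Real.exp_nat_mul, ← Real.exp_add,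
    expPolar]
  congr 3
  rw [Nat.cast_sub (by omega)]
  push_cast; ring

/-- Null sets pull back to null sets because the density `e^{d s}` never vanishes; this lets almost
everywhere statements pass from the space to the cylinder. -/
lemma quasiMeasurePreserving_expPolar {d : ℕ} (hd : 2 ≤ d) :
    Measure.QuasiMeasurePreserving (expPolar (d := d)) (cylMeasure d) volume := by
  refine ⟨(continuous_expPolar d).measurable, Measure.AbsolutelyContinuous.mk fun N hN h0 => ?_⟩
  rw [Measure.map_apply (continuous_expPolar d).measurable hN]
  have h := lintegral_eq_lintegral_expPolar_of_measurable hd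
    (F := N.indicator 1) (measurable_one.indicator hN)
  rw [lintegral_indicator_one hN, h0] at h
  have hm : Measurable fun y : Cyl d =>
      ENNReal.ofReal (Real.exp (d * y.1)) * N.indicator (1 : EuclideanSpace ℝ (Fin d) → ℝ≥0∞) (expPolar y) :=
    Measurable.mul (by fun_prop)
      ((measurable_one.indicator hN).comp (continuous_expPolar d).measurable)
  have h2 := (lintegral_eq_zero_iff hm).1 h.symm
  refine measure_mono_null (fun y hy => ?_) (ae_iff.1 h2)
  have hy' : expPolar y ∈ N := hy
  simp [hy', Real.exp_pos]

lemma lintegral_eq_lintegral_expPolar {d : ℕ} (hd : 2 ≤ d)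
    {F : EuclideanSpace ℝ (Fin d) → ℝ≥0∞} (hF : AEMeasurable F) :
    ∫⁻ x, F x = ∫⁻ y, ENNReal.ofReal (Real.exp (d * y.1)) * F (expPolar y) ∂(cylMeasure d) := by
  rw [lintegral_congr_ae hF.ae_eq_mk,
    lintegral_eq_lintegral_expPolar_of_measurable hd hF.measurable_mk]
  refine lintegral_congr_ae ?_
  filter_upwards [(quasiMeasurePreserving_expPolar hd).ae_eq_comp hF.ae_eq_mk] with y hy
  simp only [Function.comp_apply] at hy
  rw [hy]

/-! ### The Emden-Fowler transformation -/

/-- The transformation `u ↦ e^(c s) u (e^s z)`. -/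
noncomputable def emden {d : ℕ} {F : Type*} [SMul ℝ F] (c : ℝ) (u : EuclideanSpace ℝ (Fin d) → F)
    (y : Cyl d) : F :=
  Real.exp (c * y.1) • u (expPolar y)

section emden

variable {d : ℕ} {F : Type*} [NormedAddCommGroup F] [NormedSpace ℝ F]

lemma continuous_emden {u : EuclideanSpace ℝ (Fin d) → F} (hu : Continuous u) (c : ℝ) :
    Continuous (emden c u) :=
  (Real.continuous_exp.comp (continuous_const.mul continuous_fst)).smul
    (hu.comp (continuous_expPolar d))

lemma aestronglyMeasurable_emden (hd : 2 ≤ d) {u : EuclideanSpace ℝ (Fin d) → F}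
    (hu : AEStronglyMeasurable u) (c : ℝ) : AEStronglyMeasurable (emden c u) (cylMeasure d) :=
  (Real.continuous_exp.comp (continuous_const.mul continuous_fst)).aestronglyMeasurable.smul
    (hu.comp_quasiMeasurePreserving (quasiMeasurePreserving_expPolar hd))

lemma emden_sub (c : ℝ) (u v : EuclideanSpace ℝ (Fin d) → F) (y : Cyl d) :
    emden c (fun x => u x - v x) y = emden c u y - emden c v y := smul_sub _ _ _

/-- The condition on `c` absorbs the Jacobian `e^{d s}` and the weight `e^{-e s}` into the power.
With `α = (d-2-2a)/2` it is satisfied for the pairs `(p, bp)` and `(2, 2(a+1))` by `c = α`, and for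
`(2, 2a)` by `c = α + 1`. -/
lemma lintegral_emden (hd : 2 ≤ d) {u : EuclideanSpace ℝ (Fin d) → F}
    (hu : AEStronglyMeasurable u) {p c e : ℝ} (hc : c * p = d - e) :
    ∫⁻ x, ENNReal.ofReal (‖u x‖ ^ p / ‖x‖ ^ e) =
      ∫⁻ y, ENNReal.ofReal (‖emden c u y‖ ^ p) ∂(cylMeasure d) := by
  have hm : AEMeasurable fun x => ENNReal.ofReal (‖u x‖ ^ p / ‖x‖ ^ e) :=
    ((hu.norm.aemeasurable.pow_const p).div (measurable_norm.pow_const e).aemeasurable).ennreal_ofReal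
  rw [lintegral_eq_lintegral_expPolar hd hm]
  refine lintegral_congr fun y => ?_
  rw [← ENNReal.ofReal_mul (Real.exp_pos _).le, norm_expPolar, emden, norm_smul,
    Real.norm_of_nonneg (Real.exp_pos _).le, Real.mul_rpow (Real.exp_pos _).le (norm_nonneg _),
    ← Real.exp_mul, ← Real.exp_mul, mul_right_comm, hc, div_eq_mul_inv, ← Real.exp_neg,
    mul_left_comm, ← Real.exp_add]
  rw [mul_comm]
  congr 3; ring

lemma lintegral_emden_sq (hd : 2 ≤ d) {u : EuclideanSpace ℝ (Fin d) → F}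
    (hu : AEStronglyMeasurable u) {c e : ℝ} (hc : c * 2 = d - e) :
    ∫⁻ x, ENNReal.ofReal (‖u x‖ ^ 2 / ‖x‖ ^ e) =
      ∫⁻ y, ENNReal.ofReal (‖emden c u y‖ ^ 2) ∂(cylMeasure d) := by
  simpa only [Real.rpow_two] using lintegral_emden hd hu hc

end emden

lemma lhsD_eq {d : ℕ} (hd : 2 ≤ d) {u : EuclideanSpace ℝ (Fin d) → ℝ}
    (hu : AEStronglyMeasurable u) {p : ℝ} (hp : 0 < p) (a : ℝ) :
    lhsD p a u = lhsCyl p (emden (((d : ℝ) - 2 - 2 * a) / 2) u) := by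
  rw [lhsD, lhsCyl]
  congr 1
  exact lintegral_emden hd hu (by rw [bExp]; field_simp; ring)

lemma rhsD_eq {d : ℕ} (hd : 2 ≤ d) {u : EuclideanSpace ℝ (Fin d) → ℝ}
    {G : EuclideanSpace ℝ (Fin d) → EuclideanSpace ℝ (Fin d)}
    (hu : AEStronglyMeasurable u) (hG : AEStronglyMeasurable G) (θ a : ℝ) :
    rhsD θ a u G =
      (∫⁻ y, ENNReal.ofReal (‖emden (((d : ℝ) - 2 - 2 * a) / 2 + 1) G y‖ ^ 2)
        ∂(cylMeasure d)) ^ θ *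
      (∫⁻ y, ENNReal.ofReal (‖emden (((d : ℝ) - 2 - 2 * a) / 2) u y‖ ^ 2)
        ∂(cylMeasure d)) ^ (1 - θ) := by
  rw [rhsD]
  congr 2
  · exact lintegral_emden_sq hd hG (by ring)
  · exact lintegral_emden_sq hd hu (by ring)

/-- The integration by parts behind the Emden-Fowler transformation. -/
lemma integral_deriv_sub_sq {v : ℝ → ℝ} (hv : ContDiff ℝ 1 v) (hc : HasCompactSupport v) (α : ℝ) :
    ∫ s, (deriv v s - α * v s) ^ 2 = (∫ s, deriv v s ^ 2) + α ^ 2 * ∫ s, v s ^ 2 := by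
  have hd : Continuous (deriv v) := hv.continuous_deriv le_rfl
  have iY := integrable_sq hv.continuous hc
  have iX := integrable_sq hd hc.deriv
  have iZ : Integrable fun s => v s * deriv v s :=
    (hv.continuous.mul hd).integrable_of_hasCompactSupport hc.mul_right
  have hder : ∀ s, HasDerivAt (fun s => v s ^ 2) (2 * (v s * deriv v s)) s := fun s =>
    (((hv.differentiable one_ne_zero s).hasDerivAt).pow 2).congr_deriv (by push_cast; ring)
  have h0 : ∫ s, v s * deriv v s = 0 := by
    have := integral_eq_zero_of_hasDerivAt_of_integrable hder (iZ.const_mul 2) iY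
    rw [integral_const_mul] at this
    linarith
  have e : ∀ s, (deriv v s - α * v s) ^ 2 =
      deriv v s ^ 2 + α ^ 2 * v s ^ 2 - 2 * α * (v s * deriv v s) := fun s => by ring
  have iXY : Integrable fun s => deriv v s ^ 2 + α ^ 2 * v s ^ 2 := iX.add (iY.const_mul _)
  simp only [e]
  rw [integral_sub iXY (iZ.const_mul _), integral_add iX (iY.const_mul _), integral_const_mul,
    integral_const_mul, h0]
  ring

lemma lintegral_deriv_sq_add {v : ℝ → ℝ} (hv : ContDiff ℝ 1 v) (hc : HasCompactSupport v) (α : ℝ) :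
    (∫⁻ s, ENNReal.ofReal (deriv v s ^ 2)) + ENNReal.ofReal (α ^ 2) *
      ∫⁻ s, ENNReal.ofReal (v s ^ 2) = ∫⁻ s, ENNReal.ofReal ((deriv v s - α * v s) ^ 2) := by
  have hd : Continuous (deriv v) := hv.continuous_deriv le_rfl
  have iY := integrable_sq hv.continuous hc
  have iX := integrable_sq hd hc.deriv
  have iV : Integrable fun s => (deriv v s - α * v s) ^ 2 :=
    integrable_sq (hd.sub (continuous_const.mul hv.continuous))
      (hc.deriv.sub (hc.mul_left (f := fun _ => α)))
  have hX : 0 ≤ ∫ s, deriv v s ^ 2 := integral_nonneg fun s => sq_nonneg _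
  have hY : 0 ≤ ∫ s, v s ^ 2 := integral_nonneg fun s => sq_nonneg _
  rw [← ofReal_integral_eq_lintegral_ofReal iY (Eventually.of_forall fun s => sq_nonneg _),
    ← ofReal_integral_eq_lintegral_ofReal iX (Eventually.of_forall fun s => sq_nonneg _),
    ← ofReal_integral_eq_lintegral_ofReal iV (Eventually.of_forall fun s => sq_nonneg _),
    ← ENNReal.ofReal_mul (sq_nonneg _), ← ENNReal.ofReal_add hX (by positivity),
    integral_deriv_sub_sq hv hc]

section testFunction

variable {d : ℕ} {φ : EuclideanSpace ℝ (Fin d) → ℝ}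

lemma continuous_gradient (hφ : ContDiff ℝ ∞ φ) : Continuous (gradient φ) :=
  (InnerProductSpace.toDual ℝ (EuclideanSpace ℝ (Fin d))).symm.continuous.comp
    (hφ.continuous_fderiv (by simp))

/-- Test functions on the punctured space live in a compact range of the logarithmic radius. -/
lemma exists_compact_log (hc : HasCompactSupport φ) (h0 : (0 : EuclideanSpace ℝ (Fin d)) ∉ tsupport φ) :
    ∃ K : Set ℝ, IsCompact K ∧ ∀ y : Cyl d, y.1 ∉ K → expPolar y ∉ tsupport φ := by
  refine ⟨(fun x => Real.log ‖x‖) '' tsupport φ, hc.isCompact.image_of_continuousOn ?_, ?_⟩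
  · refine ContinuousOn.log continuous_norm.continuousOn fun x hx => ?_
    rw [norm_ne_zero_iff]
    rintro rfl
    exact h0 hx
  · intro y hy hmem
    exact hy ⟨_, hmem, by simp [norm_expPolar]⟩

lemma gradient_eq_zero_of_notMem_tsupport {x : EuclideanSpace ℝ (Fin d)} (hx : x ∉ tsupport φ) :
    gradient φ x = 0 := by
  have : fderiv ℝ φ x = 0 := by
    by_contra h
    exact hx (support_fderiv_subset ℝ h)
  rw [gradient, this, map_zero]

lemma contDiff_emden_slice (hφ : ContDiff ℝ ∞ φ) (c : ℝ)
    (z : Metric.sphere (0 : EuclideanSpace ℝ (Fin d)) 1) :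
    ContDiff ℝ 1 fun s => emden c φ (s, z) := by
  refine ContDiff.smul (Real.contDiff_exp.comp (contDiff_const.mul contDiff_id)) ?_
  exact (hφ.of_le (by simp)).comp
    (Real.contDiff_exp.smul (contDiff_const (c := (z : EuclideanSpace ℝ (Fin d)))))

/-- Moving along a ray sees only the radial component of the gradient, and the chain rule supplies a
factor `e^s`, which raises the weight from `c` to `c + 1`. -/
lemma deriv_emden_slice (hφ : ContDiff ℝ ∞ φ) (c : ℝ) (y : Cyl d) :
    deriv (fun s => emden c φ (s, y.2)) y.1 - c * emden c φ y =
      ⟪emden (c + 1) (gradient φ) y, (y.2 : EuclideanSpace ℝ (Fin d))⟫ := by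
  have h1 : HasDerivAt (fun s : ℝ => Real.exp s • (y.2 : EuclideanSpace ℝ (Fin d)))
      (Real.exp y.1 • (y.2 : EuclideanSpace ℝ (Fin d))) y.1 :=
    (Real.hasDerivAt_exp y.1).smul_const _
  have h2 := ((hφ.differentiable (by simp)) (expPolar y)).hasGradientAt.hasFDerivAt.comp_hasDerivAt
    y.1 h1
  have h3 : HasDerivAt (fun s : ℝ => Real.exp (c * s)) (c * Real.exp (c * y.1)) y.1 := by
    have := ((hasDerivAt_id y.1).const_mul c).exp
    refine this.congr_deriv ?_
    simp; ring
  have h4 := h3.smul h2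
  have h5 : deriv (fun s => emden c φ (s, y.2)) y.1 = _ := h4.deriv
  rw [h5]
  simp only [emden, InnerProductSpace.toDual_apply_apply, real_inner_smul_left,
    real_inner_smul_right, smul_eq_mul, Function.comp_apply, add_mul, one_mul, Real.exp_add]
  simp only [expPolar]
  ring

/-- The cross term `∫ v v'` vanishes, and Cauchy-Schwarz discards the angular part of the gradient.
Discarding it is compatible with an upper bound that is sharp for radial functions. -/
lemma emden_energy_le (hφ : ContDiff ℝ ∞ φ) {K : Set ℝ} (hK : IsCompact K)
    (hK0 : ∀ y : Cyl d, y.1 ∉ K → expPolar y ∉ tsupport φ) (c : ℝ)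
    (z : Metric.sphere (0 : EuclideanSpace ℝ (Fin d)) 1) :
    (∫⁻ s, ENNReal.ofReal (deriv (fun s => emden c φ (s, z)) s ^ 2)) +
      ENNReal.ofReal (c ^ 2) * ∫⁻ s, ENNReal.ofReal (emden c φ (s, z) ^ 2) ≤
      ∫⁻ s, ENNReal.ofReal (‖emden (c + 1) (gradient φ) (s, z)‖ ^ 2) := by
  have hc : HasCompactSupport fun s => emden c φ (s, z) := HasCompactSupport.intro hK fun s hs => by
    rw [emden, image_eq_zero_of_notMem_tsupport (hK0 (s, z) hs), smul_zero]
  rw [lintegral_deriv_sq_add (contDiff_emden_slice hφ c z) hc]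
  refine lintegral_mono fun s => ENNReal.ofReal_le_ofReal ?_
  have := deriv_emden_slice hφ c (s, z)
  simp only at this
  rw [this, ← sq_abs]
  have h := abs_real_inner_le_norm (emden (c + 1) (gradient φ) (s, z)) (z : EuclideanSpace ℝ (Fin d))
  rw [norm_sphere, mul_one] at h
  gcongr

end testFunction

/-! ### The optimal constant among radial functions. -/

/-- The scheme of `lhsCyl_le_of_isAxial` applied to the transformed approximants, with
`emden_energy_le` supplying the energy on each line. Finiteness of `rhsD` comes from convergence of
both weighted `L²` norms. -/
lemma lhsD_le_of_isRadial {d : ℕ} (hd : 2 ≤ d) {p θ a : ℝ} (hp : 2 < p)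
    (hL : 0 < ((d : ℝ) - 2 - 2 * a) ^ 2 / 4)
    (hθ : (p - 2) / (2 * p) < θ) (hθ1 : θ ≤ 1) {u : EuclideanSpace ℝ (Fin d) → ℝ}
    {G : EuclideanSpace ℝ (Fin d) → EuclideanSpace ℝ (Fin d)} (hu : MemD a u G)
    (hrad : IsRadial u) :
    lhsD p a u ≤ symConst d p θ (((d : ℝ) - 2 - 2 * a) ^ 2 / 4) * rhsD θ a u G ∧
      rhsD θ a u G ≠ ⊤ := by
  have hθ0 : 0 ≤ θ := (div_pos (by linarith) (by linarith : 0 < 2 * p)).le.trans hθ.le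
  set α := ((d : ℝ) - 2 - 2 * a) / 2 with hα
  have hα2 : ((d : ℝ) - 2 - 2 * a) ^ 2 / 4 = α ^ 2 := by rw [hα]; ring
  rw [hα2] at hL ⊢
  obtain ⟨φ, hφ, h1, h2⟩ := hu.exists_approx
  choose K hK hK0 using fun n => exists_compact_log (hφ n).2.1 (hφ n).2.2
  have hum := hu.aestronglyMeasurable
  have hGm := hu.aestronglyMeasurable_grad
  have hφc : ∀ n, Continuous (φ n) := fun n => (hφ n).1.continuous
  have hgc : ∀ n, Continuous (gradient (φ n)) := fun n => continuous_gradient (hφ n).1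
  have hWc : ∀ n, Continuous (emden α (φ n)) := fun n => continuous_emden (hφc n) α
  have hDc : ∀ n, Continuous (emden (α + 1) (gradient (φ n))) := fun n =>
    continuous_emden (hgc n) (α + 1)
  have hW0 : ∀ n, ∀ s ∉ K n, ∀ z, emden α (φ n) (s, z) = 0 := fun n s hs z => by
    rw [emden, image_eq_zero_of_notMem_tsupport (hK0 n (s, z) hs), smul_zero]
  have hD0 : ∀ n, ∀ s ∉ K n, ∀ z, emden (α + 1) (gradient (φ n)) (s, z) = 0 := fun n s hs z => by
    rw [emden, gradient_eq_zero_of_notMem_tsupport (hK0 n (s, z) hs), smul_zero]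
  have l1 : Tendsto (fun n => ∫⁻ y, ENNReal.ofReal (‖emden α (φ n) y - emden α u y‖ ^ 2)
      ∂(cylMeasure d)) atTop (𝓝 0) := by
    refine h1.congr fun n => ?_
    have := lintegral_emden_sq hd (((hφc n).aestronglyMeasurable).sub hum) (c := α)
      (e := 2 * (a + 1)) (by rw [hα]; ring)
    simp only [Pi.sub_apply, Real.norm_eq_abs, sq_abs] at this
    rw [this]
    refine lintegral_congr fun y => ?_
    rw [← emden_sub, Real.norm_eq_abs, sq_abs]; rfl
  have l2 : Tendsto (fun n => ∫⁻ y, ENNReal.ofReal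
      (‖emden (α + 1) (gradient (φ n)) y - emden (α + 1) G y‖ ^ 2) ∂(cylMeasure d))
      atTop (𝓝 0) := by
    refine h2.congr fun n => ?_
    have := lintegral_emden_sq hd (((hgc n).aestronglyMeasurable).sub hGm) (c := α + 1)
      (e := 2 * a) (by rw [hα]; ring)
    simp only [Pi.sub_apply] at this
    rw [this]
    refine lintegral_congr fun y => ?_
    rw [← emden_sub]; rfl
  have hwm : AEStronglyMeasurable (emden α u) (cylMeasure d) := aestronglyMeasurable_emden hd hum α
  obtain ⟨c1, f1⟩ := tendsto_lintegral_norm_sq (fun n => (hWc n).aestronglyMeasurable) hwm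
    (fun n => lintegral_cyl_sq_ne_top (hWc n) (hK n) (hW0 n)) l1
  obtain ⟨c2, f2⟩ := tendsto_lintegral_norm_sq (fun n => (hDc n).aestronglyMeasurable)
    (aestronglyMeasurable_emden hd hGm (α + 1)) (fun n => by
      have := lintegral_cyl_sq_ne_top (hDc n).norm (hK n) fun s hs z => by
        rw [hD0 n s hs z, norm_zero]
      simpa only [norm_norm] using this) l2
  have hax : IsAxial (emden α u) := by
    obtain ⟨f, hf⟩ := hrad
    refine ⟨fun s => Real.exp (α * s) * f (Real.exp s), ?_⟩
    filter_upwards [(quasiMeasurePreserving_expPolar hd).ae hf] with y hy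
    rw [emden, hy, norm_expPolar, smul_eq_mul]
  rw [lhsD_eq hd hum (by linarith) a, rhsD_eq hd hum hGm, ← hα]
  have t1 := ENNReal.rpow_ne_top_of_nonneg (by linarith : 0 ≤ 1 - θ) f1
  have t2 := ENNReal.rpow_ne_top_of_nonneg hθ0 f2
  refine ⟨?_, ENNReal.mul_ne_top t2 t1⟩
  have hlim := ENNReal.Tendsto.const_mul (a := ENNReal.ofReal (lineConst p θ (α ^ 2)))
    (ENNReal.Tendsto.mul ((ENNReal.continuous_rpow_const (y := θ)).tendsto _ |>.comp c2)
      (Or.inr t1) ((ENNReal.continuous_rpow_const (y := 1 - θ)).tendsto _ |>.comp c1)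
      (Or.inr t2)) (Or.inr ENNReal.ofReal_ne_top)
  refine (lhsCyl_le_of_tendsto hd hp hWc hwm hax
    (by simpa only [Real.norm_eq_abs, sq_abs] using l1) hlim fun n => ?_).trans_eq
    (by rw [symConst, mul_assoc])
  have hb := lintegral_sphere_le hp hL hθ hθ1 (hWc n) (contDiff_emden_slice (hφ n).1 α)
    (fun z => HasCompactSupport.intro (hK n) fun s hs => hW0 n s hs z)
    (F := fun y => ENNReal.ofReal (‖emden (α + 1) (gradient (φ n)) y‖ ^ 2))
    (((hDc n).norm.measurable.pow_const 2).ennreal_ofReal)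
    (fun z => emden_energy_le (hφ n).1 (hK n) (hK0 n) α z)
  simpa only [Function.comp_apply, Real.norm_eq_abs, sq_abs] using hb

lemma optConstRadial_le {d : ℕ} (hd : 2 ≤ d) {p θ a : ℝ} (hp : 2 < p)
    (hL : 0 < ((d : ℝ) - 2 - 2 * a) ^ 2 / 4) (hθ : (p - 2) / (2 * p) < θ) (hθ1 : θ ≤ 1) :
    optConstRadial d θ p a ≤ symConst d p θ (((d : ℝ) - 2 - 2 * a) ^ 2 / 4) :=
  sInf_le fun _ _ hu hrad => (lhsD_le_of_isRadial hd hp hL hθ hθ1 hu hrad).1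

/-- If the symmetric constant is smaller than the optimal one, then optimality is not achieved
by radial functions. -/
lemma not_achievedByRadial {d : ℕ} (hd : 2 ≤ d) {p θ a : ℝ} (hp : 2 < p)
    (hL : 0 < ((d : ℝ) - 2 - 2 * a) ^ 2 / 4) (hθ : (p - 2) / (2 * p) < θ) (hθ1 : θ ≤ 1)
    (hlt : symConst d p θ (((d : ℝ) - 2 - 2 * a) ^ 2 / 4) < optConst d θ p a) :
    ¬ AchievedByRadial d θ p a := by
  rintro ⟨u, G, hu, hrad, hne, heq⟩
  obtain ⟨h1, hR⟩ := lhsD_le_of_isRadial hd hp hL hθ hθ1 hu hrad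
  have : Nonempty (Fin d) := ⟨⟨0, by omega⟩⟩
  have : Nontrivial (EuclideanSpace ℝ (Fin d)) := inferInstance
  have hp0 : 0 < p := by linarith
  have hl0 : lhsD p a u ≠ 0 := by
    intro h0
    apply hne
    rw [lhsD, ENNReal.rpow_eq_zero_iff_of_pos (by positivity), lintegral_eq_zero_iff'] at h0
    · have hx0 : ∀ᵐ x : EuclideanSpace ℝ (Fin d), x ≠ 0 := by
        simp [ae_iff, measure_singleton]
      filter_upwards [h0, hx0] with x hx hx0
      rw [Pi.zero_apply, ENNReal.ofReal_eq_zero] at hx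
      by_contra hu0
      exact absurd hx (not_le.2 (div_pos (Real.rpow_pos_of_pos (abs_pos.2 hu0) _)
        (Real.rpow_pos_of_pos (norm_pos_iff.2 hx0) _)))
    · exact ((hu.aestronglyMeasurable.norm.aemeasurable.pow_const p).div
        (measurable_norm.pow_const _).aemeasurable).ennreal_ofReal
  have hlt' : lhsD p a u < optConst d θ p a * rhsD θ a u G := by
    refine h1.trans_lt (ENNReal.mul_lt_mul_left ?_ hR hlt)
    intro h0
    rw [h0, mul_zero, nonpos_iff_eq_zero] at h1
    exact hl0 h1
  exact hlt'.ne heq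

/-! ### Moments of the coordinates on the sphere -/

/-- Invariance of the surface measure under isometries is inherited from Lebesgue measure: integrate
the extension of `f` that is constant along rays over the unit ball, in logarithmic polar
coordinates. The radial factor is positive and finite, so it cancels. -/
lemma lintegral_sph_comp {d : ℕ} (hd : 2 ≤ d)
    (e : EuclideanSpace ℝ (Fin d) ≃ₗᵢ[ℝ] EuclideanSpace ℝ (Fin d))
    {f : EuclideanSpace ℝ (Fin d) → ℝ≥0∞} (hf : Measurable f) :
    ∫⁻ z, f (e z) ∂(sph d) = ∫⁻ z, f z ∂(sph d) := by
  have hpol : ∀ g : EuclideanSpace ℝ (Fin d) → ℝ≥0∞, Measurable g →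
      ∫⁻ x, (Metric.ball (0 : EuclideanSpace ℝ (Fin d)) 1).indicator (fun x => g (‖x‖⁻¹ • x)) x =
        (∫⁻ s in Set.Iio (0 : ℝ), ENNReal.ofReal (Real.exp (d * s))) * ∫⁻ z, g z ∂(sph d) := by
    intro g hg
    have hm : Measurable fun x : EuclideanSpace ℝ (Fin d) => g (‖x‖⁻¹ • x) :=
      hg.comp (measurable_norm.inv.smul measurable_id)
    rw [lintegral_eq_lintegral_expPolar_of_measurable hd (hm.indicator measurableSet_ball),
      ← lintegral_indicator measurableSet_Iio, cylMeasure_eq,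
      ← lintegral_prod_mul (μ := volume) (ν := sph d)
        (f := (Set.Iio (0 : ℝ)).indicator fun s => ENNReal.ofReal (Real.exp (d * s)))
        (g := fun z => g z) (Measurable.indicator (by fun_prop) measurableSet_Iio).aemeasurable
        (hg.comp measurable_subtype_coe).aemeasurable]
    refine lintegral_congr fun y => ?_
    have hn : ‖expPolar y‖⁻¹ • expPolar y = (y.2 : EuclideanSpace ℝ (Fin d)) := by
      rw [norm_expPolar, expPolar, smul_smul, inv_mul_cancel₀ (Real.exp_pos _).ne', one_smul]
    by_cases h : y.1 < 0
    · have h1 : expPolar y ∈ Metric.ball (0 : EuclideanSpace ℝ (Fin d)) 1 := by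
        rw [mem_ball_zero_iff, norm_expPolar]; simpa using h
      rw [Set.indicator_of_mem h1, Set.indicator_of_mem (Set.mem_Iio.2 h), hn]
    · have h1 : expPolar y ∉ Metric.ball (0 : EuclideanSpace ℝ (Fin d)) 1 := by
        rw [mem_ball_zero_iff, norm_expPolar]; simpa using h
      rw [Set.indicator_of_notMem h1, Set.indicator_of_notMem (by simpa using h)]
      simp
  have hd0 : (0 : ℝ) < d := by exact_mod_cast (by omega : 0 < d)
  have hC0 : ∫⁻ s in Set.Iio (0 : ℝ), ENNReal.ofReal (Real.exp (d * s)) ≠ 0 := by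
    rw [Ne, setLIntegral_eq_zero_iff measurableSet_Iio (by fun_prop)]
    intro h
    have hpos : ∀ᵐ s : ℝ, s ∉ Set.Iio (0 : ℝ) := by
      filter_upwards [h] with s hs hs0
      have := hs hs0
      simp only [ENNReal.ofReal_eq_zero] at this
      exact absurd this (not_le.2 (Real.exp_pos _))
    have h0 : volume (Set.Iio (0 : ℝ)) = 0 := by
      rw [ae_iff] at hpos
      refine measure_mono_null (fun s hs => ?_) hpos
      simpa using hs
    simp at h0
  have hCt : ∫⁻ s in Set.Iio (0 : ℝ), ENNReal.ofReal (Real.exp (d * s)) ≠ ⊤ :=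
    (((integrableOn_exp_mul_Iic hd0 0).mono_set Set.Iio_subset_Iic_self).lintegral_lt_top).ne
  have h1 := hpol (fun x => f (e x)) (hf.comp e.continuous.measurable)
  have h2 := hpol f hf
  have hmf : Measurable fun x : EuclideanSpace ℝ (Fin d) => f (‖x‖⁻¹ • x) :=
    hf.comp (measurable_norm.inv.smul measurable_id)
  have h3 := (e.measurePreserving).lintegral_comp (hmf.indicator
    (measurableSet_ball (x := (0 : EuclideanSpace ℝ (Fin d))) (ε := 1)))
  rw [← ENNReal.mul_right_inj hC0 hCt, ← h1, ← h2, ← h3]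
  refine lintegral_congr fun x => ?_
  simp only [Set.indicator, mem_ball_zero_iff, LinearIsometryEquiv.norm_map, map_smul]

lemma integral_sph_comp {d : ℕ} (hd : 2 ≤ d)
    (e : EuclideanSpace ℝ (Fin d) ≃ₗᵢ[ℝ] EuclideanSpace ℝ (Fin d))
    {f : EuclideanSpace ℝ (Fin d) → ℝ} (hf : Continuous f) :
    ∫ z, f (e z) ∂(sph d) = ∫ z, f z ∂(sph d) := by
  have hm : Measure.map (fun z : Metric.sphere (0 : EuclideanSpace ℝ (Fin d)) 1 =>
      e (z : EuclideanSpace ℝ (Fin d))) (sph d) = Measure.map Subtype.val (sph d) := by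
    ext S hS
    have h := lintegral_sph_comp hd e (f := S.indicator 1) (measurable_one.indicator hS)
    have hme : Measurable fun z : Metric.sphere (0 : EuclideanSpace ℝ (Fin d)) 1 =>
      e (z : EuclideanSpace ℝ (Fin d)) := e.continuous.measurable.comp measurable_subtype_coe
    rw [← lintegral_indicator_one hS, ← lintegral_indicator_one hS,
      lintegral_map (measurable_one.indicator hS) hme,
      lintegral_map (measurable_one.indicator hS) measurable_subtype_coe]
    exact h
  rw [← integral_map (φ := fun z : Metric.sphere (0 : EuclideanSpace ℝ (Fin d)) 1 =>
      e (z : EuclideanSpace ℝ (Fin d)))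
      (e.continuous.measurable.comp measurable_subtype_coe).aemeasurable hf.aestronglyMeasurable,
    hm, integral_map measurable_subtype_coe.aemeasurable hf.aestronglyMeasurable]

lemma integrable_sph {d : ℕ} {f : Metric.sphere (0 : EuclideanSpace ℝ (Fin d)) 1 → ℝ}
    (hf : Continuous f) : Integrable f (sph d) :=
  hf.integrable_of_hasCompactSupport (HasCompactSupport.of_compactSpace f)

lemma continuous_coord {d : ℕ} (i : Fin d) : Continuous fun x : EuclideanSpace ℝ (Fin d) => x i :=
  (EuclideanSpace.proj (𝕜 := ℝ) i).continuous

lemma integral_sph_coord {d : ℕ} (hd : 2 ≤ d) (i : Fin d) :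
    ∫ z, (z : EuclideanSpace ℝ (Fin d)) i ∂(sph d) = 0 := by
  have h := integral_sph_comp hd (LinearIsometryEquiv.neg ℝ) (continuous_coord i)
  simp only [LinearIsometryEquiv.coe_neg, PiLp.neg_apply, integral_neg] at h
  linarith

/-- Swapping coordinates shows that the `d` second moments agree, and their sum is the total measure
because `‖z‖ = 1`. -/
lemma integral_sph_coord_sq {d : ℕ} (hd : 2 ≤ d) (i : Fin d) :
    ∫ z, (z : EuclideanSpace ℝ (Fin d)) i ^ 2 ∂(sph d) = (sph d).real Set.univ / d := by
  have hd0 : (d : ℝ) ≠ 0 := by exact_mod_cast (by omega : d ≠ 0)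
  have hij : ∀ j, ∫ z, (z : EuclideanSpace ℝ (Fin d)) j ^ 2 ∂(sph d) =
      ∫ z, (z : EuclideanSpace ℝ (Fin d)) i ^ 2 ∂(sph d) := by
    intro j
    have hc : Continuous fun x : EuclideanSpace ℝ (Fin d) => x i ^ 2 := (continuous_coord i).pow 2
    have h := integral_sph_comp hd
      (LinearIsometryEquiv.piLpCongrLeft 2 ℝ ℝ (Equiv.swap i j)) hc
    rw [← h]
    simp [LinearIsometryEquiv.piLpCongrLeft_apply, Equiv.piCongrLeft']
  have hsum : ∑ j, ∫ z, (z : EuclideanSpace ℝ (Fin d)) j ^ 2 ∂(sph d) = (sph d).real Set.univ := by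
    have hint : ∀ j, Integrable (fun z : Metric.sphere (0 : EuclideanSpace ℝ (Fin d)) 1 =>
        (z : EuclideanSpace ℝ (Fin d)) j ^ 2) (sph d) := fun j =>
      integrable_sph (((continuous_coord j).comp continuous_subtype_val).pow 2)
    rw [← integral_finsetSum _ fun j _ => hint j]
    have : ∀ z : Metric.sphere (0 : EuclideanSpace ℝ (Fin d)) 1,
        ∑ j, (z : EuclideanSpace ℝ (Fin d)) j ^ 2 = 1 := fun z => by
      have := EuclideanSpace.norm_sq_eq (z : EuclideanSpace ℝ (Fin d))
      rw [norm_sphere] at this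
      simpa using this.symm
    simp [this]
  rw [Finset.sum_congr rfl fun j _ => hij j] at hsum
  rw [eq_div_iff hd0, ← hsum]
  simp [mul_comm]

/-- The integral of a quadratic expression in a coordinate. -/
lemma integral_cyl_quadratic {d : ℕ} (hd : 2 ≤ d) (i : Fin d) {A B C : ℝ → ℝ}
    (hA : Continuous A) (hB : Continuous B) (hC : Continuous C) {K : Set ℝ} (hK : IsCompact K)
    (hA0 : ∀ s ∉ K, A s = 0) (hB0 : ∀ s ∉ K, B s = 0) (hC0 : ∀ s ∉ K, C s = 0) :
    ∫⁻ y : Cyl d, ENNReal.ofReal ((A y.1 + B y.1 * (y.2 : EuclideanSpace ℝ (Fin d)) i) ^ 2 +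
      C y.1 ^ 2 * (1 - (y.2 : EuclideanSpace ℝ (Fin d)) i ^ 2)) ∂(cylMeasure d) =
      ENNReal.ofReal ((sph d).real Set.univ * ((∫ s, A s ^ 2) + (1 / d) * (∫ s, B s ^ 2) +
        (1 - 1 / d) * ∫ s, C s ^ 2)) := by
  have hz : Continuous fun y : Cyl d => (y.2 : EuclideanSpace ℝ (Fin d)) i :=
    (continuous_coord i).comp (continuous_subtype_val.comp continuous_snd)
  have hle : ∀ y : Cyl d, (y.2 : EuclideanSpace ℝ (Fin d)) i ^ 2 ≤ 1 := fun y => by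
    have h1 := EuclideanSpace.norm_sq_eq (y.2 : EuclideanSpace ℝ (Fin d))
    rw [norm_sphere] at h1
    simp only [one_pow, Real.norm_eq_abs, sq_abs] at h1
    refine le_of_le_of_eq ?_ h1.symm
    exact Finset.single_le_sum (f := fun j => (y.2 : EuclideanSpace ℝ (Fin d)) j ^ 2)
      (fun j _ => sq_nonneg _) (Finset.mem_univ i)
  have hA' : Continuous fun y : Cyl d => A y.1 := hA.comp continuous_fst
  have hB' : Continuous fun y : Cyl d => B y.1 := hB.comp continuous_fst
  have hC' : Continuous fun y : Cyl d => C y.1 := hC.comp continuous_fst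
  have iAll : Integrable (fun y : Cyl d => (A y.1 + B y.1 * (y.2 : EuclideanSpace ℝ (Fin d)) i) ^ 2 +
      C y.1 ^ 2 * (1 - (y.2 : EuclideanSpace ℝ (Fin d)) i ^ 2)) (cylMeasure d) :=
    integrable_cyl (by fun_prop) hK fun s hs z => by simp [hA0 s hs, hB0 s hs, hC0 s hs]
  rw [← ofReal_integral_eq_lintegral_ofReal iAll (Eventually.of_forall fun y =>
    add_nonneg (sq_nonneg _) (mul_nonneg (sq_nonneg _) (sub_nonneg.2 (hle y))))]
  congr 1
  have e : ∀ y : Cyl d, (A y.1 + B y.1 * (y.2 : EuclideanSpace ℝ (Fin d)) i) ^ 2 +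
      C y.1 ^ 2 * (1 - (y.2 : EuclideanSpace ℝ (Fin d)) i ^ 2) =
      (A y.1 ^ 2 + C y.1 ^ 2) * 1 + 2 * A y.1 * B y.1 * (y.2 : EuclideanSpace ℝ (Fin d)) i +
        (B y.1 ^ 2 - C y.1 ^ 2) * (y.2 : EuclideanSpace ℝ (Fin d)) i ^ 2 := fun y => by ring
  simp only [e]
  have i1 : Integrable (fun y : Cyl d => (A y.1 ^ 2 + C y.1 ^ 2) * 1) (cylMeasure d) :=
    integrable_cyl (by fun_prop) hK fun s hs z => by simp [hA0 s hs, hC0 s hs]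
  have i2 : Integrable (fun y : Cyl d => 2 * A y.1 * B y.1 * (y.2 : EuclideanSpace ℝ (Fin d)) i)
      (cylMeasure d) :=
    integrable_cyl (by fun_prop) hK fun s hs z => by simp [hA0 s hs]
  have i3 : Integrable (fun y : Cyl d => (B y.1 ^ 2 - C y.1 ^ 2) *
      (y.2 : EuclideanSpace ℝ (Fin d)) i ^ 2) (cylMeasure d) :=
    integrable_cyl (by fun_prop) hK fun s hs z => by simp [hB0 s hs, hC0 s hs]
  have i12 : Integrable (fun y : Cyl d => (A y.1 ^ 2 + C y.1 ^ 2) * 1 +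
      2 * A y.1 * B y.1 * (y.2 : EuclideanSpace ℝ (Fin d)) i) (cylMeasure d) := i1.add i2
  have j : ∀ {v : ℝ → ℝ}, Continuous v → (∀ s ∉ K, v s = 0) → Integrable fun s => v s ^ 2 :=
    fun hv h0 => integrable_sq hv (HasCompactSupport.intro hK h0)
  rw [integral_add i12 i3, integral_add i1 i2, cylMeasure_eq,
    integral_prod_mul (fun s => A s ^ 2 + C s ^ 2) (fun _ => (1 : ℝ)),
    integral_prod_mul (fun s => 2 * A s * B s) (fun z : Metric.sphere
      (0 : EuclideanSpace ℝ (Fin d)) 1 => (z : EuclideanSpace ℝ (Fin d)) i),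
    integral_prod_mul (fun s => B s ^ 2 - C s ^ 2) (fun z : Metric.sphere
      (0 : EuclideanSpace ℝ (Fin d)) 1 => (z : EuclideanSpace ℝ (Fin d)) i ^ 2),
    integral_sph_coord hd, integral_sph_coord_sq hd, integral_add (j hA hA0) (j hC hC0),
    integral_sub (j hB hB0) (j hC hC0), integral_const, smul_eq_mul]
  ring

/-! ### Trial functions -/

/-- The mass of the trial function `f (s) + h (s) z_i`, up to the factor `|S^{d-1}|`. -/
noncomputable def trialMass (d : ℕ) (f h : ℝ → ℝ) : ℝ := (∫ s, f s ^ 2) + (1 / d) * ∫ s, h s ^ 2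

/-- The energy of the trial function `f (s) + h (s) z_i`, up to the factor `|S^{d-1}|`. -/
noncomputable def trialEnergy (d : ℕ) (L : ℝ) (f h : ℝ → ℝ) : ℝ :=
  (∫ s, deriv f s ^ 2) + (1 / d) * (∫ s, deriv h s ^ 2) + (1 - 1 / d) * (∫ s, h s ^ 2) +
    L * trialMass d f h

/-- The trial function `f (s) + h (s) z_i`. -/
def trial {d : ℕ} (i : Fin d) (f h : ℝ → ℝ) (y : Cyl d) : ℝ :=
  f y.1 + h y.1 * (y.2 : EuclideanSpace ℝ (Fin d)) i

section trial

variable {d : ℕ} (i : Fin d) {f h : ℝ → ℝ}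

lemma continuous_trial (hf : Continuous f) (hh : Continuous h) : Continuous (trial i f h) :=
  (hf.comp continuous_fst).add ((hh.comp continuous_fst).mul
    ((continuous_coord i).comp (continuous_subtype_val.comp continuous_snd)))

lemma lintegral_trial_sq (hd : 2 ≤ d) (hf : Continuous f) (hh : Continuous h) {K : Set ℝ}
    (hK : IsCompact K) (hf0 : ∀ s ∉ K, f s = 0) (hh0 : ∀ s ∉ K, h s = 0) :
    ∫⁻ y, ENNReal.ofReal (trial i f h y ^ 2) ∂(cylMeasure d) =
      ENNReal.ofReal ((sph d).real Set.univ * trialMass d f h) := by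
  have := integral_cyl_quadratic hd i hf hh (C := fun _ => 0) continuous_const hK hf0 hh0
    fun _ _ => rfl
  simpa [trial, trialMass] using this

lemma hasFDerivAt_coord (x : EuclideanSpace ℝ (Fin d)) :
    HasFDerivAt (fun x : EuclideanSpace ℝ (Fin d) => x i)
      (InnerProductSpace.toDual ℝ _ (EuclideanSpace.single i (1 : ℝ))) x := by
  refine (EuclideanSpace.proj (𝕜 := ℝ) i).hasFDerivAt.congr_fderiv ?_
  ext y
  simp [EuclideanSpace.inner_single_left]

/-- The component along `z` is `P + Q z_i`; the tangential remainder `Q(e_i - z_i z)` has squared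
length `Q²(1 - z_i²)`. This produces the integrand of `integral_cyl_quadratic`, for the spherical
gradient and for the Euclidean one alike. -/
lemma norm_add_single_sq (P Q : ℝ) (z : Metric.sphere (0 : EuclideanSpace ℝ (Fin d)) 1) :
    ‖P • (z : EuclideanSpace ℝ (Fin d)) + Q • EuclideanSpace.single i (1 : ℝ)‖ ^ 2 =
      (P + Q * (z : EuclideanSpace ℝ (Fin d)) i) ^ 2 +
        Q ^ 2 * (1 - (z : EuclideanSpace ℝ (Fin d)) i ^ 2) := by
  rw [norm_add_sq_real, norm_smul, norm_smul, norm_sphere, real_inner_smul_left,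
    real_inner_smul_right, EuclideanSpace.inner_single_right]
  simp
  ring

/-- A trial function on the cylinder. -/
lemma exists_memH1_trial (hd : 2 ≤ d) (hf : ContDiff ℝ ∞ f) (hh : ContDiff ℝ ∞ h) {K : Set ℝ}
    (hK : IsCompact K) (hf0 : ∀ s ∉ K, f s = 0) (hh0 : ∀ s ∉ K, h s = 0) (θ a : ℝ) :
    ∃ (g : Cyl d → ℝ) (H : Cyl d → EuclideanSpace ℝ (Fin d)), MemH1 (trial i f h) g H ∧
      rhsCyl θ a (trial i f h) g H =
        ENNReal.ofReal ((sph d).real Set.univ *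
          trialEnergy d (((d : ℝ) - 2 - 2 * a) ^ 2 / 4) f h) ^ θ *
        ENNReal.ofReal ((sph d).real Set.univ * trialMass d f h) ^ (1 - θ) := by
  -- The bump is `1` on the ball of radius `2`, a neighbourhood of the unit sphere, so it alters
  -- neither the values nor the gradients there while making the extension compactly supported.
  let χ : ContDiffBump (0 : EuclideanSpace ℝ (Fin d)) := ⟨2, 3, by norm_num, by norm_num⟩
  set Φ : ℝ × EuclideanSpace ℝ (Fin d) → ℝ := fun y => (f y.1 + h y.1 * y.2 i) * χ y.2 with hΦ
  have hcoord : ContDiff ℝ ∞ fun y : ℝ × EuclideanSpace ℝ (Fin d) => y.2 i :=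
    (EuclideanSpace.proj (𝕜 := ℝ) i).contDiff.comp contDiff_snd
  have hΦs : ContDiff ℝ ∞ Φ :=
    ((hf.comp contDiff_fst).add ((hh.comp contDiff_fst).mul hcoord)).mul
      (χ.contDiff.comp contDiff_snd)
  have hΦc : HasCompactSupport Φ := by
    refine HasCompactSupport.intro (hK.prod χ.hasCompactSupport) fun y hy => ?_
    by_cases h1 : y.1 ∈ K
    · have h2 : y.2 ∉ tsupport χ := fun h2 => hy ⟨h1, h2⟩
      simp [hΦ, image_eq_zero_of_notMem_tsupport h2]
    · simp [hΦ, hf0 _ h1, hh0 _ h1]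
  have hnear : ∀ (s : ℝ) (z : Metric.sphere (0 : EuclideanSpace ℝ (Fin d)) 1),
      (fun x => Φ (s, x)) =ᶠ[𝓝 (z : EuclideanSpace ℝ (Fin d))] fun x => f s + h s * x i := by
    intro s z
    filter_upwards [Metric.isOpen_ball.mem_nhds (show (z : EuclideanSpace ℝ (Fin d)) ∈
      Metric.ball 0 2 by rw [mem_ball_zero_iff, norm_sphere]; norm_num)] with x hx
    rw [hΦ]
    simp only
    rw [χ.one_of_mem_closedBall (Metric.ball_subset_closedBall hx), mul_one]
  have hval : ∀ y : Cyl d, Φ (y.1, y.2) = trial i f h y := fun y => (hnear y.1 y.2).self_of_nhds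
  have hax : ∀ y : Cyl d, axialDeriv Φ y = trial i (deriv f) (deriv h) y := by
    intro y
    have : (fun t => Φ (t, (y.2 : EuclideanSpace ℝ (Fin d)))) =
        fun t => f t + h t * (y.2 : EuclideanSpace ℝ (Fin d)) i :=
      funext fun t => hval (t, y.2)
    rw [axialDeriv, this]
    exact ((hf.differentiable (by simp) _).hasDerivAt.add
      ((hh.differentiable (by simp) _).hasDerivAt.mul_const _)).deriv
  have hgrad : ∀ y : Cyl d, gradient (fun x => Φ (y.1, x)) (y.2 : EuclideanSpace ℝ (Fin d)) =
      h y.1 • EuclideanSpace.single i (1 : ℝ) := by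
    intro y
    rw [gradient, (hnear y.1 y.2).fderiv_eq,
      ((hasFDerivAt_coord i _).const_mul (h y.1) |>.const_add (f y.1)).fderiv]
    simp
  have hsph : ∀ y : Cyl d, sphericalGrad Φ y =
      (-(h y.1 * (y.2 : EuclideanSpace ℝ (Fin d)) i)) • (y.2 : EuclideanSpace ℝ (Fin d)) +
        h y.1 • EuclideanSpace.single i (1 : ℝ) := by
    intro y
    rw [sphericalGrad, hgrad, real_inner_smul_right, EuclideanSpace.inner_single_right, neg_smul,
      add_comm, sub_eq_add_neg]
    simp
  have hf' : Continuous (deriv f) := hf.continuous_deriv (by simp)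
  have hh' : Continuous (deriv h) := hh.continuous_deriv (by simp)
  have hcy : Continuous fun y : Cyl d => (y.2 : EuclideanSpace ℝ (Fin d)) :=
    continuous_subtype_val.comp continuous_snd
  have hHc : Continuous (sphericalGrad (d := d) Φ) := by
    rw [funext hsph]
    have h1 := hh.continuous.comp (continuous_fst (X := ℝ)
      (Y := Metric.sphere (0 : EuclideanSpace ℝ (Fin d)) 1))
    exact (((h1.mul ((continuous_coord i).comp hcy)).neg).smul hcy).add (h1.smul continuous_const)
  have hgc : Continuous (axialDeriv (d := d) Φ) := by
    rw [funext hax]; exact continuous_trial i hf' hh'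
  refine ⟨axialDeriv Φ, sphericalGrad Φ,
    ⟨(continuous_trial i hf.continuous hh.continuous).aestronglyMeasurable,
      hgc.aestronglyMeasurable, hHc.aestronglyMeasurable, fun _ => Φ, fun _ => ⟨hΦs, hΦc⟩, ?_, ?_, ?_⟩, ?_⟩
  · simp [hval]
  · simp
  · simp
  · have hE := integral_cyl_quadratic hd i hf' hh' hh.continuous hK
      (fun s hs => deriv_eq_zero_of_notMem hK.isClosed hf0 hs)
      (fun s hs => deriv_eq_zero_of_notMem hK.isClosed hh0 hs) hh0
    have hE' : ∫⁻ y, ENNReal.ofReal (axialDeriv Φ y ^ 2 + ‖sphericalGrad Φ y‖ ^ 2)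
        ∂(cylMeasure d) = ENNReal.ofReal ((sph d).real Set.univ * ((∫ s, deriv f s ^ 2) +
          (1 / d) * (∫ s, deriv h s ^ 2) + (1 - 1 / d) * ∫ s, h s ^ 2)) := by
      rw [← hE]
      refine lintegral_congr fun y => ?_
      rw [hax, hsph, norm_add_single_sq, trial, neg_add_cancel]
      congr 1; ring
    have hM := lintegral_trial_sq i hd hf.continuous hh.continuous hK hf0 hh0
    have hd1 : (1 : ℝ) / d ≤ 1 := by
      rw [div_le_one (by exact_mod_cast (by omega : 0 < d))]
      exact_mod_cast (by omega : 1 ≤ d)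
    rw [rhsCyl]
    simp only [sq_abs]
    rw [hE', hM, ← ENNReal.ofReal_mul (by positivity), ← ENNReal.ofReal_add]
    · congr 3
      rw [trialEnergy]; ring
    · have h1 : 0 ≤ ∫ s, deriv f s ^ 2 := integral_nonneg fun s => sq_nonneg _
      have h2 : 0 ≤ ∫ s, deriv h s ^ 2 := integral_nonneg fun s => sq_nonneg _
      have h3 : 0 ≤ ∫ s, h s ^ 2 := integral_nonneg fun s => sq_nonneg _
      have h4 : 0 ≤ 1 - 1 / (d : ℝ) := by linarith
      positivity
    · have h1 : 0 ≤ ∫ s, f s ^ 2 := integral_nonneg fun s => sq_nonneg _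
      have h3 : 0 ≤ ∫ s, h s ^ 2 := integral_nonneg fun s => sq_nonneg _
      rw [trialMass]
      positivity

lemma hasFDerivAt_log_norm {x : EuclideanSpace ℝ (Fin d)} (hx : x ≠ 0) :
    HasFDerivAt (fun x : EuclideanSpace ℝ (Fin d) => Real.log ‖x‖)
      (InnerProductSpace.toDual ℝ _ ((‖x‖ ^ 2)⁻¹ • x)) x := by
  have hx2 : ‖x‖ ^ 2 ≠ 0 := pow_ne_zero 2 (norm_ne_zero_iff.2 hx)
  have h1 := ((hasStrictFDerivAt_norm_sq x).hasFDerivAt.log hx2).const_mul (1 / 2 : ℝ)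
  have h2 : (fun x : EuclideanSpace ℝ (Fin d) => 1 / 2 * Real.log (‖x‖ ^ 2)) =
      fun x => Real.log ‖x‖ := funext fun x => by
    rw [Real.log_pow]; push_cast; ring
  rw [h2] at h1
  refine h1.congr_fderiv ?_
  ext y
  simp
  ring

/-- A trial function on the punctured space. -/
lemma exists_memD_trial (hd : 2 ≤ d) (hf : ContDiff ℝ ∞ f) (hh : ContDiff ℝ ∞ h) {K : Set ℝ}
    (hK : IsCompact K) (hf0 : ∀ s ∉ K, f s = 0) (hh0 : ∀ s ∉ K, h s = 0) {p : ℝ} (hp : 0 < p)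
    (θ a : ℝ) :
    ∃ (u : EuclideanSpace ℝ (Fin d) → ℝ) (G : EuclideanSpace ℝ (Fin d) → EuclideanSpace ℝ (Fin d)),
      MemD a u G ∧ lhsD p a u = lhsCyl p (trial i f h) ∧
      rhsD θ a u G =
        ENNReal.ofReal ((sph d).real Set.univ *
          trialEnergy d (((d : ℝ) - 2 - 2 * a) ^ 2 / 4) f h) ^ θ *
        ENNReal.ofReal ((sph d).real Set.univ * trialMass d f h) ^ (1 - θ) := by
  set α := ((d : ℝ) - 2 - 2 * a) / 2 with hα
  have hα2 : ((d : ℝ) - 2 - 2 * a) ^ 2 / 4 = α ^ 2 := by rw [hα]; ring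
  -- The inverse transformation: `u = |x|^{-α} f(log|x|) + |x|^{-(α+1)} h(log|x|) x_i`. The extra
  -- power compensates the factor `e^s` in `x_i`.
  set k : ℝ → ℝ := fun s => Real.exp (-α * s) * f s with hk
  set m : ℝ → ℝ := fun s => Real.exp (-(α + 1) * s) * h s with hm
  have hexp : ∀ c : ℝ, ContDiff ℝ ∞ fun s => Real.exp (c * s) := fun c =>
    Real.contDiff_exp.comp (contDiff_const.mul contDiff_id)
  have hks : ContDiff ℝ ∞ k := (hexp _).mul hf
  have hms : ContDiff ℝ ∞ m := (hexp _).mul hh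
  have hk0 : ∀ s ∉ K, k s = 0 := fun s hs => by simp [hk, hf0 s hs]
  have hm0 : ∀ s ∉ K, m s = 0 := fun s hs => by simp [hm, hh0 s hs]
  have hexpd : ∀ c s : ℝ, HasDerivAt (fun s => Real.exp (c * s)) (c * Real.exp (c * s)) s := by
    intro c s
    refine ((hasDerivAt_id s).const_mul c).exp.congr_deriv ?_
    simp; ring
  have hkd : ∀ s, deriv k s = Real.exp (-α * s) * (deriv f s - α * f s) := fun s => by
    have h1 : HasDerivAt k _ s := (hexpd _ s).mul (hf.differentiable (by simp) s).hasDerivAt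
    rw [h1.deriv]; ring
  have hmd : ∀ s, deriv m s = Real.exp (-(α + 1) * s) * (deriv h s - (α + 1) * h s) := fun s => by
    have h1 : HasDerivAt m _ s := (hexpd _ s).mul (hh.differentiable (by simp) s).hasDerivAt
    rw [h1.deriv]; ring
  set v : EuclideanSpace ℝ (Fin d) → ℝ := fun x => k (Real.log ‖x‖) + m (Real.log ‖x‖) * x i with hv
  -- Since `Real.log 0 = 0`, the formula for `v` has the value `f 0` at the origin, which need not
  -- vanish; the indicator restores smoothness there.
  set u : EuclideanSpace ℝ (Fin d) → ℝ := Set.indicator {0}ᶜ v with hu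
  have huv : ∀ x, x ≠ 0 → u x = v x := fun x hx => Set.indicator_of_mem (by simpa using hx) _
  have huv' : ∀ x, x ≠ 0 → u =ᶠ[𝓝 x] v := fun x hx => by
    filter_upwards [isOpen_compl_singleton.mem_nhds hx] with t ht using huv t ht
  -- the support
  obtain ⟨R, hR⟩ := hK.isBounded.subset_closedBall 0
  have hfar : ∀ x : EuclideanSpace ℝ (Fin d), (‖x‖ < Real.exp (-R) ∨ Real.exp R < ‖x‖) → u x = 0 := by
    intro x hx
    by_cases hx0 : x = 0
    · rw [hx0, hu]; simp
    · have hn : 0 < ‖x‖ := norm_pos_iff.2 hx0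
      have : Real.log ‖x‖ ∉ K := by
        intro hmem
        have := hR hmem
        rw [mem_closedBall_zero_iff, Real.norm_eq_abs, abs_le] at this
        rcases hx with h1 | h1
        · have := (Real.log_lt_iff_lt_exp hn).2 h1
          linarith
        · have := (Real.lt_log_iff_exp_lt hn).2 h1
          linarith
      rw [huv x hx0, hv]
      simp [hk0 _ this, hm0 _ this]
  have hsupp : tsupport u ⊆ Metric.closedBall 0 (Real.exp R) \ Metric.ball 0 (Real.exp (-R)) := by
    refine closure_minimal (fun x hx => ?_)
      (Metric.isClosed_closedBall.sdiff Metric.isOpen_ball)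
    by_contra hcon
    refine hx (hfar x ?_)
    simp only [Set.mem_sdiff, mem_closedBall_zero_iff, mem_ball_zero_iff, not_and_or, not_le,
      not_not] at hcon
    exact hcon.symm
  have huc : HasCompactSupport u :=
    (isCompact_closedBall _ _).of_isClosed_subset (isClosed_tsupport u)
      (hsupp.trans Set.sdiff_subset)
  have hu0 : (0 : EuclideanSpace ℝ (Fin d)) ∉ tsupport u := fun h0 => (hsupp h0).2
    (Metric.mem_ball_self (Real.exp_pos _))
  have hus : ContDiff ℝ ∞ u := by
    rw [contDiff_iff_contDiffAt]
    intro x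
    by_cases hx : x = 0
    · have : u =ᶠ[𝓝 x] fun _ => 0 := by
        rw [hx]
        filter_upwards [(isClosed_tsupport u).isOpen_compl.mem_nhds hu0] with t ht
        exact image_eq_zero_of_notMem_tsupport ht
      exact contDiffAt_const.congr_of_eventuallyEq this
    · have hl : ContDiffAt ℝ ∞ (fun x : EuclideanSpace ℝ (Fin d) => Real.log ‖x‖) x :=
        (contDiffAt_norm ℝ hx).log (norm_ne_zero_iff.2 hx)
      refine ContDiffAt.congr_of_eventuallyEq ?_ (huv' x hx)
      exact (hks.contDiffAt.comp x hl).add ((hms.contDiffAt.comp x hl).mul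
        (EuclideanSpace.proj (𝕜 := ℝ) i).contDiff.contDiffAt)
  have hgrad : ∀ x, x ≠ 0 → gradient u x =
      ((deriv k (Real.log ‖x‖) + deriv m (Real.log ‖x‖) * x i) * (‖x‖ ^ 2)⁻¹) • x +
        m (Real.log ‖x‖) • EuclideanSpace.single i (1 : ℝ) := by
    intro x hx
    have h1 := (hks.differentiable (by simp) (Real.log ‖x‖)).hasDerivAt.comp_hasFDerivAt x
      (hasFDerivAt_log_norm hx)
    have h2 := (hms.differentiable (by simp) (Real.log ‖x‖)).hasDerivAt.comp_hasFDerivAt x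
      (hasFDerivAt_log_norm hx)
    have h3 := h1.add (h2.mul (hasFDerivAt_coord i x))
    have h4 : fderiv ℝ v x = _ := h3.fderiv
    rw [gradient, (huv' x hx).fderiv_eq, h4]
    simp only [map_add, map_smul, LinearIsometryEquiv.symm_apply_apply, Function.comp_apply,
      smul_smul, add_mul, add_smul]
    module
  -- the transformed functions
  have hne : ∀ y : Cyl d, expPolar y ≠ 0 := fun y => by
    rw [← norm_ne_zero_iff, norm_expPolar]; exact (Real.exp_pos _).ne'
  have hcoordy : ∀ y : Cyl d, expPolar y i = Real.exp y.1 * (y.2 : EuclideanSpace ℝ (Fin d)) i :=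
    fun y => rfl
  have hW : emden α u = trial i f h := by
    funext y
    rw [emden, huv _ (hne y), hv, trial]
    simp only [norm_expPolar, Real.log_exp, hcoordy, hk, hm, smul_eq_mul]
    have e1 : Real.exp (α * y.1) * Real.exp (-α * y.1) = 1 := by
      rw [← Real.exp_add, Real.exp_eq_one_iff]; ring
    have e2 : Real.exp (α * y.1) * Real.exp (-(α + 1) * y.1) * Real.exp y.1 = 1 := by
      rw [← Real.exp_add, ← Real.exp_add, Real.exp_eq_one_iff]; ring
    linear_combination f y.1 * e1 + h y.1 * (y.2 : EuclideanSpace ℝ (Fin d)) i * e2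
  have hG : ∀ y : Cyl d, emden (α + 1) (gradient u) y =
      ((deriv f y.1 - α * f y.1) + (deriv h y.1 - (α + 1) * h y.1) *
        (y.2 : EuclideanSpace ℝ (Fin d)) i) • (y.2 : EuclideanSpace ℝ (Fin d)) +
        h y.1 • EuclideanSpace.single i (1 : ℝ) := by
    intro y
    rw [emden, hgrad _ (hne y)]
    simp only [norm_expPolar, Real.log_exp, hcoordy, hkd, hmd, smul_add, smul_smul]
    simp only [hm]
    have e1 : Real.exp ((α + 1) * y.1) * Real.exp (-(α + 1) * y.1) = 1 := by
      rw [← Real.exp_add, Real.exp_eq_one_iff]; ring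
    have e2 : Real.exp (-(α + 1) * y.1) * Real.exp y.1 = Real.exp (-α * y.1) := by
      rw [← Real.exp_add]; congr 1; ring
    have e3 : Real.exp y.1 * Real.exp y.1 * (Real.exp y.1 ^ 2)⁻¹ = 1 := by
      field_simp
    rw [expPolar, smul_smul]
    congr 2
    · rw [← e2]
      generalize Real.exp ((α + 1) * y.1) = E1 at *
      generalize Real.exp (-(α + 1) * y.1) = E2 at *
      generalize (Real.exp y.1 ^ 2)⁻¹ = E3 at *
      generalize Real.exp y.1 = E4 at *
      linear_combination ((deriv f y.1 - α * f y.1) + (deriv h y.1 - (α + 1) * h y.1) *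
        (y.2 : EuclideanSpace ℝ (Fin d)) i) * (E1 * E2 * e3 + e1)
    · linear_combination h y.1 * e1
  have hgc := continuous_gradient hus
  have hum := hus.continuous.aestronglyMeasurable (μ := volume)
  refine ⟨u, gradient u, ⟨hum, hgc.aestronglyMeasurable, fun _ => u,
    fun _ => ⟨hus, huc, hu0⟩, by simp, by simp⟩, ?_, ?_⟩
  · rw [lhsD_eq hd hum hp, ← hα, hW]
  · have hf' : Continuous (deriv f) := hf.continuous_deriv (by simp)
    have hh' : Continuous (deriv h) := hh.continuous_deriv (by simp)
    have hfd : ∀ s ∉ K, deriv f s = 0 := fun s hs => deriv_eq_zero_of_notMem hK.isClosed hf0 hs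
    have hhd : ∀ s ∉ K, deriv h s = 0 := fun s hs => deriv_eq_zero_of_notMem hK.isClosed hh0 hs
    -- The vector `h e_i` adds `h z_i` to the radial component, which changes `h' - (α+1)h` into `h'
    -- - αh`.
    have hE := integral_cyl_quadratic (A := fun s => deriv f s - α * f s)
      (B := fun s => deriv h s - α * h s) hd i (hf'.sub (continuous_const.mul hf.continuous))
      (hh'.sub (continuous_const.mul hh.continuous)) hh.continuous hK
      (fun s hs => by simp [hf0 s hs, hfd s hs]) (fun s hs => by simp [hh0 s hs, hhd s hs]) hh0
    rw [integral_deriv_sub_sq (hf.of_le (by simp)) (HasCompactSupport.intro hK hf0),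
      integral_deriv_sub_sq (hh.of_le (by simp)) (HasCompactSupport.intro hK hh0)] at hE
    have hM := lintegral_trial_sq i hd hf.continuous hh.continuous hK hf0 hh0
    rw [rhsD_eq hd hum hgc.aestronglyMeasurable, ← hα, hW, hα2]
    simp only [Real.norm_eq_abs, sq_abs]
    rw [hM]
    congr 2
    rw [trialEnergy, trialMass,
      show (∫ s, deriv f s ^ 2) + (1 / d) * (∫ s, deriv h s ^ 2) + (1 - 1 / d) * (∫ s, h s ^ 2) +
        α ^ 2 * ((∫ s, f s ^ 2) + (1 / d) * ∫ s, h s ^ 2) =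
        ((∫ s, deriv f s ^ 2) + α ^ 2 * ∫ s, f s ^ 2) + 1 / d *
          ((∫ s, deriv h s ^ 2) + α ^ 2 * ∫ s, h s ^ 2) + (1 - 1 / d) * (∫ s, h s ^ 2) by ring, ← hE]
    refine lintegral_congr fun y => ?_
    rw [hG, norm_add_single_sq]
    congr 1; ring

end trial

/-! ### Truncation -/

/-- Rescalings of one bump function: the derivatives are bounded uniformly in `n`, as dominated
convergence requires, and at each point the sequence is eventually constant. -/
lemma exists_cutoff : ∃ (χ : ℕ → ℝ → ℝ) (C : ℝ), (∀ n, ContDiff ℝ ∞ (χ n)) ∧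
    (∀ n, ∃ K, IsCompact K ∧ ∀ s ∉ K, χ n s = 0) ∧ (∀ n s, 0 ≤ χ n s) ∧ (∀ n s, χ n s ≤ 1) ∧
    (∀ n s, |deriv (χ n) s| ≤ C) ∧ ∀ s, ∀ᶠ n in atTop, χ n s = 1 ∧ deriv (χ n) s = 0 := by
  let χ : ContDiffBump (0 : ℝ) := ⟨1, 2, by norm_num, by norm_num⟩
  have hχ : ContDiff ℝ ∞ χ := χ.contDiff
  obtain ⟨C, hC⟩ := (hχ.continuous_deriv (by simp)).bounded_above_of_compact_support
    χ.hasCompactSupport.deriv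
  have hpos : ∀ n : ℕ, (0 : ℝ) < (n : ℝ) + 1 := fun n => by positivity
  have hder : ∀ (n : ℕ) s, deriv (fun s => χ (((n : ℝ) + 1)⁻¹ * s)) s =
      ((n : ℝ) + 1)⁻¹ * deriv χ (((n : ℝ) + 1)⁻¹ * s) := fun n s => by
    rw [deriv_comp_mul_left, smul_eq_mul]
  refine ⟨fun n s => χ (((n : ℝ) + 1)⁻¹ * s), C, fun n => hχ.comp (contDiff_const.mul contDiff_id),
    fun n => ⟨Metric.closedBall 0 (2 * (n + 1)), isCompact_closedBall _ _, fun s hs => ?_⟩,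
    fun n s => χ.nonneg, fun n s => χ.le_one, fun n s => ?_, fun s => ?_⟩
  · refine χ.zero_of_le_dist ?_
    rw [mem_closedBall_zero_iff, not_le, Real.norm_eq_abs] at hs
    rw [dist_zero_right, Real.norm_eq_abs, abs_mul, abs_of_pos (inv_pos.2 (hpos n)),
      inv_mul_eq_div, le_div_iff₀ (hpos n)]
    exact hs.le
  · rw [hder, abs_mul, abs_of_pos (inv_pos.2 (hpos n))]
    calc _ ≤ 1 * |deriv χ (((n : ℝ) + 1)⁻¹ * s)| := by
          refine mul_le_mul_of_nonneg_right ?_ (abs_nonneg _)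
          exact inv_le_one_of_one_le₀ (by linarith [n.cast_nonneg (α := ℝ)])
      _ ≤ C := by rw [one_mul]; exact hC _
  · filter_upwards [eventually_gt_atTop ⌈|s|⌉₊] with n hn
    have hlt : |((n : ℝ) + 1)⁻¹ * s| < 1 := by
      rw [abs_mul, abs_of_pos (inv_pos.2 (hpos n)), inv_mul_eq_div, div_lt_one (hpos n)]
      have := Nat.lt_of_ceil_lt hn
      linarith
    have hmem : ((n : ℝ) + 1)⁻¹ * s ∈ Metric.ball (0 : ℝ) 1 := by
      rwa [mem_ball_zero_iff, Real.norm_eq_abs]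
    refine ⟨χ.one_of_mem_closedBall (Metric.ball_subset_closedBall hmem), ?_⟩
    have : χ =ᶠ[𝓝 (((n : ℝ) + 1)⁻¹ * s)] fun _ => 1 := by
      filter_upwards [Metric.isOpen_ball.mem_nhds hmem] with t ht
      exact χ.one_of_mem_closedBall (Metric.ball_subset_closedBall ht)
    rw [hder, this.deriv_eq, deriv_const, mul_zero]

lemma tendsto_integral_cutoff_rpow {χ : ℕ → ℝ → ℝ} (h0 : ∀ n s, 0 ≤ χ n s)
    (h1 : ∀ n s, χ n s ≤ 1) (hχ : ∀ n, Continuous (χ n))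
    (hlim : ∀ s, ∀ᶠ n in atTop, χ n s = 1) {r : ℝ} (hr : 0 ≤ r) {g : ℝ → ℝ} (hg : Integrable g) :
    Tendsto (fun n => ∫ s, χ n s ^ r * g s) atTop (𝓝 (∫ s, g s)) := by
  refine tendsto_integral_of_dominated_convergence (fun s => ‖g s‖) (fun n => ?_) hg.norm
    (fun n => Eventually.of_forall fun s => ?_) (Eventually.of_forall fun s => ?_)
  · exact ((hχ n).rpow_const fun _ => Or.inr hr).aestronglyMeasurable.mul hg.aestronglyMeasurable
  · rw [norm_mul, Real.norm_of_nonneg (Real.rpow_nonneg (h0 n s) _)]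
    exact mul_le_of_le_one_left (norm_nonneg _) (Real.rpow_le_one (h0 n s) (h1 n s) hr)
  · refine tendsto_const_nhds.congr' ?_
    filter_upwards [hlim s] with n hn
    rw [hn, Real.one_rpow, one_mul]

lemma tendsto_integral_cutoff_sq {χ : ℕ → ℝ → ℝ} (h0 : ∀ n s, 0 ≤ χ n s)
    (h1 : ∀ n s, χ n s ≤ 1) (hχ : ∀ n, Continuous (χ n))
    (hlim : ∀ s, ∀ᶠ n in atTop, χ n s = 1) {v : ℝ → ℝ} (hv : Integrable fun s => v s ^ 2) :
    Tendsto (fun n => ∫ s, (χ n s * v s) ^ 2) atTop (𝓝 (∫ s, v s ^ 2)) := by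
  refine (tendsto_integral_cutoff_rpow h0 h1 hχ hlim zero_le_two hv).congr fun n => ?_
  simp only [Real.rpow_two, mul_pow]

lemma tendsto_integral_deriv_cutoff_sq {χ : ℕ → ℝ → ℝ} (h0 : ∀ n s, 0 ≤ χ n s)
    (h1 : ∀ n s, χ n s ≤ 1) {C : ℝ}
    (hχ : ∀ n, ContDiff ℝ ∞ (χ n))
    (hC : ∀ n s, |deriv (χ n) s| ≤ C)
    (hlim : ∀ s, ∀ᶠ n in atTop, χ n s = 1 ∧ deriv (χ n) s = 0) {v : ℝ → ℝ} (hv : ContDiff ℝ ∞ v)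
    (i0 : Integrable fun s => v s ^ 2) (i1 : Integrable fun s => deriv v s ^ 2) :
    Tendsto (fun n => ∫ s, deriv (fun s => χ n s * v s) s ^ 2) atTop
      (𝓝 (∫ s, deriv v s ^ 2)) := by
  have hder : ∀ n s, deriv (fun s => χ n s * v s) s = deriv (χ n) s * v s + χ n s * deriv v s :=
    fun n s => (((hχ n).differentiable (by simp) s).hasDerivAt.mul
      (hv.differentiable (by simp) s).hasDerivAt).deriv
  simp only [hder]
  refine tendsto_integral_of_dominated_convergence
    (fun s => 2 * (C ^ 2 * v s ^ 2 + deriv v s ^ 2)) (fun n => ?_)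
    (((i0.const_mul _).add i1).const_mul 2) (fun n => Eventually.of_forall fun s => ?_)
    (Eventually.of_forall fun s => ?_)
  · exact ((((((hχ n).continuous_deriv (by simp)).mul hv.continuous).add
      ((hχ n).continuous.mul (hv.continuous_deriv (by simp)))).pow 2)).aestronglyMeasurable
  · rw [Real.norm_of_nonneg (sq_nonneg _)]
    have e1 : (deriv (χ n) s * v s) ^ 2 ≤ C ^ 2 * v s ^ 2 := by
      rw [mul_pow, ← sq_abs (deriv (χ n) s)]
      gcongr
      exact hC n s
    have e2 : (χ n s * deriv v s) ^ 2 ≤ deriv v s ^ 2 := by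
      rw [mul_pow]
      exact mul_le_of_le_one_left (sq_nonneg _) (pow_le_one₀ (h0 n s) (h1 n s))
    nlinarith [sq_nonneg (deriv (χ n) s * v s - χ n s * deriv v s)]
  · refine tendsto_const_nhds.congr' ?_
    filter_upwards [hlim s] with n hn
    rw [hn.1, hn.2]; ring

/-! ### The second variation -/

/-- Second order lower bound for powers near `1`. -/
lemma eventually_quadratic_le_rpow {p c : ℝ} (hc : c < p * (p - 1) / 2) :
    ∀ᶠ x : ℝ in 𝓝 0, 1 + p * x + c * x ^ 2 ≤ |1 + x| ^ p := by
  set g : ℝ → ℝ := fun x => (1 + x) ^ p - (1 + p * x + c * x ^ 2) with hg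
  have hpos : ∀ᶠ x : ℝ in 𝓝 0, 0 < 1 + x :=
    (continuous_const.add continuous_id).continuousAt.eventually_const_lt (by simp)
  have hd1 : ∀ x : ℝ, 0 < 1 + x → HasDerivAt g (p * (1 + x) ^ (p - 1) - (p + 2 * c * x)) x := by
    intro x hx
    have h1 : HasDerivAt (fun x : ℝ => (1 + x) ^ p) (p * (1 + x) ^ (p - 1)) x := by
      simpa using ((hasDerivAt_id x).const_add 1).rpow_const (p := p) (Or.inl hx.ne')
    have h2 : HasDerivAt (fun x : ℝ => 1 + p * x + c * x ^ 2) (p + 2 * c * x) x := by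
      have := (((hasDerivAt_id x).const_mul p).const_add 1).add (((hasDerivAt_id x).pow 2).const_mul c)
      refine this.congr_deriv ?_
      simp; ring
    exact h1.sub h2
  have hd : deriv g =ᶠ[𝓝 0] fun x => p * (1 + x) ^ (p - 1) - (p + 2 * c * x) := by
    filter_upwards [hpos] with x hx using (hd1 x hx).deriv
  have hd2 : deriv (deriv g) 0 = p * (p - 1) - 2 * c := by
    rw [hd.deriv_eq]
    have h1 : HasDerivAt (fun x : ℝ => (1 + x) ^ (p - 1)) (p - 1) 0 := by
      simpa using ((hasDerivAt_id (0 : ℝ)).const_add 1).rpow_const (p := p - 1) (Or.inl (by simp))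
    have h2 : HasDerivAt (fun x : ℝ => p + 2 * c * x) (2 * c) 0 := by
      simpa using ((hasDerivAt_id (0 : ℝ)).const_mul (2 * c)).const_add p
    exact ((h1.const_mul p).sub h2).deriv
  have hmin := isLocalMin_of_deriv_deriv_pos (f := g) (x₀ := 0) (by rw [hd2]; linarith)
    (by rw [hd.self_of_nhds]; simp) (hd1 0 (by simp)).continuousAt
  filter_upwards [hmin, hpos] with x hx hx1
  have : g 0 = 0 := by simp [hg]
  rw [this] at hx
  rw [abs_of_pos hx1]
  linarith

/-- Both sides are `1` at `t = 0`, and the hypothesis compares their slopes there. -/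
lemma eventually_affine_lt_rpow {β r q : ℝ} (h : β < q * r) :
    ∀ᶠ t : ℝ in 𝓝[>] 0, 1 + t * β < (1 + t * r) ^ q := by
  set g : ℝ → ℝ := fun t => (1 + t * r) ^ q - (1 + t * β) with hg
  have hd : HasDerivAt g (q * r - β) 0 := by
    have h1 : HasDerivAt (fun t : ℝ => (1 + t * r) ^ q) (q * r) 0 := by
      have := (((hasDerivAt_id (0 : ℝ)).mul_const r).const_add 1).rpow_const (p := q)
        (Or.inl (by simp))
      simpa [mul_comm] using this
    have h2 : HasDerivAt (fun t : ℝ => 1 + t * β) β 0 := by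
      simpa using ((hasDerivAt_id (0 : ℝ)).mul_const β).const_add 1
    exact h1.sub h2
  have hs := (hd.tendsto_slope.mono_left (nhdsGT_le_nhdsNE 0)).eventually_const_lt (sub_pos.2 h)
  filter_upwards [hs, self_mem_nhdsWithin] with t ht ht0
  have ht0' : 0 < t := ht0
  have hg0 : g 0 = 0 := by simp [hg]
  rw [slope_def_field, hg0, sub_zero, sub_zero] at ht
  have := (div_pos_iff_of_pos_right ht0').1 ht
  linarith

/-! ### Symmetry breaking -/

lemma sph_real_pos {d : ℕ} (hd : 2 ≤ d) : 0 < (sph d).real Set.univ :=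
  ENNReal.toReal_pos (sph_univ_ne_zero hd) (measure_ne_top _ _)

/-- All elements of `S` lie above the fixed number `b / c > x`, so strictness survives the infimum.
-/
lemma lt_sInf_of_mul_lt {x b c : ℝ≥0∞} {S : Set ℝ≥0∞} (hx : x ≠ ⊤) (hc : c ≠ ⊤)
    (h : x * c < b)
    (hS : ∀ K ∈ S, b ≤ K * c) : x < sInf S := by
  have h1 : x < b / c := by
    rw [ENNReal.lt_div_iff_mul_lt (Or.inr hx) (Or.inl hc)]
    exact h
  exact h1.trans_le (le_sInf fun K hK => ENNReal.div_le_of_le_mul (hS K hK))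

/-- A good trial function breaks the symmetry. -/
lemma symmetryBreaking_of_trial {d : ℕ} (hd : 2 ≤ d) {p θ a : ℝ} (hp : 2 < p)
    (hL : 0 < ((d : ℝ) - 2 - 2 * a) ^ 2 / 4) (hθ : (p - 2) / (2 * p) < θ) (hθ1 : θ ≤ 1)
    (i : Fin d) {f h : ℝ → ℝ} (hf : ContDiff ℝ ∞ f) (hh : ContDiff ℝ ∞ h) {K : Set ℝ}
    (hK : IsCompact K) (hf0 : ∀ s ∉ K, f s = 0) (hh0 : ∀ s ∉ K, h s = 0) {m : ℝ} (hm : 0 ≤ m)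
    (hle : ENNReal.ofReal ((sph d).real Set.univ * m) ≤
      ∫⁻ y, ENNReal.ofReal (|trial i f h y| ^ p) ∂(cylMeasure d))
    (hM : 0 ≤ trialMass d f h) (hE : 0 ≤ trialEnergy d (((d : ℝ) - 2 - 2 * a) ^ 2 / 4) f h)
    (hlt : lineConst p θ (((d : ℝ) - 2 - 2 * a) ^ 2 / 4) *
      (trialEnergy d (((d : ℝ) - 2 - 2 * a) ^ 2 / 4) f h ^ θ * trialMass d f h ^ (1 - θ)) <
        m ^ (2 / p)) :
    SymmetryBreaking d θ p a := by
  have hp0 : 0 < p := by linarith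
  have hθ0 : 0 ≤ θ := (div_pos (by linarith) (by linarith : 0 < 2 * p)).le.trans hθ.le
  have hS := sph_real_pos hd
  have hlc := lineConst_pos hp hL hθ
  set L := ((d : ℝ) - 2 - 2 * a) ^ 2 / 4
  set E := trialEnergy d L f h
  set M := trialMass d f h
  set S := (sph d).real Set.univ
  set R : ℝ≥0∞ := ENNReal.ofReal (S * E) ^ θ * ENNReal.ofReal (S * M) ^ (1 - θ)
  have hR : R ≠ ⊤ := ENNReal.mul_ne_top (ENNReal.rpow_ne_top_of_nonneg hθ0 ENNReal.ofReal_ne_top)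
    (ENNReal.rpow_ne_top_of_nonneg (by linarith) ENNReal.ofReal_ne_top)
  have key : symConst d p θ L * R < lhsCyl p (trial i f h) := by
    refine lt_of_lt_of_le ?_ (ENNReal.rpow_le_rpow hle (by positivity))
    have hSS : sph d Set.univ = ENNReal.ofReal S :=
      (ENNReal.ofReal_toReal (measure_ne_top _ _)).symm
    have hRR : R = ENNReal.ofReal ((S * E) ^ θ * (S * M) ^ (1 - θ)) := by
      rw [ENNReal.ofReal_mul (by positivity), ← ENNReal.ofReal_rpow_of_nonneg (by positivity) hθ0,
        ← ENNReal.ofReal_rpow_of_nonneg (by positivity) (by linarith)]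
    rw [symConst, hSS, ENNReal.ofReal_rpow_of_pos hS, ← ENNReal.ofReal_mul (by positivity), hRR,
      ← ENNReal.ofReal_mul (by positivity),
      ENNReal.ofReal_rpow_of_nonneg (by positivity) (by positivity), ENNReal.ofReal_lt_ofReal_iff']
    have e1 : S ^ (2 / p - 1) * lineConst p θ L * ((S * E) ^ θ * (S * M) ^ (1 - θ)) =
        S ^ (2 / p) * (lineConst p θ L * (E ^ θ * M ^ (1 - θ))) := by
      rw [Real.mul_rpow hS.le hE, Real.mul_rpow hS.le hM]
      have e2 : S ^ (2 / p - 1) * S ^ θ * S ^ (1 - θ) = S ^ (2 / p) := by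
        rw [← Real.rpow_add hS, ← Real.rpow_add hS]; congr 1; ring
      rw [← e2]; ring
    have hlt' : S ^ (2 / p - 1) * lineConst p θ L * ((S * E) ^ θ * (S * M) ^ (1 - θ)) <
        (S * m) ^ (2 / p) := by
      rw [e1, Real.mul_rpow hS.le hm]
      exact mul_lt_mul_of_pos_left hlt (by positivity)
    exact ⟨hlt', lt_of_le_of_lt (by positivity) hlt'⟩
  have hcyl : symConst d p θ L < optConstCyl d θ p a := by
    obtain ⟨g, H, hmem, hrhs⟩ := exists_memH1_trial i hd hf hh hK hf0 hh0 θ a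
    refine lt_sInf_of_mul_lt (symConst_ne_top hd _ _ _) hR key fun K hK => ?_
    exact (hK _ g H hmem).trans_eq (by rw [hrhs])
  have hspace : symConst d p θ L < optConst d θ p a := by
    obtain ⟨u, G, hmem, hlhs, hrhs⟩ := exists_memD_trial i hd hf hh hK hf0 hh0 hp0 θ a
    refine lt_sInf_of_mul_lt (symConst_ne_top hd _ _ _) hR key fun K hK => ?_
    rw [← hlhs]
    exact (hK u G hmem).trans_eq (by rw [hrhs])
  exact ⟨(optConstRadial_le hd hp hL hθ hθ1).trans_lt hspace,
    not_achievedByRadial hd hp hL hθ hθ1 hspace, (optConstAxial_le hd hp hL hθ hθ1).trans_lt hcyl,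
    not_achievedByAxial hd hp hL hθ hθ1 hcyl⟩

lemma trialMass_nonneg (d : ℕ) (f h : ℝ → ℝ) : 0 ≤ trialMass d f h := by
  have h1 : 0 ≤ ∫ s, f s ^ 2 := integral_nonneg fun s => sq_nonneg _
  have h2 : 0 ≤ ∫ s, h s ^ 2 := integral_nonneg fun s => sq_nonneg _
  rw [trialMass]; positivity

lemma trialEnergy_nonneg {d : ℕ} (hd : 2 ≤ d) {L : ℝ} (hL : 0 ≤ L) (f h : ℝ → ℝ) :
    0 ≤ trialEnergy d L f h := by
  have h1 : 0 ≤ ∫ s, deriv f s ^ 2 := integral_nonneg fun s => sq_nonneg _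
  have h2 : 0 ≤ ∫ s, deriv h s ^ 2 := integral_nonneg fun s => sq_nonneg _
  have h3 : 0 ≤ ∫ s, h s ^ 2 := integral_nonneg fun s => sq_nonneg _
  have h4 := trialMass_nonneg d f h
  have h5 : 0 ≤ 1 - 1 / (d : ℝ) := by
    rw [sub_nonneg, div_le_one (by exact_mod_cast (by omega : 0 < d))]
    exact_mod_cast (by omega : 1 ≤ d)
  rw [trialEnergy]; positivity

/-- Lower bound for the integral of the power `p` of the truncated perturbed optimizer. -/
lemma lintegral_trial_rpow_ge {d : ℕ} (hd : 2 ≤ d) (i : Fin d) {p k c e : ℝ} (hp : 2 < p)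
    (he : 0 ≤ e) (hquad : ∀ x : ℝ, |x| ≤ e → 1 + p * x + c * x ^ 2 ≤ |1 + x| ^ p)
    {χ : ℝ → ℝ} (hχ : Continuous χ) (h0 : ∀ s, 0 ≤ χ s) {K : Set ℝ} (hK : IsCompact K)
    (hχ0 : ∀ s ∉ K, χ s = 0) :
    ENNReal.ofReal ((sph d).real Set.univ *
      ((∫ s, χ s ^ p * sechPow k (2 * (2 / (p - 2)) + 2) s) + e ^ 2 / d * c *
        ∫ s, χ s ^ p * sechPow k (2 * (2 / (p - 2)) + 2 + 2) s)) ≤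
      ∫⁻ y, ENNReal.ofReal (|trial i (fun s => χ s * sechPow k (2 / (p - 2)) s)
        (fun s => χ s * (e * sechPow k (2 / (p - 2) + 1) s)) y| ^ p) ∂(cylMeasure d) := by
  have hp0 : 0 < p := by linarith
  have hp2 : p - 2 ≠ 0 := by linarith
  set b := 2 / (p - 2) with hb
  have hbp : b * p = 2 * b + 2 := by rw [hb]; field_simp; ring
  have hsc := continuous_sechPow k
  have hz : Continuous fun y : Cyl d => (y.2 : EuclideanSpace ℝ (Fin d)) i :=
    (continuous_coord i).comp (continuous_subtype_val.comp continuous_snd)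
  have hχp : Continuous fun y : Cyl d => χ y.1 ^ p :=
    (hχ.comp continuous_fst).rpow_const fun _ => Or.inr hp0.le
  have hs' : ∀ q, Continuous fun y : Cyl d => sechPow k q y.1 := fun q =>
    (hsc q).comp continuous_fst
  have hz1 : ∀ y : Cyl d, |(y.2 : EuclideanSpace ℝ (Fin d)) i| ≤ 1 := fun y => by
    exact (PiLp.norm_apply_le _ i).trans_eq (norm_sphere y.2)
  have i1 : Integrable (fun y : Cyl d => (χ y.1 ^ p * sechPow k (2 * b + 2) y.1) * 1)
      (cylMeasure d) := integrable_cyl ((hχp.mul (hs' _)).mul continuous_const) hK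
    fun s hs z => by simp [hχ0 s hs, Real.zero_rpow hp0.ne']
  have i2 : Integrable (fun y : Cyl d => (χ y.1 ^ p * (p * e * sechPow k (2 * b + 3) y.1)) *
      (y.2 : EuclideanSpace ℝ (Fin d)) i) (cylMeasure d) :=
    integrable_cyl ((hχp.mul (continuous_const.mul (hs' _))).mul hz) hK
    fun s hs z => by simp [hχ0 s hs, Real.zero_rpow hp0.ne']
  have i3 : Integrable (fun y : Cyl d => (c * e ^ 2 * (χ y.1 ^ p * sechPow k (2 * b + 2 + 2) y.1)) *
      (y.2 : EuclideanSpace ℝ (Fin d)) i ^ 2) (cylMeasure d) :=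
    integrable_cyl ((continuous_const.mul (hχp.mul (hs' _))).mul (hz.pow 2)) hK
    fun s hs z => by simp [hχ0 s hs, Real.zero_rpow hp0.ne']
  have i12 : Integrable (fun y : Cyl d => (χ y.1 ^ p * sechPow k (2 * b + 2) y.1) * 1 +
      (χ y.1 ^ p * (p * e * sechPow k (2 * b + 3) y.1)) * (y.2 : EuclideanSpace ℝ (Fin d)) i)
      (cylMeasure d) := i1.add i2
  have iT : Integrable (fun y => |trial i (fun s => χ s * sechPow k b s)
      (fun s => χ s * (e * sechPow k (b + 1) s)) y| ^ p) (cylMeasure d) := by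
    refine integrable_cyl ((continuous_trial i (hχ.mul (hsc _))
      (hχ.mul (continuous_const.mul (hsc _)))).abs.rpow_const fun _ => Or.inr hp0.le) hK
      fun s hs z => by simp [trial, hχ0 s hs, Real.zero_rpow hp0.ne']
  rw [← ofReal_integral_eq_lintegral_ofReal iT
    (Eventually.of_forall fun y => Real.rpow_nonneg (abs_nonneg _) _)]
  refine ENNReal.ofReal_le_ofReal ?_
  -- The term linear in `e` integrates to zero because `z_i` has mean zero on the sphere; the
  -- quadratic one picks up `1/d`.
  have hI : (sph d).real Set.univ *
      ((∫ s, χ s ^ p * sechPow k (2 * b + 2) s) + e ^ 2 / d * c *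
        ∫ s, χ s ^ p * sechPow k (2 * b + 2 + 2) s) =
      ∫ y : Cyl d, (χ y.1 ^ p * sechPow k (2 * b + 2) y.1) * 1 +
        (χ y.1 ^ p * (p * e * sechPow k (2 * b + 3) y.1)) * (y.2 : EuclideanSpace ℝ (Fin d)) i +
        (c * e ^ 2 * (χ y.1 ^ p * sechPow k (2 * b + 2 + 2) y.1)) *
          (y.2 : EuclideanSpace ℝ (Fin d)) i ^ 2 ∂(cylMeasure d) := by
    rw [integral_add i12 i3, integral_add i1 i2, cylMeasure_eq,
      integral_prod_mul (fun s => χ s ^ p * sechPow k (2 * b + 2) s) (fun _ => (1 : ℝ)),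
      integral_prod_mul (fun s => χ s ^ p * (p * e * sechPow k (2 * b + 3) s))
        (fun z : Metric.sphere (0 : EuclideanSpace ℝ (Fin d)) 1 => (z : EuclideanSpace ℝ (Fin d)) i),
      integral_prod_mul (fun s => c * e ^ 2 * (χ s ^ p * sechPow k (2 * b + 2 + 2) s))
        (fun z : Metric.sphere (0 : EuclideanSpace ℝ (Fin d)) 1 =>
          (z : EuclideanSpace ℝ (Fin d)) i ^ 2),
      integral_sph_coord hd, integral_sph_coord_sq hd, integral_const_mul, integral_const,
      smul_eq_mul]
    ring
  rw [hI]
  refine integral_mono (i12.add i3) iT fun y => ?_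
  set ζ := (y.2 : EuclideanSpace ℝ (Fin d)) i
  -- `x` is the ratio of the perturbation to the optimizer. As `ψ = w / cosh(ks)`, it is at most `e`
  -- on the whole cylinder, so a quadratic bound near `1` is enough.
  set x := e * sechPow k 1 y.1 * ζ with hx
  have hxe : |x| ≤ e := by
    rw [hx, abs_mul, abs_mul, abs_of_nonneg he, abs_of_pos (sechPow_pos _ _ _), mul_assoc]
    refine mul_le_of_le_one_right he ?_
    exact mul_le_one₀ (sechPow_le_one zero_le_one _) (abs_nonneg _) (hz1 y)
  have htr : trial i (fun s => χ s * sechPow k b s) (fun s => χ s * (e * sechPow k (b + 1) s)) y =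
      χ y.1 * sechPow k b y.1 * (1 + x) := by
    rw [trial, hx, ← sechPow_mul]; ring
  have hpow : |χ y.1 * sechPow k b y.1 * (1 + x)| ^ p =
      χ y.1 ^ p * sechPow k (2 * b + 2) y.1 * |1 + x| ^ p := by
    rw [abs_mul, abs_mul, abs_of_nonneg (h0 _), abs_of_pos (sechPow_pos _ _ _),
      Real.mul_rpow (mul_nonneg (h0 _) (sechPow_pos _ _ _).le) (abs_nonneg _),
      Real.mul_rpow (h0 _) (sechPow_pos _ _ _).le, sechPow_rpow, hbp]
  have e3 : sechPow k (2 * b + 3) y.1 = sechPow k (2 * b + 2) y.1 * sechPow k 1 y.1 := by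
    rw [sechPow_mul]; congr 1; ring
  have e4 : sechPow k (2 * b + 2 + 2) y.1 = sechPow k (2 * b + 2) y.1 * sechPow k 1 y.1 ^ 2 := by
    rw [sechPow_sq, sechPow_mul]; congr 1; ring
  simp only
  rw [htr, hpow, e3, e4]
  calc _ = χ y.1 ^ p * sechPow k (2 * b + 2) y.1 * (1 + p * x + c * x ^ 2) := by rw [hx]; ring
    _ ≤ _ := mul_le_mul_of_nonneg_left (hquad x hxe)
      (mul_nonneg (Real.rpow_nonneg (h0 _) _) (sechPow_pos _ _ _).le)

/-- The computation of the sign of the second variation. -/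
lemma second_variation_neg {p θ L D l : ℝ} (hp : 2 < p) (hl0 : 0 < l)
    (hl : l * (2 * p * θ - (p - 2)) = L * (p + 2)) (hlD : 4 * D < l * ((p - 2) * (p + 2)))
    (hθ : (p - 2) / (2 * p) < θ) :
    θ * ((l * p ^ 2 * (p - 2) / (4 * (3 * p - 2)) + D + L) / (l * (p - 2) / 4 + L * ((p + 2) / 4))) +
      (1 - θ) * (4 / (p + 2)) < (p - 1) * (2 * p / (3 * p - 2)) := by
  have hp3 : 0 < 3 * p - 2 := by linarith
  have hp0 : 0 < p := by linarith
  have hp2 : 0 < p + 2 := by linarith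
  have hθ0 : 0 < θ := (div_pos (by linarith) (by linarith : 0 < 2 * p)).trans hθ
  -- The criticality relation `hl` eliminates `L`; afterwards `D` enters only through `2 * D / (l *
  -- p)`.
  have hE : l * (p - 2) / 4 + L * ((p + 2) / 4) = l * p * θ / 2 := by linear_combination -hl / 4
  have hL : L = l * (2 * p * θ - (p - 2)) / (p + 2) := by
    rw [eq_div_iff hp2.ne']; exact hl.symm
  rw [hE]
  have e : θ * ((l * p ^ 2 * (p - 2) / (4 * (3 * p - 2)) + D + L) / (l * p * θ / 2)) +
      (1 - θ) * (4 / (p + 2)) = p * (p - 2) / (2 * (3 * p - 2)) + 2 * D / (l * p) + 2 / p := by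
    rw [hL]; field_simp; ring
  rw [e]
  have h1 : 2 * D / (l * p) < (p - 2) * (p + 2) / (2 * p) := by
    rw [div_lt_div_iff₀ (by positivity) (by positivity)]
    nlinarith
  -- The borderline case `4D = l(p-2)(p+2)`, in which the second variation vanishes.
  have h2 : p * (p - 2) / (2 * (3 * p - 2)) + (p - 2) * (p + 2) / (2 * p) + 2 / p =
      (p - 1) * (2 * p / (3 * p - 2)) := by
    have h3 : (p - 2) * (p + 2) / (2 * p) + 2 / p = p / 2 := by field_simp; ring
    rw [add_assoc, h3, div_add_div _ _ (by positivity) two_ne_zero, mul_div_assoc',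
      div_eq_div_iff (by positivity) hp3.ne']
    ring
  linarith

/-- A weighted arithmetic-geometric mean estimate with prefactors. -/
lemma scaled_geom_mean_lt {θ q P Q N x y z : ℝ} (hθ0 : 0 ≤ θ) (hθ1 : θ ≤ 1) (hP : 0 < P)
    (hQ : 0 < Q) (hN : 0 < N) (hx : 0 ≤ x) (hy : 0 ≤ y) (hz : 0 ≤ z)
    (h : θ * x + (1 - θ) * y < z ^ q) :
    N ^ q / (P ^ θ * Q ^ (1 - θ)) * ((P * x) ^ θ * (Q * y) ^ (1 - θ)) < (N * z) ^ q := by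
  have h1 := Real.geom_mean_le_arith_mean2_weighted hθ0 (sub_nonneg.2 hθ1) hx hy (by ring)
  have hP' : 0 < P ^ θ := Real.rpow_pos_of_pos hP _
  have hQ' : 0 < Q ^ (1 - θ) := Real.rpow_pos_of_pos hQ _
  rw [Real.mul_rpow hP.le hx, Real.mul_rpow hQ.le hy, Real.mul_rpow hN.le hz]
  generalize P ^ θ = P' at *
  generalize Q ^ (1 - θ) = Q' at *
  calc _ = N ^ q * (x ^ θ * y ^ (1 - θ)) := by field_simp
    _ < _ := mul_lt_mul_of_pos_left (h1.trans_lt h) (Real.rpow_pos_of_pos hN _)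

set_option maxHeartbeats 1000000 in
/-- Symmetry breaking follows from the second variation of the energy at the optimizer on the
line in the direction of the first spherical harmonics. -/
lemma symmetryBreaking_of_freq {d : ℕ} (hd : 2 ≤ d) {p θ a : ℝ} (hp : 2 < p)
    (hL : 0 < ((d : ℝ) - 2 - 2 * a) ^ 2 / 4) (hθ : (p - 2) / (2 * p) < θ) (hθ1 : θ ≤ 1)
    (hfreq : 4 * ((d : ℝ) - 1) <
      lineFreq p θ (((d : ℝ) - 2 - 2 * a) ^ 2 / 4) * ((p - 2) * (p + 2))) :
    SymmetryBreaking d θ p a := by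
  have hp0 : 0 < p := by linarith
  have hp2 : 0 < p - 2 := by linarith
  have hp3 : 0 < 3 * p - 2 := by linarith
  have hθ0 : 0 < θ := (div_pos (by linarith) (by linarith : 0 < 2 * p)).trans hθ
  have hd0 : (0 : ℝ) < d := by exact_mod_cast (by omega : 0 < d)
  have hd1 : (2 : ℝ) ≤ d := by exact_mod_cast hd
  have hSB := fun (f h : ℝ → ℝ) (hf : ContDiff ℝ ∞ f) (hh : ContDiff ℝ ∞ h) =>
    fun (K : Set ℝ) => symmetryBreaking_of_trial hd hp hL hθ hθ1 ⟨0, by omega⟩ hf hh (K := K)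
  set L := ((d : ℝ) - 2 - 2 * a) ^ 2 / 4 with hLdef
  set k := lineRate p θ L with hk
  set l := lineFreq p θ L with hl
  set N := lineMass p θ L with hN
  have hk0 : 0 < k := lineRate_pos hp hL hθ
  have hl0 : 0 < l := lineFreq_pos hp hL hθ
  have hN0 : 0 < N := lineMass_pos hp hL hθ
  set b := 2 / (p - 2) with hb
  have hb0 : 0 < b := div_pos two_pos hp2
  have hlden : l * (2 * p * θ - (p - 2)) = L * (p + 2) :=
    div_mul_cancel₀ _ (lineFreq_denom_pos hp hθ).ne'
  -- the integrals of the unperturbed optimizer and of the perturbation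
  set B := ∫ s, sechPow k (2 * b + 2 + 2) s with hB
  have hBN : B = 2 * p / (3 * p - 2) * N := by
    have h := integral_sechPow_add_two (c := 2 * b + 2) hk0 (by positivity)
    rw [← hB] at h
    have hN' : ∫ s, sechPow k (2 * b + 2) s = N := rfl
    rw [hN'] at h
    have e1 : (2 * b + 2 + 1) * (p - 2) = 3 * p - 2 := by rw [hb]; field_simp; ring
    have e2 : (2 * b + 2) * (p - 2) = 2 * p := by rw [hb]; field_simp; ring
    rw [div_mul_eq_mul_div, eq_div_iff hp3.ne']
    linear_combination (p - 2) * h - B * e1 + N * e2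
  have hY : ∫ s, sechPow k b s ^ 2 = (p + 2) / 4 * N := by
    simp only [sechPow_sq]; exact integral_optimizer_sq hp hL hθ
  have hX : ∫ s, deriv (sechPow k b) s ^ 2 = l * (p - 2) / 4 * N :=
    integral_deriv_optimizer_sq hp hL hθ
  -- The radial profile of the perturbation is `w^{p/2}`, because `b p / 2 = b + 1`.
  have hψ : ∫ s, sechPow k (b + 1) s ^ 2 = N := by
    simp only [sechPow_sq]
    rw [show 2 * (b + 1) = 2 * b + 2 by ring]; rfl
  have hψ' : ∫ s, deriv (sechPow k (b + 1)) s ^ 2 = l * p ^ 2 / 4 * (N - B) := by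
    rw [integral_deriv_sechPow_sq hk0 (by positivity), show 2 * (b + 1) = 2 * b + 2 by ring, ← hB]
    have e1 : k * (b + 1) = √l * (p / 2) := by
      rw [← lineRate_mul hp, ← hk, ← hb, hb]; field_simp; ring
    rw [e1, mul_pow, Real.sq_sqrt hl0.le]
    change l * (p / 2) ^ 2 * (N - B) = _
    ring
  have iw : ∀ c : ℝ, 0 < c → Integrable fun s => sechPow k c s ^ 2 := fun c hc => by
    simp only [sechPow_sq]; exact integrable_sechPow hk0 (by linarith)
  -- the perturbation parameter
  set e₂ := (l * p ^ 2 * (p - 2) / (4 * (3 * p - 2)) + ((d : ℝ) - 1) + L) /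
    (l * (p - 2) / 4 + L * ((p + 2) / 4)) with he₂
  have hneg := second_variation_neg hp hl0 hlden hfreq hθ
  rw [← he₂] at hneg
  set r := 2 * p / (3 * p - 2) with hr
  have hr0 : 0 < r := by positivity
  -- With `t = e²/d`, energy and mass of the trial function grow by the factors `1 + t e₂` and `1 +
  -- 4t/(p+2)`, so `β` is the slope of their weighted mean. It competes with the slope `(2/p) c r`
  -- from the `p`-th power integral.
  set β := θ * e₂ + (1 - θ) * (4 / (p + 2)) with hβ
  -- Strict negativity of the second variation leaves room to take `c` below the Taylor coefficient
  -- `p(p-1)/2`, so no estimate of the remainder is needed.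
  obtain ⟨c, hc1, hc2⟩ : ∃ c, p * β / (2 * r) < c ∧ c < p * (p - 1) / 2 := by
    refine exists_between ?_
    rw [div_lt_div_iff₀ (by positivity) two_pos]
    nlinarith
  have hcβ : β < 2 / p * (c * r) := by
    rw [div_lt_iff₀ (by positivity)] at hc1
    rw [div_mul_eq_mul_div, lt_div_iff₀ hp0]
    nlinarith
  obtain ⟨δ, hδ0, hδ⟩ := Metric.eventually_nhds_iff.1 (eventually_quadratic_le_rpow hc2)
  have hev : ∀ᶠ e : ℝ in 𝓝[>] 0, 1 + e ^ 2 / d * β < (1 + e ^ 2 / d * (c * r)) ^ (2 / p) := by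
    have ht : Tendsto (fun e : ℝ => e ^ 2 / d) (𝓝[>] 0) (𝓝[>] 0) := by
      refine tendsto_nhdsWithin_iff.2 ⟨?_, ?_⟩
      · have : Tendsto (fun e : ℝ => e ^ 2 / d) (𝓝 0) (𝓝 (0 ^ 2 / d)) :=
          ((continuous_id.pow 2).div_const _).tendsto 0
        rw [zero_pow two_ne_zero, zero_div] at this
        exact this.mono_left nhdsWithin_le_nhds
      · filter_upwards [self_mem_nhdsWithin] with e he
        have : 0 < e := he
        exact Set.mem_Ioi.2 (by positivity)
    exact ht.eventually (eventually_affine_lt_rpow hcβ)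
  obtain ⟨e, he1, he2, he0⟩ : ∃ e : ℝ, 1 + e ^ 2 / d * β < (1 + e ^ 2 / d * (c * r)) ^ (2 / p) ∧
      e < δ ∧ 0 < e := by
    have h2 : ∀ᶠ e : ℝ in 𝓝[>] 0, e < δ := (eventually_lt_nhds hδ0).filter_mono nhdsWithin_le_nhds
    exact (hev.and (h2.and self_mem_nhdsWithin)).exists
  have hquad : ∀ x : ℝ, |x| ≤ e → 1 + p * x + c * x ^ 2 ≤ |1 + x| ^ p := fun x hx =>
    hδ (by rw [Real.dist_eq, sub_zero]; exact hx.trans_lt he2)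
  -- the truncated trial functions
  obtain ⟨χ, C, hχs, hχK, hχ0, hχ1, hχC, hχlim⟩ := exists_cutoff
  set t := e ^ 2 / d with ht
  have ht0 : 0 < t := by positivity
  set f : ℕ → ℝ → ℝ := fun n s => χ n s * sechPow k b s with hf
  set h : ℕ → ℝ → ℝ := fun n s => χ n s * (e * sechPow k (b + 1) s) with hh
  have hχc := fun n => (hχs n).continuous
  have hlim1 := fun s => (hχlim s).mono fun n hn => hn.1
  have hes : ContDiff ℝ ∞ fun s => e * sechPow k (b + 1) s := contDiff_const.mul (contDiff_sechPow k _)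
  have hed : ∀ s, deriv (fun s => e * sechPow k (b + 1) s) s ^ 2 =
      e ^ 2 * deriv (sechPow k (b + 1)) s ^ 2 := fun s => by
    rw [deriv_const_mul _ ((contDiff_sechPow k _).differentiable (by simp) s), mul_pow]
  have ie0 : Integrable fun s => (e * sechPow k (b + 1) s) ^ 2 := by
    simp only [mul_pow]; exact (iw _ (by positivity)).const_mul _
  have ie1 : Integrable fun s => deriv (fun s => e * sechPow k (b + 1) s) s ^ 2 := by
    simp only [hed]; exact (integrable_deriv_sechPow_sq hk0 (by positivity)).const_mul _
  have lf := tendsto_integral_cutoff_sq hχ0 hχ1 hχc hlim1 (iw b hb0)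
  have lh := tendsto_integral_cutoff_sq hχ0 hχ1 hχc hlim1 ie0
  have lf' := tendsto_integral_deriv_cutoff_sq hχ0 hχ1 hχs hχC hχlim (contDiff_sechPow k b)
    (iw b hb0) (integrable_deriv_sechPow_sq hk0 hb0)
  have lh' := tendsto_integral_deriv_cutoff_sq hχ0 hχ1 hχs hχC hχlim hes ie0 ie1
  simp only [hed, integral_const_mul, hψ'] at lh'
  simp only [mul_pow e, integral_const_mul, hψ] at lh
  rw [hX] at lf'
  rw [hY] at lf
  have lM : Tendsto (fun n => trialMass d (f n) (h n)) atTop (𝓝 ((p + 2) / 4 * N + t * N)) := by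
    have := lf.add (lh.const_mul (1 / (d : ℝ)))
    have e1 : (p + 2) / 4 * N + 1 / (d : ℝ) * (e ^ 2 * N) = (p + 2) / 4 * N + t * N := by
      rw [ht]; ring
    rw [e1] at this
    exact this
  have lE : Tendsto (fun n => trialEnergy d L (f n) (h n)) atTop
      (𝓝 ((l * (p - 2) / 4 + L * ((p + 2) / 4)) * N +
        t * (l * p ^ 2 / 4 * (N - B) + (((d : ℝ) - 1) + L) * N))) := by
    have := ((lf'.add (lh'.const_mul (1 / (d : ℝ)))).add (lh.const_mul (1 - 1 / (d : ℝ)))).add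
      (lM.const_mul L)
    have e1 : l * (p - 2) / 4 * N + 1 / (d : ℝ) * (e ^ 2 * (l * p ^ 2 / 4 * (N - B))) +
        (1 - 1 / (d : ℝ)) * (e ^ 2 * N) + L * ((p + 2) / 4 * N + t * N) =
        (l * (p - 2) / 4 + L * ((p + 2) / 4)) * N +
        t * (l * p ^ 2 / 4 * (N - B) + (((d : ℝ) - 1) + L) * N) := by
      rw [ht]; field_simp; ring
    rw [e1] at this
    exact this
  set m : ℕ → ℝ := fun n => (∫ s, χ n s ^ p * sechPow k (2 * b + 2) s) + t * c *
    ∫ s, χ n s ^ p * sechPow k (2 * b + 2 + 2) s with hm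
  have lm : Tendsto m atTop (𝓝 (N + t * c * B)) :=
    (tendsto_integral_cutoff_rpow hχ0 hχ1 hχc hlim1 hp0.le
      (integrable_sechPow hk0 (by positivity))).add
      ((tendsto_integral_cutoff_rpow hχ0 hχ1 hχc hlim1 hp0.le
        (integrable_sechPow hk0 (by positivity))).const_mul _)
  -- the strict inequality in the limit
  have hE₀ : 0 < l * (p - 2) / 4 + L * ((p + 2) / 4) := by positivity
  have he₂0 : 0 < e₂ := by
    have : 0 < (d : ℝ) - 1 := by linarith
    positivity
  have hy0 : 0 < 4 / (p + 2) := by positivity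
  have hβ0 : 0 < β := add_pos_of_pos_of_nonneg (by positivity)
    (mul_nonneg (by linarith) hy0.le)
  have hcr : 0 < c * r := by
    by_contra hcon
    have : 2 / p * (c * r) ≤ 0 := mul_nonpos_of_nonneg_of_nonpos (by positivity) (not_lt.1 hcon)
    linarith
  have eE : (l * (p - 2) / 4 + L * ((p + 2) / 4)) * N +
      t * (l * p ^ 2 / 4 * (N - B) + (((d : ℝ) - 1) + L) * N) =
      (l * (p - 2) / 4 + L * ((p + 2) / 4)) * N * (1 + t * e₂) := by
    have e3 : N - B = (p - 2) / (3 * p - 2) * N := by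
      rw [hBN, hr, div_mul_eq_mul_div, div_mul_eq_mul_div, eq_div_iff hp3.ne', sub_mul,
        div_mul_cancel₀ _ hp3.ne']
      ring
    have e4 : (l * (p - 2) / 4 + L * ((p + 2) / 4)) * e₂ =
        l * p ^ 2 * (p - 2) / (4 * (3 * p - 2)) + ((d : ℝ) - 1) + L := mul_div_cancel₀ _ hE₀.ne'
    have e5 : l * p ^ 2 / 4 * ((p - 2) / (3 * p - 2)) = l * p ^ 2 * (p - 2) / (4 * (3 * p - 2)) := by
      rw [div_mul_div_comm]
    rw [e3]
    linear_combination (-N * t) * e4 + (t * N) * e5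
  have eM : (p + 2) / 4 * N + t * N = (p + 2) / 4 * N * (1 + t * (4 / (p + 2))) := by
    field_simp
  have em : N + t * c * B = N * (1 + t * (c * r)) := by rw [hBN]; ring
  rw [eE] at lE
  rw [eM] at lM
  rw [em] at lm
  have hβ' : 1 + t * β = θ * (1 + t * e₂) + (1 - θ) * (1 + t * (4 / (p + 2))) := by
    rw [hβ]; ring
  have hfin : lineConst p θ L * (((l * (p - 2) / 4 + L * ((p + 2) / 4)) * N * (1 + t * e₂)) ^ θ *
      ((p + 2) / 4 * N * (1 + t * (4 / (p + 2)))) ^ (1 - θ)) < (N * (1 + t * (c * r))) ^ (2 / p) := by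
    refine scaled_geom_mean_lt hθ0.le hθ1 (mul_pos hE₀ hN0) (by positivity) hN0 (by positivity)
      (by positivity) (by positivity) ?_
    rw [← hβ']
    exact he1
  have hlimL := ((lE.rpow_const (p := θ) (Or.inr hθ0.le)).mul
    (lM.rpow_const (p := 1 - θ) (Or.inr (by linarith)))).const_mul (lineConst p θ L)
  have hlimR := lm.rpow_const (p := 2 / p) (Or.inr (by positivity))
  obtain ⟨n, hn, hmn⟩ := ((hlimL.eventually_lt hlimR hfin).and
    (lm.eventually_const_lt (by positivity : 0 < N * (1 + t * (c * r))))).exists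
  obtain ⟨K, hK, hK0⟩ := hχK n
  exact hSB (f n) (h n) ((hχs n).mul (contDiff_sechPow k b)) ((hχs n).mul hes) K hK
    (fun s hs => by simp [hf, hK0 s hs]) (fun s hs => by simp [hh, hK0 s hs]) hmn.le
    (lintegral_trial_rpow_ge hd _ hp he0.le hquad (hχc n) (hχ0 n) hK hK0)
    (trialMass_nonneg _ _ _) (trialEnergy_nonneg hd hL.le _ _) hn

/-! ### The thresholds in terms of `L = (d-2-2a)²/4`, and the conclusion. -/

/-- The identity behind it is `d² + 4a² - 4a(d-2) = (d-2-2a)² + 4(d-1)`. -/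
lemma capTheta_eq {d : ℕ} (a p : ℝ) : capTheta a p d = (p - 2) / (8 * ((d : ℝ) - 1) * p) *
    ((p + 2) ^ 2 * (((d : ℝ) - 2 - 2 * a) ^ 2 / 4) + 4 * ((d : ℝ) - 1)) := by
  rw [capTheta, show (p - 2) / (32 * ((d : ℝ) - 1) * p) =
    (p - 2) / (8 * ((d : ℝ) - 1) * p) * (1 / 4) by
      rw [div_mul_div_comm]; congr 1 <;> ring]
  ring

/-- Inserting `l = L(p+2)/(2pθ-(p-2))`, the condition `4(d-1) < l(p²-4)` is linear in `θ` and reads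
`θ < Θ`. The denominator is positive because `ϑ = d(p-2)/(2p)` with `d ≥ 2`. -/
lemma symmetryBreaking_of_lt_capTheta {d : ℕ} (hd : 2 ≤ d) {p θ a : ℝ} (hp : 2 < p)
    (ha : a < ((d : ℝ) - 2) / 2) (hθ : vartheta p d ≤ θ) (hθ1 : θ ≤ 1)
    (hΘ : θ < capTheta a p d) : SymmetryBreaking d θ p a := by
  have hd1 : (2 : ℝ) ≤ d := by exact_mod_cast hd
  have hD : 0 < (d : ℝ) - 1 := by linarith
  have hp0 : 0 < p := by linarith
  have hL : 0 < ((d : ℝ) - 2 - 2 * a) ^ 2 / 4 := by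
    have : 0 < (d : ℝ) - 2 - 2 * a := by linarith
    positivity
  have hθ' : (p - 2) / (2 * p) < θ := by
    refine lt_of_lt_of_le ?_ hθ
    rw [vartheta]
    gcongr
    nlinarith
  refine symmetryBreaking_of_freq hd hp hL hθ' hθ1 ?_
  have hden := lineFreq_denom_pos hp hθ'
  rw [lineFreq, div_mul_eq_mul_div, lt_div_iff₀ hden]
  rw [capTheta_eq, div_mul_eq_mul_div, lt_div_iff₀ (by positivity)] at hΘ
  nlinarith

end CKN

theorem mainTheorem8 (d : ℕ) (hd : 2 ≤ d) (a : ℝ) :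
    (∀ p : ℝ, 2 < p → (p : EReal) < CKN.twoStar d → a < CKN.aMinus p d →
      (CKN.aThreshold p d ≤ a →
        ∀ θ : ℝ, CKN.vartheta p d ≤ θ → θ < CKN.capTheta a p d →
          CKN.SymmetryBreaking d θ p a) ∧
      (a < CKN.aThreshold p d →
        ∀ θ : ℝ, CKN.vartheta p d ≤ θ → θ ≤ 1 →
          CKN.SymmetryBreaking d θ p a)) ∧
    (a < -1 / 2 →
      ∃ ε γ₁ γ₂ : ℝ, 0 < ε ∧ (d : ℝ) / 4 < γ₁ ∧ γ₁ < γ₂ ∧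
        ∀ γ ∈ Set.Ioo γ₁ γ₂, ∀ p ∈ Set.Ioo (2 : ℝ) (2 + ε),
          (p : EReal) < CKN.twoStar d ∧
          CKN.vartheta p d ≤ γ * (p - 2) ∧ γ * (p - 2) ≤ 1 ∧
          CKN.SymmetryBreaking d (γ * (p - 2)) p a) := by
  have hd1 : (2 : ℝ) ≤ d := by exact_mod_cast hd
  have hD : 0 < (d : ℝ) - 1 := by linarith
  refine ⟨fun p hp _ ha => ?_, fun ha => ?_⟩
  · have hp0 : 0 < p := by linarith
    have hp2 : 0 < p - 2 := by linarith
    have ha' : a < ((d : ℝ) - 2) / 2 := by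
      rw [CKN.aMinus] at ha
      have : 0 ≤ 2 * ((d : ℝ) - 1) / (p + 2) := by positivity
      linarith
    have hx : 0 < (d : ℝ) - 2 - 2 * a := by linarith
    have hq : 0 < (p - 2) * (p + 2) := by positivity
    -- the value of the threshold
    have hthr : ∀ τ : ℝ, τ = 2 * √((d : ℝ) - 1) / √((p - 2) * (p + 2)) →
        0 ≤ τ ∧ τ ^ 2 * ((p - 2) * (p + 2)) = 4 * ((d : ℝ) - 1) := by
      rintro τ rfl
      refine ⟨by positivity, ?_⟩
      rw [div_pow, mul_pow, Real.sq_sqrt hD.le, Real.sq_sqrt hq.le]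
      field_simp
      norm_num
    obtain ⟨hτ0, hτ⟩ := hthr _ rfl
    refine ⟨fun hth θ h1 h2 => ?_, fun hth θ h1 h2 => ?_⟩
    · refine CKN.symmetryBreaking_of_lt_capTheta hd hp ha' h1 (h2.le.trans ?_) h2
      rw [CKN.aThreshold] at hth
      set τ := 2 * √((d : ℝ) - 1) / √((p - 2) * (p + 2))
      have hsq : ((d : ℝ) - 2 - 2 * a) ^ 2 / 4 ≤ τ ^ 2 := by
        have : ((d : ℝ) - 2 - 2 * a) / 2 ≤ τ := by linarith
        calc _ = (((d : ℝ) - 2 - 2 * a) / 2) ^ 2 := by ring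
          _ ≤ _ := by gcongr
      rw [CKN.capTheta_eq, div_mul_eq_mul_div, div_le_one (by positivity)]
      have := mul_le_mul_of_nonneg_left hsq (by positivity : 0 ≤ (p - 2) * (p + 2) ^ 2)
      nlinarith
    · refine CKN.symmetryBreaking_of_lt_capTheta hd hp ha' h1 h2 (h2.trans_lt ?_)
      rw [CKN.aThreshold] at hth
      set τ := 2 * √((d : ℝ) - 1) / √((p - 2) * (p + 2))
      have hsq : τ ^ 2 < ((d : ℝ) - 2 - 2 * a) ^ 2 / 4 := by
        have : τ < ((d : ℝ) - 2 - 2 * a) / 2 := by linarith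
        calc _ < (((d : ℝ) - 2 - 2 * a) / 2) ^ 2 := by gcongr
          _ = _ := by ring
      rw [CKN.capTheta_eq, div_mul_eq_mul_div, one_lt_div (by positivity)]
      have := mul_lt_mul_of_pos_left hsq (by positivity : 0 < (p - 2) * (p + 2) ^ 2)
      nlinarith
  · have hd0 : (0 : ℝ) < d := by linarith
    set L := ((d : ℝ) - 2 - 2 * a) ^ 2 / 4 with hL
    -- The two sides are the limits of `ϑ/(p-2)` and `Θ/(p-2)` as `p → 2`. The gap is positive
    -- because `a < -1/2` means `d-2-2a > d-1`.
    have hG : (d : ℝ) / 4 < 1 / 4 + L / (d - 1) := by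
      have : ((d : ℝ) - 1) / 4 < L / (d - 1) := by
        rw [lt_div_iff₀ hD, hL]
        nlinarith
      linarith
    obtain ⟨γ₂, h1, h2⟩ := exists_between hG
    obtain ⟨γ₁, h3, h4⟩ := exists_between h1
    have hγ₂ : 0 < γ₂ := lt_trans (by positivity) h1
    -- The three bounds on `p - 2` ensure, in this order, `γ(p-2) < Θ`, `γ(p-2) ≤ 1` and `p < 2^*`;
    -- the last uses `2^* - 2 = 4/(d-2) > 4/d` for `d ≥ 3`.
    refine ⟨min (8 * (1 / 4 + L / (d - 1) - γ₂)) (min (1 / γ₂) (4 / d)), γ₁, γ₂,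
      lt_min (by linarith) (by positivity), h3, h4, ?_⟩
    rintro γ ⟨hγ1, hγ2⟩ p ⟨hp, hpε⟩
    have hp0 : 0 < p := by linarith
    have hp2 : 0 < p - 2 := by linarith
    rw [← sub_lt_iff_lt_add', lt_min_iff, lt_min_iff, lt_div_iff₀ hγ₂, lt_div_iff₀ hd0] at hpε
    obtain ⟨hp1, hp3, hp4⟩ := hpε
    have hϑ : CKN.vartheta p d ≤ γ * (p - 2) := by
      rw [CKN.vartheta, div_le_iff₀ (by positivity)]
      have : (d : ℝ) ≤ γ * (2 * p) := by nlinarith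
      nlinarith
    have hθ1 : γ * (p - 2) ≤ 1 := by nlinarith
    refine ⟨?_, hϑ, hθ1, CKN.symmetryBreaking_of_lt_capTheta hd hp (by linarith) hϑ hθ1 ?_⟩
    · rw [CKN.twoStar]
      split_ifs with hd2
      · exact EReal.coe_lt_top p
      · have hd3 : (3 : ℝ) ≤ d := by exact_mod_cast (by omega : 3 ≤ d)
        rw [EReal.coe_lt_coe_iff, lt_div_iff₀ (by linarith)]
        nlinarith
    · have key : (p - 2) / (8 * ((d : ℝ) - 1) * p) * ((p + 2) ^ 2 * L + 4 * (d - 1)) =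
          ((p + 2) ^ 2 / (8 * p) * (L / (d - 1)) + 1 / (2 * p)) * (p - 2) := by
        field_simp
        ring
      rw [CKN.capTheta_eq, ← hL, key]
      -- Lower bounds exact at `p = 2`: here `(p+2)² ≥ 8p`, and in `h6` the tangent line of the
      -- convex function `1/(2p)`, whose slope `-1/8` is the source of the factor `8` in `ε`.
      have h5 : 1 ≤ (p + 2) ^ 2 / (8 * p) := by
        rw [one_le_div (by positivity)]
        nlinarith [sq_nonneg (p - 2)]
      have h6 : 1 / 4 - (p - 2) / 8 ≤ 1 / (2 * p) := by
        rw [le_div_iff₀ (by positivity)]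
        nlinarith [sq_nonneg (p - 2)]
      have h7 : 0 ≤ L / ((d : ℝ) - 1) := by positivity
      have h8 := le_mul_of_one_le_left h7 h5
      exact mul_lt_mul_of_pos_right (by linarith) hp2
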